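/- Let $k,n\ge 1$ be integers. Let $\mathcal P_{k,n}$ be the set of functions $\lambda:\mathbb Z\to\mathbb Z$ with $\lambda_{i+k}=\lambda_i-n$, put $|\lambda|=\lambda_1+\dots+\lambda_k$, and let $\mathcal A_{k,n}=\{\lambda\in\mathcal P_{k,n}: n\ge\lambda_1\ge\dots\ge\lambda_k>0\}$. Let $\mathcal P_k^+$ be the set of partitions with at most $k$ parts, regarded as elements $\nu\in\mathcal P_{k,n}$ with $\nu_1\ge\dots\ge\nu_k\ge 0$. The affine symmetric group $\tilde S_k$ consists of the bijections $w:\mathbb Z\to\mathbb Z$ with $w(m+k)=w(m)+k$ for all $m$ and $\sum_{m=1}^k w(m)=\sum_{m=1}^k m$; the symmetric group $S_k\subset\tilde S_k$ consists of those that preserve $\{1,\dots,k\}$. Put $\tau(m)=m-1$, and for $\alpha\in\mathbb Z^k$ let $y^\alpha$ be the translation $y^\alpha(m)=m-k\alpha_{m}$ (index of $\alpha$ modulo $k$), so that $\lambda\circ y^\alpha=\lambda+n\alpha$ on $\{1,\dots,k\}$; put $|\alpha|=\alpha_1+\dots+\alpha_k$. For a weight $\mu$ let $S_\mu\subset S_k$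 be its stabiliser under $(\mu,w)\mapsto\mu\circ w$, and let $S^\mu$ (respectively $\tilde S^\mu$) be the set of minimal length representatives of the cosets $S_\mu\backslash S_k$ (respectively $S_\mu\backslash\tilde S_k$). *The numbers $N$.* For $\mu,\lambda\in\mathcal A_{k,n}$ and $\nu\in\mathcal P_k^+$ let $N_{\mu\nu}^\lambda$ be the number of pairs $(w,w')\in S^\mu\times S^\nu$ such that $\mu\circ w+\nu\circ w'=\lambda\circ y^\alpha$ on $\{1,\dots,k\}$ for some $\alpha\in\mathbb Z^k$ with $|\alpha|=d$, where $|\nu|=nd+|\lambda|-|\mu|$ (so $N_{\mu\nu}^\lambda=0$ if no such integer $d$ exists). *Cylindric complete symmetric functions.* For $\lambda,\mu\in\mathcal A_{k,n}$ and $d\in\mathbb Z$ put $\lambda[d]=\lambda\circ\tau^d$, $\lambda/d/\mu=\{(i,j)\in\mathbb Z^2:\mu_i<j\le\lambda[d]_i\}$ and $\chi_{\lambda/d/\mu}=\#\{w\in\tilde S^\mu:\mu\circ w\le\lambda\circ\tau^d\}$. A cylindric reverse plane partition $\hat\pi$ of shape $\lambda/d/\mu$ is a sequence $(\lambda^{(i)},d_i)_{i\ge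 0}$ in $\mathcal A_{k,n}\times\mathbb Z$ with $(\lambda^{(0)},d_0)=(\mu,0)$, $d_{i-1}\le d_i$, $\lambda^{(i-1)}\le\lambda^{(i)}[d_i-d_{i-1}]$ for $i\ge1$, and $(\lambda^{(i)},d_i)=(\lambda,d)$ for all large $i$. Its weight is $\theta(\hat\pi)=(\theta_1,\theta_2,\dots)$, with $\theta_i$ the number of $(a,b)\in\lambda^{(i)}/(d_i-d_{i-1})/\lambda^{(i-1)}$ with $1\le a\le k$; put $x^{\hat\pi}=\prod_{i\ge 1} x_i^{\theta_i}$, $\chi_{\hat\pi}=\prod_{i\ge1}\chi_{\lambda^{(i)}/(d_i-d_{i-1})/\lambda^{(i-1)}}$ and $$h_{\lambda/d/\mu}=\sum_{\hat\pi}\chi_{\hat\pi}\,x^{\hat\pi},$$ the sum being over all $\hat\pi$ of shape $\lambda/d/\mu$, as a formal power series in $x_1,x_2,\dots$. For a partition $\rho$ let $\chi_{\lambda/d/\mu}(\rho)=\sum\chi_{\hat\pi}$, the sum being over the $\hat\pi$ of shape $\lambda/d/\mu$ and weight $\rho$. *The algebra.* Let $$\mathcal V_k(n)=\mathbb C[z^{\pm1}][x_1,\dots,x_k]^{S_k}/\langle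 p_n-zk,\;p_{n+1}-zp_1,\dots,p_{n+k-1}-zp_{k-1}\rangle,$$ where $p_r=x_1^r+\dots+x_k^r$. Write $m_\lambda$ for the monomial and $h_\rho=h_{\rho_1}h_{\rho_2}\cdots$ for the complete symmetric polynomials in $x_1,\dots,x_k$, and for their images in $\mathcal V_k(n)$. **Theorem.** (i) The family $(m_\lambda)_{\lambda\in\mathcal A_{k,n}}$ is a basis of $\mathcal V_k(n)$ over $\mathbb C[z^{\pm1}]$. With the $\mathbb C[z^{\pm1}]$-linear map $\varepsilon:\mathcal V_k(n)\to\mathbb C[z^{\pm1}]$ given by $\varepsilon(m_\lambda)=z^k\delta_{\lambda,n^k}/n^k$, where $n^k=(n,\dots,n)$, the pair $(\mathcal V_k(n),\varepsilon)$ is a Frobenius extension of $\mathbb C[z^{\pm1}]$: the structure map $\mathbb C[z^{\pm1}]\to\mathcal V_k(n)$ is injective, $\mathcal V_k(n)$ is a finitely generated projective module, and $b\mapsto\varepsilon(b\,\cdot)$ is a bijection from $\mathcal V_k(n)$ onto $\operatorname{Hom}_{\mathbb C[z^{\pm1}]}(\mathcal V_k(n),\mathbb C[z^{\pm1}])$.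 (ii) For all $\lambda,\mu\in\mathcal A_{k,n}$ and every partition $\rho$ one has in $\mathcal V_k(n)$ $$m_\lambda m_\mu=\sum_{\nu\in\mathcal A_{k,n}}z^{\frac{|\lambda|+|\mu|-|\nu|}{n}}N_{\lambda\mu}^{\nu}\,m_\nu,\qquad h_\rho m_\mu=\sum_{\nu\in\mathcal A_{k,n}}z^{d}\chi_{\nu/d/\mu}(\rho)\,m_\nu,\quad d=\tfrac{|\rho|+|\mu|-|\nu|}{n},$$ where terms with a non-integral exponent of $z$ are zero. The coefficients are the expansion coefficients of the cylindric complete symmetric functions: for all $\lambda,\mu\in\mathcal A_{k,n}$ and all integers $d\ge0$ (with $m_\rho$, $h_\nu$ now in infinitely many variables), $$h_{\lambda/d/\mu}=\sum_{\nu\in\mathcal P_k^+,\;|\nu|=nd+|\lambda|-|\mu|}N_{\mu\nu}^\lambda\,h_\nu=\sum_{\rho\,\vdash\, nd+|\lambda|-|\mu|}\chi_{\lambda/d/\mu}(\rho)\,m_\rho .$$ -/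

import Mathlib

open Finset

/-! ## Frobenius extensions -/

/-- A commutative ring extension `A → B` with an `A`-linear map `ε : B → A` is a Frobenius extension:
`B` is a finitely generated projective `A`-module and `b ↦ ε (b * ·)` is a bijection from `B` onto
the dual module `Hom_A(B, A)`. -/
structure IsFrobeniusExtension {A B : Type*} [CommRing A] [CommRing B] [Algebra A B]
    (ε : B →ₗ[A] A) : Prop where
  injective : Function.Injective (algebraMap A B)
  finite : Module.Finite A B
  projective : Module.Projective A B
  bijective : Function.Bijective (fun b : B => (ε ∘ₗ LinearMap.mul A B b : Module.Dual A B))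

/-! ## Weights and the alcove

A weight of `gl_k` is given by its values `l 1, …, l k`, extended to a function `l : ℤ → ℤ`
by `l (i + k) = l i - n`. -/

/-- The set `P_{k,n}` of functions `l : ℤ → ℤ` with `l (i + k) = l i - n`. -/
def cylWeight (k n : ℕ) : Set (ℤ → ℤ) :=
  {l | ∀ i, l (i + k) = l i - n}

/-- The alcove `A_{k,n}`: `n ≥ l 1 ≥ l 2 ≥ ⋯ ≥ l k > 0`. -/
def alcove (k n : ℕ) : Set (ℤ → ℤ) :=
  {l | l ∈ cylWeight k n ∧ l 1 ≤ n ∧ (∀ i : ℤ, 1 ≤ i → i < k → l (i + 1) ≤ l i) ∧ 0 < l k}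

/-- The set `P_k^+` of partitions with at most `k` parts: `l 1 ≥ l 2 ≥ ⋯ ≥ l k ≥ 0`. -/
def dominantWeight (k n : ℕ) : Set (ℤ → ℤ) :=
  {l | l ∈ cylWeight k n ∧ (∀ i : ℤ, 1 ≤ i → i < k → l (i + 1) ≤ l i) ∧ 0 ≤ l k}

/-- The size `|l| = l 1 + ⋯ + l k`. -/
noncomputable def wsize (k : ℕ) (l : ℤ → ℤ) : ℤ := ∑ i ∈ Icc (1 : ℤ) k, l i

/-- The partition whose parts are the nonzero numbers among `l 1, …, l k` (used for `l i ≥ 0`). -/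
noncomputable def weightPartition (k : ℕ) (l : ℤ → ℤ) :
    Nat.Partition ((Icc (1 : ℤ) k).val.map (fun i => (l i).toNat)).sum :=
  Nat.Partition.ofMultiset ((Icc (1 : ℤ) k).val.map (fun i => (l i).toNat))

theorem alcove_mem_Icc {k n : ℕ} {l : ℤ → ℤ} (hl : l ∈ alcove k n) {i : ℤ}
    (h1 : 1 ≤ i) (hk : i ≤ k) : l i ∈ Set.Icc (0 : ℤ) n := by
  obtain ⟨-, h2, h3, h4⟩ := hl
  constructor
  · have key : ∀ j : ℕ, (1 : ℤ) ≤ k - j → 0 < l (k - j) := by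
      intro j
      induction j with
      | zero => intro _; simpa using h4
      | succ j ih =>
        intro hj
        push_cast at hj
        have h5 := ih (by omega)
        have h6 := h3 (k - (j + 1)) (by omega) (by omega)
        rw [show (k : ℤ) - (j + 1) + 1 = k - j by ring] at h6
        push_cast
        omega
    have h7 := key (k - i).toNat (by omega)
    rw [show (k : ℤ) - ((k - i).toNat : ℕ) = i by omega] at h7
    exact h7.le
  · have key : ∀ j : ℕ, (1 : ℤ) + j ≤ k → l (1 + j) ≤ n := by
      intro j
      induction j with
      | zero => intro _; simpa using h2
      | succ j ih =>
        intro hj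
        push_cast at hj
        have h5 := ih (by omega)
        have h6 := h3 (1 + j) (by omega) (by omega)
        push_cast
        rw [show (1 : ℤ) + (j + 1) = 1 + j + 1 by ring]
        omega
    have h7 := key (i - 1).toNat (by omega)
    rwa [show (1 : ℤ) + ((i - 1).toNat : ℕ) = i by omega] at h7

instance alcove_finite (k n : ℕ) [NeZero k] : Finite (alcove k n) := by
  have hk : (0 : ℤ) < k := by exact_mod_cast Nat.pos_of_ne_zero (NeZero.ne k)
  let f : alcove k n → (Set.Icc (1 : ℤ) k → Set.Icc (0 : ℤ) n) :=
    fun l i => ⟨l.1 i.1, alcove_mem_Icc l.2 i.2.1 i.2.2⟩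
  refine Finite.of_injective f ?_
  intro l m hlm
  have heq : ∀ i : ℤ, 1 ≤ i → i ≤ k → l.1 i = m.1 i := by
    intro i h1 h2
    have h3 := congrFun hlm ⟨i, h1, h2⟩
    exact congrArg Subtype.val h3
  have per : ∀ x : alcove k n, ∀ (i : ℤ) (q : ℤ), x.1 (i + k * q) = x.1 i - n * q := by
    intro x i q
    induction q using Int.induction_on with
    | zero => simp
    | succ q ih =>
      have := x.2.1 (i + k * q)
      rw [show i + k * ((q : ℤ) + 1) = i + k * q + k by ring, this, ih]; ring
    | pred q ih =>
      have := x.2.1 (i + k * (-(q : ℤ) - 1))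
      rw [show i + k * (-(q : ℤ) - 1) + k = i + k * (-q) by ring, ih] at this
      linarith
  apply Subtype.ext
  funext i
  have h5 : i = ((i - 1) % k + 1) + k * ((i - 1) / k) := by
    have := Int.emod_add_mul_ediv (i - 1) k
    linarith
  have h6 := Int.emod_nonneg (i - 1) hk.ne'
  have h7 := Int.emod_lt_of_pos (i - 1) hk
  rw [h5, per, per, heq _ (by omega) (by omega)]

noncomputable instance alcove_fintype (k n : ℕ) [NeZero k] : Fintype (alcove k n) :=
  Fintype.ofFinite _

/-! ## The (extended) affine symmetric group as bijections of `ℤ` -/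

/-- The symmetric group `S_k`: bijections `w` of `ℤ` with `w (m + k) = w m + k` that map
`{1, …, k}` to itself. -/
def finSym (k : ℕ) : Set (Equiv.Perm ℤ) :=
  {w | (∀ m, w (m + k) = w m + k) ∧ ∀ m ∈ Icc (1 : ℤ) k, w m ∈ Icc (1 : ℤ) k}

/-- The affine symmetric group: bijections `w` of `ℤ` with `w (m + k) = w m + k` and
`w 1 + ⋯ + w k = 1 + ⋯ + k`. -/
def affSym (k : ℕ) : Set (Equiv.Perm ℤ) :=
  {w | (∀ m, w (m + k) = w m + k) ∧ ∑ m ∈ Icc (1 : ℤ) k, w m = ∑ m ∈ Icc (1 : ℤ) k, m}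

/-- The Coxeter length: the number of inversions `i < j`, `w j < w i`, with `1 ≤ i ≤ k`. -/
noncomputable def symLength (k : ℕ) (w : Equiv.Perm ℤ) : ℕ :=
  Set.ncard {p : ℤ × ℤ | 1 ≤ p.1 ∧ p.1 ≤ k ∧ p.1 < p.2 ∧ w p.2 < w p.1}

/-- The stabiliser `S_μ ⊆ S_k` of a weight for the right action `(μ, w) ↦ μ ∘ w`. -/
def weightStab (k : ℕ) (mu : ℤ → ℤ) : Set (Equiv.Perm ℤ) :=
  {u | u ∈ finSym k ∧ mu ∘ u = mu}

/-- The minimal length representatives in `G` of the right cosets `S_μ w`. For `G = finSym k` this is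
`S^μ`, for `G = affSym k` it is the affine version. -/
def minReps (k : ℕ) (G : Set (Equiv.Perm ℤ)) (mu : ℤ → ℤ) : Set (Equiv.Perm ℤ) :=
  {w | w ∈ G ∧ ∀ u ∈ weightStab k mu, symLength k w ≤ symLength k (u * w)}

/-- The shift operator `τ m = m - 1`. -/
def tau : Equiv.Perm ℤ := Equiv.subRight 1

/-- The translation `y^α` in the extended affine symmetric group, for `α ∈ ℤ^k` given as a
`k`-periodic function: `y^α m = m - k α_m`, so that `l ∘ y^α = l + n α` for `l` in `P_{k,n}`. -/
def yTrans (k : ℕ) (a : ℤ → ℤ) (m : ℤ) : ℤ := m - k * a m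

/-- The number `N_{μν}^λ` of pairs `(w, w')` in `S^μ × S^ν` such that
`μ ∘ w + ν ∘ w' = λ ∘ y^α` on `{1, …, k}` for some `α ∈ ℤ^k` with `|α| = d`, where `d` is defined by
`|ν| = n d + |λ| - |μ|`. In particular it is zero if there is no such integer `d`. -/
noncomputable def cylN (k n : ℕ) (mu nu lam : ℤ → ℤ) : ℕ :=
  Set.ncard {p : Equiv.Perm ℤ × Equiv.Perm ℤ |
    p.1 ∈ minReps k (finSym k) mu ∧ p.2 ∈ minReps k (finSym k) nu ∧
    ∃ a : ℤ → ℤ, (∀ i, a (i + k) = a i) ∧ wsize k nu = n * wsize k a + wsize k lam - wsize k mu ∧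
      ∀ i ∈ Icc (1 : ℤ) k, mu (p.1 i) + nu (p.2 i) = lam (yTrans k a i)}

/-! ## Cylindric reverse plane partitions -/

/-- The cylindric loop `λ[d] = λ ∘ τ^d`. -/
def cylLoop (lam : ℤ → ℤ) (d : ℤ) : ℤ → ℤ := lam ∘ (tau ^ d : Equiv.Perm ℤ)

/-- The cylindric skew diagram `λ/d/μ`: lattice points between the loops `μ[0]` and `λ[d]`. -/
def cylDiagram (lam : ℤ → ℤ) (d : ℤ) (mu : ℤ → ℤ) : Set (ℤ × ℤ) :=
  {p | mu p.1 < p.2 ∧ p.2 ≤ cylLoop lam d p.1}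

/-- The weight factor `χ_{λ/d/μ}`: the number of minimal length representatives `w` of the cosets of
`S_μ` in the affine symmetric group with `μ ∘ w ≤ λ ∘ τ^d`. -/
noncomputable def cylChiFactor (k : ℕ) (lam : ℤ → ℤ) (d : ℤ) (mu : ℤ → ℤ) : ℕ :=
  Set.ncard {w | w ∈ minReps k (affSym k) mu ∧ ∀ i, mu (w i) ≤ cylLoop lam d i}

/-- A cylindric reverse plane partition `π` of shape `λ/d/μ` as a sequence of cylindric loops
`μ[0] = λ⁽⁰⁾[d₀] ≤ λ⁽¹⁾[d₁] ≤ ⋯` which is eventually equal to `λ[d]`: the squares with entry `i + 1`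
are those between `λ⁽ⁱ⁾[dᵢ]` and `λ⁽ⁱ⁺¹⁾[dᵢ₊₁]`. -/
structure CylRPP (k n : ℕ) (lam : alcove k n) (d : ℤ) (mu : alcove k n) where
  loop : ℕ → alcove k n
  deg : ℕ → ℤ
  loop_zero : loop 0 = mu
  deg_zero : deg 0 = 0
  deg_le : ∀ i, deg i ≤ deg (i + 1)
  loop_le : ∀ i j, (loop i).1 j ≤ cylLoop (loop (i + 1)).1 (deg (i + 1) - deg i) j
  eventually_eq : ∃ N, ∀ i ≥ N, loop i = lam ∧ deg i = d

/-- `π.weight i` is the number `θ_{i+1}` of lattice points `(a, b)` with `1 ≤ a ≤ k` in the cylindric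
skew diagram `λ⁽ⁱ⁺¹⁾/(dᵢ₊₁ - dᵢ)/λ⁽ⁱ⁾`. -/
noncomputable def CylRPP.weight {k n : ℕ} {lam mu : alcove k n} {d : ℤ} (π : CylRPP k n lam d mu)
    (i : ℕ) : ℕ :=
  Set.ncard {p | p ∈ cylDiagram (π.loop (i + 1)).1 (π.deg (i + 1) - π.deg i) (π.loop i).1 ∧
    1 ≤ p.1 ∧ p.1 ≤ k}

/-- `χ_π`, the product of the weight factors of the skew diagrams of `π` (almost all of them are of
the form `λ/0/λ` and have weight factor `1`). -/
noncomputable def CylRPP.chi {k n : ℕ} {lam mu : alcove k n} {d : ℤ} (π : CylRPP k n lam d mu) : ℕ :=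
  ∏ᶠ i, cylChiFactor k (π.loop (i + 1)).1 (π.deg (i + 1) - π.deg i) (π.loop i).1

/-- The weighted sum `∑ χ_π` over the cylindric reverse plane partitions `π` of shape `λ/d/μ` and
weight `θ`. -/
noncomputable def cylChiWeight {k n : ℕ} (lam : alcove k n) (d : ℤ) (mu : alcove k n)
    (θ : ℕ →₀ ℕ) : ℕ :=
  ∑ᶠ π : {π : CylRPP k n lam d mu // ∀ i, π.weight i = θ i}, π.1.chi

/-- The cylindric complete symmetric function `h_{λ/d/μ} = ∑ χ_π x^π`, a formal power series in
`x_1, x_2, …` (the variable `x_{i+1}` has index `i`). -/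
noncomputable def cylH {k n : ℕ} (lam : alcove k n) (d : ℤ) (mu : alcove k n) : MvPowerSeries ℕ ℤ :=
  fun θ => (cylChiWeight lam d mu θ : ℤ)

/-- `χ_{λ/d/μ}(p)` for a partition `p`: the weighted sum over all cylindric reverse plane partitions
of shape `λ/d/μ` and weight `p = (p_1 ≥ p_2 ≥ ⋯)`. -/
noncomputable def cylChi {k n : ℕ} (lam : alcove k n) (d : ℤ) (mu : alcove k n) {N : ℕ}
    (p : N.Partition) : ℕ :=
  cylChiWeight lam d mu (p.parts.sort (· ≥ ·)).toFinsupp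

/-! ## Symmetric functions in infinitely many variables -/

/-- The monomial symmetric function `m_p`. -/
noncomputable def seriesM {N : ℕ} (p : N.Partition) : MvPowerSeries ℕ ℤ :=
  fun θ => if θ.support.val.map θ = p.parts then 1 else 0

/-- The complete symmetric function `h_r`: the sum of all monomials of degree `r`. -/
noncomputable def seriesH (r : ℕ) : MvPowerSeries ℕ ℤ :=
  fun θ => if θ.degree = r then 1 else 0

/-- The complete symmetric function `h_ν = h_{ν_1} ⋯ h_{ν_k}`. -/
noncomputable def seriesHWeight (k : ℕ) (nu : ℤ → ℤ) : MvPowerSeries ℕ ℤ :=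
  ∏ i ∈ Icc (1 : ℤ) k, seriesH (nu i).toNat

/-! ## The generalised Verlinde algebra -/

/-- The ring `ℂ[z^{±1}]`. -/
abbrev LaurentC : Type := LaurentPolynomial ℂ

/-- The ring of symmetric polynomials `R[x_1, …, x_k]^{S_k}`. -/
abbrev SymPoly (k : ℕ) (R : Type) [CommRing R] : Type := MvPolynomial.symmetricSubalgebra (Fin k) R

/-- The ring `ℂ[z^{±1}][x_1, …, x_k]^{S_k}`. -/
abbrev SymRing (k : ℕ) : Type := SymPoly k LaurentC

/-- The power sum `p_r`. -/
noncomputable def symP (k r : ℕ) : SymRing k :=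
  ⟨MvPolynomial.psum (Fin k) LaurentC r, MvPolynomial.psum_isSymmetric _ _ r⟩

/-- The monomial symmetric polynomial `m_l`. -/
noncomputable def symM (k : ℕ) (l : ℤ → ℤ) : SymRing k :=
  ⟨MvPolynomial.msymm (Fin k) LaurentC (weightPartition k l), MvPolynomial.msymm_isSymmetric _ _ _⟩

/-- The complete symmetric polynomial `h_p = h_{p_1} h_{p_2} ⋯`. -/
noncomputable def symH (k : ℕ) {N : ℕ} (p : N.Partition) : SymRing k :=
  (p.parts.map fun r => (⟨MvPolynomial.hsymm (Fin k) LaurentC r,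
    MvPolynomial.hsymm_isSymmetric _ _ r⟩ : SymRing k)).prod

/-- The ideal `⟨p_n - z k, p_{n+1} - z p_1, …, p_{n+k-1} - z p_{k-1}⟩`. -/
noncomputable def verlindeIdeal (k n : ℕ) : Ideal (SymRing k) :=
  Ideal.span ({symP k n - algebraMap LaurentC (SymRing k) (LaurentPolynomial.T 1 * (k : LaurentC))} ∪
    {f | ∃ r, 1 ≤ r ∧ r < k ∧ f = symP k (n + r) - (LaurentPolynomial.T 1 : LaurentC) • symP k r})

/-- The generalised Verlinde algebra `V_k(n)`. -/
abbrev GenVerlinde (k n : ℕ) : Type := SymRing k ⧸ verlindeIdeal k n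

/-- The image of `m_l` in `V_k(n)`. -/
noncomputable def verM (k n : ℕ) (l : ℤ → ℤ) : GenVerlinde k n :=
  Ideal.Quotient.mk (verlindeIdeal k n) (symM k l)

/-- The image of `h_p` in `V_k(n)`. -/
noncomputable def verH (k n : ℕ) {N : ℕ} (p : N.Partition) : GenVerlinde k n :=
  Ideal.Quotient.mk (verlindeIdeal k n) (symH k p)

open Classical in
/-- The value `z^k δ_{l,n^k} / n^k` of the trace on `m_l`, where `n^k = (n, …, n)`. -/
noncomputable def traceValue (k n : ℕ) (l : ℤ → ℤ) : LaurentC :=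
  if ∀ i ∈ Icc (1 : ℤ) k, l i = n then
    LaurentPolynomial.C ((n : ℂ) ^ k)⁻¹ * LaurentPolynomial.T (k : ℤ) else 0

/-! Over A = ℂ[z^{±1}] the algebra behaves like the symmetric part of A[x_1,…,x_k]/(x_i^n - z),
where a monomial depends, up to a power of z, only on its exponents modulo n. The rearrangements of
the vectors in `alcove k n` represent each class of (ℤ/n)^k exactly once, so the m_λ should form a
basis. The functional `coord` reads off the coefficient of m_ν: it sends x^f to z^{(|f|-|ν|)/n} if f
≡ ν modulo n and to 0 otherwise. It kills the ideal because p_{n+a} - z p_a = ∑ x_i^a (x_i^n - z)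
(`coord_eq_zero_of_mem`). Conversely, the ideal contains every symmetrization of x^f (x_i^n - z)
(`symmetrize_monomial_mul_powSub_mem`). Together these give the expansion of every element,
`mk_eq_sum_coord`.

Structure constants thus become numbers of pairs (f, g) of exponent vectors with f + g ≡ ν modulo n.
Since minimal coset representatives correspond to points of an orbit, `cylN_eq_card` identifies
these numbers with N, and `cylChiFactor_eq_card` identifies those for h_r m_μ with the factors χ.
Iterating the rule for h_r m_μ sums over paths of loops, which are the cylindric reverse plane
partitions (`prod_hsymm_mul_verM`).

For the expansions of h_{λ/d/μ}, the coefficient of m_λ in h_θ m_μ is computed twice: as a sum over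
paths, and by expanding h_θ in monomial symmetric polynomials. The coefficient of x^ν in h_θ(x)
equals that of y^θ in h_ν(y), as both count nonnegative integer matrices with given row and column
sums (`coeff_seriesHWeight`). Symmetry in θ, needed for the expansion in the m_ρ, is commutativity
of the product of the h_r.

For the trace, the coefficient of m_{n^k} in m_λ m_μ is nonzero only if μ consists of the residues
of the negatives of the parts of λ. The Gram matrix is therefore supported on an involution, with
units as entries. -/

section Positions

/-! ### Integers as pairs of a quotient and a residue modulo k. -/

variable {k : ℕ}

theorem exists_eq_mul_add_fin (k : ℕ) [NeZero k] (i : ℤ) :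
    ∃ (q : ℤ) (r : Fin k), i = q * k + (r : ℕ) + 1 := by
  refine ⟨(Int.divModEquiv k (i - 1)).1, (Int.divModEquiv k (i - 1)).2, ?_⟩
  have h := (Int.divModEquiv k).symm_apply_apply (i - 1)
  rw [Int.divModEquiv_symm_apply] at h
  omega

theorem mul_add_fin_injective [NeZero k] {q q' : ℤ} {r r' : Fin k}
    (h : q * k + (r : ℕ) + 1 = q' * k + (r' : ℕ) + 1) : q = q' ∧ r = r' := by
  have h1 : (Int.divModEquiv k).symm (q, r) = (Int.divModEquiv k).symm (q', r') := by
    simp only [Int.divModEquiv_symm_apply]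
    omega
  have h2 := (Int.divModEquiv k).symm.injective h1
  simpa using h2

/-- The decomposition `i = q * k + r + 1` of an integer. -/
def posEquiv (k : ℕ) [NeZero k] : ℤ ≃ ℤ × Fin k := (Equiv.subRight 1).trans (Int.divModEquiv k)

theorem posEquiv_symm_apply [NeZero k] (q : ℤ) (r : Fin k) :
    (posEquiv k).symm (q, r) = q * k + (r : ℕ) + 1 := by
  simp [posEquiv]

theorem posEquiv_apply [NeZero k] (q : ℤ) (r : Fin k) :
    posEquiv k (q * k + (r : ℕ) + 1) = (q, r) := by
  rw [← posEquiv_symm_apply, Equiv.apply_symm_apply]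

theorem sum_Icc_eq_sum_fin {M : Type*} [AddCommMonoid M] (k : ℕ) (f : ℤ → M) :
    ∑ i ∈ Icc (1 : ℤ) k, f i = ∑ r : Fin k, f ((r : ℕ) + 1) := by
  symm
  refine Finset.sum_bij (fun r _ => ((r : ℕ) : ℤ) + 1) ?_ ?_ ?_ ?_
  · intro r _
    have := r.2
    simp only [mem_Icc]
    omega
  · intro r _ s _ h
    apply Fin.ext
    omega
  · intro i hi
    rw [mem_Icc] at hi
    exact ⟨⟨(i - 1).toNat, by omega⟩, mem_univ _, by simp; omega⟩
  · intro _ _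
    rfl

theorem prod_Icc_eq_prod_fin {M : Type*} [CommMonoid M] (k : ℕ) (f : ℤ → M) :
    ∏ i ∈ Icc (1 : ℤ) k, f i = ∏ r : Fin k, f ((r : ℕ) + 1) :=
  sum_Icc_eq_sum_fin (M := Additive M) k f

theorem exists_fin_of_mem_Icc {i : ℤ} (h : i ∈ Icc (1 : ℤ) k) :
    ∃ r : Fin k, i = (r : ℕ) + 1 := by
  rw [mem_Icc] at h
  exact ⟨⟨(i - 1).toNat, by omega⟩, by simp; omega⟩

theorem fin_add_one_mem_Icc (r : Fin k) : ((r : ℕ) : ℤ) + 1 ∈ Icc (1 : ℤ) k := by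
  have := r.2
  rw [mem_Icc]
  omega

theorem wsize_eq (l : ℤ → ℤ) : wsize k l = ∑ r : Fin k, l ((r : ℕ) + 1) :=
  sum_Icc_eq_sum_fin k l

end Positions

/-! ### Quasi-periodic weights, the alcove and shifted loops. -/

section Weights

variable {k n : ℕ} {l m : ℤ → ℤ}

theorem cylWeight_add_mul (hl : l ∈ cylWeight k n) (i q : ℤ) : l (i + q * k) = l i - n * q := by
  induction q using Int.induction_on with
  | zero => simp
  | succ q ih =>
    rw [show i + ((q : ℤ) + 1) * k = i + q * k + k by ring, hl, ih]; ring
  | pred q ih =>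
    have := hl (i + (-(q : ℤ) - 1) * k)
    rw [show i + (-(q : ℤ) - 1) * k + k = i + (-q) * k by ring, ih] at this
    linarith

theorem cylWeight_pos (hl : l ∈ cylWeight k n) (q : ℤ) (r : Fin k) :
    l (q * k + (r : ℕ) + 1) = l ((r : ℕ) + 1) - n * q := by
  rw [← cylWeight_add_mul hl]; congr 1; ring

theorem cylWeight_ext [NeZero k] (hl : l ∈ cylWeight k n) (hm : m ∈ cylWeight k n)
    (h : ∀ r : Fin k, l ((r : ℕ) + 1) = m ((r : ℕ) + 1)) : l = m := by
  funext i
  obtain ⟨q, r, rfl⟩ := exists_eq_mul_add_fin k i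
  rw [cylWeight_pos hl, cylWeight_pos hm, h]

/-- The weight with prescribed values on `{1, …, k}`. -/
def weightOf (k n : ℕ) [NeZero k] (v : Fin k → ℤ) (i : ℤ) : ℤ :=
  v (posEquiv k i).2 - n * (posEquiv k i).1

theorem weightOf_apply [NeZero k] (v : Fin k → ℤ) (r : Fin k) :
    weightOf k n v ((r : ℕ) + 1) = v r := by
  have := posEquiv_apply 0 r
  rw [zero_mul, zero_add] at this
  simp [weightOf, this]

theorem weightOf_mem [NeZero k] (v : Fin k → ℤ) : weightOf k n v ∈ cylWeight k n := by
  intro i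
  obtain ⟨q, r, rfl⟩ := exists_eq_mul_add_fin k i
  rw [show q * k + ((r : ℕ) : ℤ) + 1 + k = (q + 1) * k + (r : ℕ) + 1 by ring]
  simp only [weightOf, posEquiv_apply]
  ring

/-- Weights which are weakly decreasing on `{1, …, k}`. -/
def IsSortedWeight (k : ℕ) (l : ℤ → ℤ) : Prop := ∀ i : ℤ, 1 ≤ i → i < k → l (i + 1) ≤ l i

theorem IsSortedWeight.le (hl : IsSortedWeight k l) {i j : ℤ} (hi : 1 ≤ i) (hij : i ≤ j)
    (hj : j ≤ k) : l j ≤ l i := by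
  induction j, hij using Int.leInduction with
  | base => exact le_rfl
  | succ j hij ih => exact (hl j (by omega) (by omega)).trans (ih (by omega))

theorem IsSortedWeight.antitone (hl : IsSortedWeight k l) :
    Antitone fun r : Fin k => l ((r : ℕ) + 1) := by
  intro r s hrs
  have h1 : (r : ℕ) ≤ s := hrs
  have := s.2
  exact hl.le (by omega) (by omega) (by omega)

theorem isSortedWeight_of_antitone
    (hl : Antitone fun r : Fin k => l ((r : ℕ) + 1)) : IsSortedWeight k l := by
  intro i h1 h2
  have := @hl ⟨(i - 1).toNat, by omega⟩ ⟨i.toNat, by omega⟩ (by simp [Fin.le_def])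
  simp only at this
  rwa [show (((i - 1).toNat : ℕ) : ℤ) + 1 = i by omega,
    show ((i.toNat : ℕ) : ℤ) + 1 = i + 1 by omega] at this

theorem alcove_pos (hl : l ∈ alcove k n) (r : Fin k) : 0 < l ((r : ℕ) + 1) := by
  have h := IsSortedWeight.le hl.2.2.1 (i := (r : ℕ) + 1) (j := k) (by omega)
    (by have := r.2; omega) le_rfl
  exact hl.2.2.2.trans_le h

theorem alcove_le (hl : l ∈ alcove k n) (r : Fin k) : l ((r : ℕ) + 1) ≤ n :=
  (alcove_mem_Icc hl (by omega) (by have := r.2; omega)).2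

theorem mem_alcove_iff [NeZero k] : l ∈ alcove k n ↔
    l ∈ cylWeight k n ∧ IsSortedWeight k l ∧ ∀ r : Fin k, 0 < l ((r : ℕ) + 1) ∧
      l ((r : ℕ) + 1) ≤ n := by
  constructor
  · intro h
    exact ⟨h.1, h.2.2.1, fun r => ⟨alcove_pos h r, alcove_le h r⟩⟩
  · rintro ⟨h1, h2, h3⟩
    have hk := Nat.pos_of_ne_zero (NeZero.ne k)
    refine ⟨h1, ?_, h2, ?_⟩
    · simpa using (h3 ⟨0, hk⟩).2
    · have := (h3 ⟨k - 1, by omega⟩).1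
      simpa [Nat.cast_sub hk] using this

theorem dominant_nonneg (hl : l ∈ dominantWeight k n) (r : Fin k) : 0 ≤ l ((r : ℕ) + 1) := by
  have h := IsSortedWeight.le hl.2.1 (i := (r : ℕ) + 1) (j := k) (by omega)
    (by have := r.2; omega) le_rfl
  exact hl.2.2.trans h

theorem mem_dominantWeight_iff [NeZero k] : l ∈ dominantWeight k n ↔
    l ∈ cylWeight k n ∧ IsSortedWeight k l ∧ ∀ r : Fin k, 0 ≤ l ((r : ℕ) + 1) := by
  constructor
  · intro h
    exact ⟨h.1, h.2.1, fun r => dominant_nonneg h r⟩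
  · rintro ⟨h1, h2, h3⟩
    have hk := Nat.pos_of_ne_zero (NeZero.ne k)
    refine ⟨h1, h2, ?_⟩
    have := h3 ⟨k - 1, by omega⟩
    simpa [Nat.cast_sub hk] using this

theorem alcove_subset_dominantWeight : alcove k n ⊆ dominantWeight k n :=
  fun _ h => ⟨h.1, h.2.2.1, h.2.2.2.le⟩

/-- Across the end of a period the value drops from `l k > 0` to `l 1 - n ≤ 0`; this is where the
outer bounds of the alcove enter. -/
theorem alcove_antitone [NeZero k] (hl : l ∈ alcove k n) : Antitone l := by
  have hk := Nat.pos_of_ne_zero (NeZero.ne k)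
  refine antitone_int_of_succ_le fun i => ?_
  obtain ⟨q, r, rfl⟩ := exists_eq_mul_add_fin k i
  by_cases h : (r : ℕ) + 1 < k
  · have h1 := cylWeight_pos hl.1 q ⟨(r : ℕ) + 1, h⟩
    simp only [Nat.cast_add, Nat.cast_one] at h1
    rw [show q * k + ((r : ℕ) : ℤ) + 1 + 1 = q * k + ((r : ℕ) + 1) + 1 by ring, h1,
      cylWeight_pos hl.1]
    have := hl.2.2.1 ((r : ℕ) + 1) (by omega) (by omega)
    omega
  · have hr : (r : ℕ) + 1 = k := by have := r.2; omega
    have h1 := cylWeight_pos hl.1 (q + 1) ⟨0, hk⟩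
    simp only [Nat.cast_zero, add_zero, zero_add] at h1
    have hr' : ((r : ℕ) : ℤ) + 1 = k := by exact_mod_cast hr
    rw [show q * k + ((r : ℕ) : ℤ) + 1 + 1 = (q + 1) * k + 1 by rw [add_assoc (q * k), hr']; ring, h1,
      cylWeight_pos hl.1, hr']
    have h2 := hl.2.2.2
    have h3 := hl.2.1
    linarith

/-- Positivity stops exactly after position `k`, so signs detect the shift of a loop. This turns
inequalities between loops into inequalities between degrees. -/
theorem alcove_apply_pos_iff [NeZero k] (hl : l ∈ alcove k n) (i : ℤ) : 0 < l i ↔ i ≤ k := by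
  constructor
  · intro h
    by_contra h1
    have h2 := alcove_antitone hl (show (k : ℤ) + 1 ≤ i by omega)
    have h3 := hl.1 1
    rw [add_comm] at h2
    have := hl.2.1
    omega
  · intro h
    exact hl.2.2.2.trans_le (alcove_antitone hl h)

theorem tau_zpow_apply (d i : ℤ) : (tau ^ d : Equiv.Perm ℤ) i = i - d := by
  induction d using Int.induction_on generalizing i with
  | zero => simp
  | succ d ih =>
    rw [zpow_add_one, Equiv.Perm.mul_apply, ih]
    simp [tau]; ring
  | pred d ih =>
    rw [zpow_sub_one, Equiv.Perm.mul_apply, ih]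
    have : (tau⁻¹ : Equiv.Perm ℤ) i = i + 1 := by
      rw [Equiv.Perm.inv_eq_iff_eq]; simp [tau]
    rw [this]; ring

theorem cylLoop_apply (l : ℤ → ℤ) (d i : ℤ) : cylLoop l d i = l (i - d) := by
  simp [cylLoop, tau_zpow_apply]

theorem cylLoop_mem (hl : l ∈ cylWeight k n) (d : ℤ) : cylLoop l d ∈ cylWeight k n := by
  intro i
  rw [cylLoop_apply, cylLoop_apply, ← hl]; congr 1; ring

/-- A unit shift replaces the last value of a window by the one preceding the window, which is
larger by `n`. -/
theorem wsize_cylLoop (hl : l ∈ cylWeight k n) (d : ℤ) :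
    wsize k (cylLoop l d) = wsize k l + n * d := by
  rcases Nat.eq_zero_or_pos k with rfl | hk
  · have := hl 0
    simp only [Nat.cast_zero, add_zero] at this
    have : (n : ℤ) = 0 := by omega
    simp [wsize, this]
  have step : ∀ d, wsize k (cylLoop l (d + 1)) = wsize k (cylLoop l d) + n := by
    intro d
    simp only [wsize, cylLoop_apply]
    have h1 : ∑ i ∈ Icc (1 : ℤ) k, l (i - (d + 1)) = ∑ i ∈ Ico (0 : ℤ) k, l (i - d) := by
      refine Finset.sum_bij (fun i _ => i - 1) ?_ ?_ ?_ ?_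
      · intro i hi; simp only [mem_Icc, mem_Ico] at *; omega
      · intro i _ j _ h; omega
      · intro i hi; simp only [mem_Ico] at hi
        exact ⟨i + 1, by simp only [mem_Icc]; omega, by ring⟩
      · intro i _; congr 1; ring
    have h2 : Icc (1 : ℤ) k = insert (k : ℤ) (Ico (1 : ℤ) k) := by
      ext i; simp only [mem_insert, mem_Icc, mem_Ico]; omega
    have h3 : Ico (0 : ℤ) k = insert (0 : ℤ) (Ico (1 : ℤ) k) := by
      ext i; simp only [mem_insert, mem_Ico]; omega
    rw [h1, h2, h3, sum_insert (by simp), sum_insert (by simp)]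
    have := hl (0 - d)
    rw [show 0 - d + (k : ℤ) = k - d by ring] at this
    omega
  induction d using Int.induction_on with
  | zero => simp [cylLoop]
  | succ d ih => rw [step, ih]; ring
  | pred d ih =>
    have := step (-(d : ℤ) - 1)
    rw [show -(d : ℤ) - 1 + 1 = -d by ring, ih] at this
    linarith

end Weights

/-! ### Periodic permutations of ℤ as a permutation of residues with an integer vector. -/

section AffinePermutations

variable {k n : ℕ} [NeZero k]

/-- The permutation `q k + r + 1 ↦ (q + a r) k + σ r + 1` of `ℤ`. -/
def affPerm (σ : Equiv.Perm (Fin k)) (a : Fin k → ℤ) : Equiv.Perm ℤ :=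
  ((posEquiv k).trans
    { toFun := fun p => (p.1 + a p.2, σ p.2)
      invFun := fun p => (p.1 - a (σ.symm p.2), σ.symm p.2)
      left_inv := fun p => by simp
      right_inv := fun p => by simp }).trans (posEquiv k).symm

theorem affPerm_apply (σ : Equiv.Perm (Fin k)) (a : Fin k → ℤ) (q : ℤ) (r : Fin k) :
    affPerm σ a (q * k + (r : ℕ) + 1) = (q + a r) * k + (σ r : ℕ) + 1 := by
  simp [affPerm, posEquiv_apply, posEquiv_symm_apply]

theorem affPerm_apply_fin (σ : Equiv.Perm (Fin k)) (a : Fin k → ℤ) (r : Fin k) :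
    affPerm σ a ((r : ℕ) + 1) = a r * k + (σ r : ℕ) + 1 := by
  simpa using affPerm_apply σ a 0 r

theorem affPerm_add (σ : Equiv.Perm (Fin k)) (a : Fin k → ℤ) (m : ℤ) :
    affPerm σ a (m + k) = affPerm σ a m + k := by
  obtain ⟨q, r, rfl⟩ := exists_eq_mul_add_fin k m
  rw [show q * k + ((r : ℕ) : ℤ) + 1 + k = (q + 1) * k + (r : ℕ) + 1 by ring, affPerm_apply,
    affPerm_apply]
  ring

omit [NeZero k] in
theorem perm_add_mul {w : Equiv.Perm ℤ} (hw : ∀ m, w (m + k) = w m + k) (m q : ℤ) :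
    w (m + q * k) = w m + q * k := by
  induction q using Int.induction_on with
  | zero => simp
  | succ q ih =>
    rw [show m + ((q : ℤ) + 1) * k = m + q * k + k by ring, hw, ih]; ring
  | pred q ih =>
    have := hw (m + (-(q : ℤ) - 1) * k)
    rw [show m + (-(q : ℤ) - 1) * k + k = m + (-q) * k by ring, ih] at this
    linarith

omit [NeZero k] in
theorem perm_pos {w : Equiv.Perm ℤ} (hw : ∀ m, w (m + k) = w m + k) (q : ℤ) (r : Fin k) :
    w (q * k + (r : ℕ) + 1) = w ((r : ℕ) + 1) + q * k := by
  rw [← perm_add_mul hw]; congr 1; ring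

theorem periodicPerm_ext {w w' : Equiv.Perm ℤ} (hw : ∀ m, w (m + k) = w m + k)
    (hw' : ∀ m, w' (m + k) = w' m + k) (h : ∀ r : Fin k, w ((r : ℕ) + 1) = w' ((r : ℕ) + 1)) :
    w = w' := by
  ext i
  obtain ⟨q, r, rfl⟩ := exists_eq_mul_add_fin k i
  rw [perm_pos hw, perm_pos hw', h]

theorem exists_eq_affPerm {w : Equiv.Perm ℤ} (hw : ∀ m, w (m + k) = w m + k) :
    ∃ σ a, w = affPerm (k := k) σ a := by
  choose a s h using fun r : Fin k => exists_eq_mul_add_fin k (w ((r : ℕ) + 1))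
  -- Equal image residues would make `w` agree at two positions after a shift by a multiple of `k`.
  have hs : Function.Injective s := by
    intro r r' hr
    have h1 : w ((r : ℕ) + 1) = w ((r' : ℕ) + 1 + (a r - a r') * k) := by
      rw [perm_add_mul hw, h r, h r', hr]; ring
    have h2 := w.injective h1
    refine (mul_add_fin_injective (q := 0) (q' := a r - a r') ?_).2
    rw [zero_mul, zero_add, h2]; ring
  refine ⟨Equiv.ofBijective s (Finite.injective_iff_bijective.1 hs), a, ?_⟩
  refine periodicPerm_ext hw (affPerm_add _ _) fun r => ?_
  rw [affPerm_apply_fin, h r]; rfl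

theorem sum_affPerm (σ : Equiv.Perm (Fin k)) (a : Fin k → ℤ) :
    ∑ m ∈ Icc (1 : ℤ) k, affPerm σ a m = (∑ r, a r) * k + ∑ m ∈ Icc (1 : ℤ) k, m := by
  rw [sum_Icc_eq_sum_fin, sum_Icc_eq_sum_fin]
  simp only [affPerm_apply_fin]
  rw [Finset.sum_add_distrib, Finset.sum_add_distrib, Finset.sum_add_distrib, Finset.sum_mul,
    add_assoc, Equiv.sum_comp σ (fun r => ((r : ℕ) : ℤ))]

theorem affPerm_mem_affSym {σ : Equiv.Perm (Fin k)} {a : Fin k → ℤ} :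
    affPerm σ a ∈ affSym k ↔ ∑ r, a r = 0 := by
  have hk : (k : ℤ) ≠ 0 := by exact_mod_cast NeZero.ne k
  constructor
  · intro h
    have h1 := h.2
    rw [sum_affPerm] at h1
    have h2 : (∑ r, a r) * (k : ℤ) = 0 := by linarith
    exact (mul_eq_zero.1 h2).resolve_right hk
  · intro h
    exact ⟨affPerm_add σ a, by rw [sum_affPerm, h]; simp⟩

theorem affPerm_mem_finSym {σ : Equiv.Perm (Fin k)} {a : Fin k → ℤ} :
    affPerm σ a ∈ finSym k ↔ a = 0 := by
  constructor
  · intro h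
    funext r
    obtain ⟨s, hs⟩ := exists_fin_of_mem_Icc (h.2 _ (fin_add_one_mem_Icc r))
    rw [affPerm_apply_fin] at hs
    exact (mul_add_fin_injective (q' := 0) (r' := s) (by rw [hs]; ring)).1
  · rintro rfl
    refine ⟨affPerm_add σ 0, fun m hm => ?_⟩
    obtain ⟨r, rfl⟩ := exists_fin_of_mem_Icc hm
    rw [affPerm_apply_fin]
    simp

theorem affPerm_mul (σ σ' : Equiv.Perm (Fin k)) (a a' : Fin k → ℤ) :
    affPerm σ a * affPerm σ' a' = affPerm (σ * σ') (fun r => a' r + a (σ' r)) := by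
  ext i
  obtain ⟨q, r, rfl⟩ := exists_eq_mul_add_fin k i
  rw [Equiv.Perm.mul_apply, affPerm_apply, affPerm_apply, affPerm_apply, Equiv.Perm.mul_apply]
  ring

theorem affPerm_inv (σ : Equiv.Perm (Fin k)) (a : Fin k → ℤ) :
    (affPerm σ a)⁻¹ = affPerm σ⁻¹ (fun r => - a (σ⁻¹ r)) := by
  rw [inv_eq_iff_mul_eq_one, affPerm_mul]
  ext i
  obtain ⟨q, r, rfl⟩ := exists_eq_mul_add_fin k i
  rw [affPerm_apply]
  simp

theorem mul_mem_finSym {u w : Equiv.Perm ℤ} (hu : u ∈ finSym k) (hw : w ∈ finSym k) :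
    u * w ∈ finSym k := by
  obtain ⟨σ, a, rfl⟩ := exists_eq_affPerm hu.1
  obtain ⟨σ', a', rfl⟩ := exists_eq_affPerm hw.1
  rw [affPerm_mem_finSym] at hu hw
  rw [affPerm_mul, affPerm_mem_finSym, hu, hw]
  simp; rfl

theorem inv_mem_finSym {u : Equiv.Perm ℤ} (hu : u ∈ finSym k) : u⁻¹ ∈ finSym k := by
  obtain ⟨σ, a, rfl⟩ := exists_eq_affPerm hu.1
  rw [affPerm_mem_finSym] at hu
  rw [affPerm_inv, affPerm_mem_finSym, hu]
  simp; rfl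

theorem finSym_subset_affSym : finSym k ⊆ affSym k := by
  intro u hu
  obtain ⟨σ, a, rfl⟩ := exists_eq_affPerm hu.1
  rw [affPerm_mem_finSym] at hu
  rw [affPerm_mem_affSym, hu]
  simp

theorem mul_mem_affSym {u w : Equiv.Perm ℤ} (hu : u ∈ affSym k) (hw : w ∈ affSym k) :
    u * w ∈ affSym k := by
  obtain ⟨σ, a, rfl⟩ := exists_eq_affPerm hu.1
  obtain ⟨σ', a', rfl⟩ := exists_eq_affPerm hw.1
  rw [affPerm_mem_affSym] at hu hw
  rw [affPerm_mul, affPerm_mem_affSym, sum_add_distrib, hw, Equiv.sum_comp σ' a, hu, add_zero]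

theorem inv_mem_affSym {u : Equiv.Perm ℤ} (hu : u ∈ affSym k) : u⁻¹ ∈ affSym k := by
  obtain ⟨σ, a, rfl⟩ := exists_eq_affPerm hu.1
  rw [affPerm_mem_affSym] at hu
  rw [affPerm_inv, affPerm_mem_affSym, sum_neg_distrib, Equiv.sum_comp σ⁻¹ a, hu, neg_zero]

omit [NeZero k] in
theorem one_mem_finSym : (1 : Equiv.Perm ℤ) ∈ finSym k := ⟨by simp, by simp⟩

omit [NeZero k] in
theorem cylWeight_comp {l : ℤ → ℤ} (hl : l ∈ cylWeight k n) {w : Equiv.Perm ℤ}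
    (hw : ∀ m, w (m + k) = w m + k) : l ∘ w ∈ cylWeight k n := by
  intro i
  simp only [Function.comp_apply, hw, hl (w i)]

theorem mem_orbit_finSym {l : ℤ → ℤ} {φ : ℤ → ℤ} (hl : l ∈ cylWeight k n) :
    (∃ w ∈ finSym k, l ∘ w = φ) ↔ φ ∈ cylWeight k n ∧
      ∃ σ : Equiv.Perm (Fin k), ∀ r : Fin k, φ ((r : ℕ) + 1) = l ((σ r : ℕ) + 1) := by
  constructor
  · rintro ⟨w, hw, rfl⟩
    refine ⟨cylWeight_comp hl hw.1, ?_⟩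
    obtain ⟨σ, a, rfl⟩ := exists_eq_affPerm hw.1
    rw [affPerm_mem_finSym] at hw
    exact ⟨σ, fun r => by rw [Function.comp_apply, affPerm_apply_fin, hw]; simp⟩
  · rintro ⟨h1, σ, h2⟩
    refine ⟨affPerm σ 0, affPerm_mem_finSym.2 rfl,
      cylWeight_ext (cylWeight_comp hl (affPerm_add σ 0)) h1 fun r => ?_⟩
    rw [Function.comp_apply, affPerm_apply_fin, h2]; simp

theorem mem_orbit_affSym {l : ℤ → ℤ} {φ : ℤ → ℤ} (hl : l ∈ cylWeight k n) :
    (∃ w ∈ affSym k, l ∘ w = φ) ↔ φ ∈ cylWeight k n ∧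
      ∃ (σ : Equiv.Perm (Fin k)) (a : Fin k → ℤ), ∑ r, a r = 0 ∧
        ∀ r : Fin k, φ ((r : ℕ) + 1) = l ((σ r : ℕ) + 1) - n * a r := by
  constructor
  · rintro ⟨w, hw, rfl⟩
    refine ⟨cylWeight_comp hl hw.1, ?_⟩
    obtain ⟨σ, a, rfl⟩ := exists_eq_affPerm hw.1
    rw [affPerm_mem_affSym] at hw
    exact ⟨σ, a, hw, fun r => by rw [Function.comp_apply, affPerm_apply_fin, cylWeight_pos hl]⟩
  · rintro ⟨h1, σ, a, ha, h2⟩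
    refine ⟨affPerm σ a, affPerm_mem_affSym.2 ha,
      cylWeight_ext (cylWeight_comp hl (affPerm_add σ a)) h1 fun r => ?_⟩
    rw [Function.comp_apply, affPerm_apply_fin, h2, cylWeight_pos hl]

end AffinePermutations

/-! ### Minimal coset representatives and orbits of weights. -/

section MinimalRepresentatives

variable {k n : ℕ} [NeZero k]

theorem perm_apply_inv (w : Equiv.Perm ℤ) (i : ℤ) : w (w⁻¹ i) = i := w.apply_symm_apply i

theorem perm_inv_apply (w : Equiv.Perm ℤ) (i : ℤ) : w⁻¹ (w i) = i := w.symm_apply_apply i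

/-- The inversions counted by `symLength`. -/
def inversions (k : ℕ) (w : Equiv.Perm ℤ) : Set (ℤ × ℤ) :=
  {p : ℤ × ℤ | 1 ≤ p.1 ∧ p.1 ≤ k ∧ p.1 < p.2 ∧ w p.2 < w p.1}

theorem exists_displacement_bound {w : Equiv.Perm ℤ} (hw : ∀ m, w (m + k) = w m + k) :
    ∃ B : ℤ, ∀ m, |w m - m| ≤ B := by
  refine ⟨∑ r : Fin k, |w ((r : ℕ) + 1) - ((r : ℕ) + 1)|, fun m => ?_⟩
  obtain ⟨q, r, rfl⟩ := exists_eq_mul_add_fin k m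
  rw [perm_pos hw, show w ((r : ℕ) + 1) + q * k - (q * k + (r : ℕ) + 1) =
    w ((r : ℕ) + 1) - ((r : ℕ) + 1) by ring]
  exact Finset.single_le_sum (f := fun r : Fin k => |w ((r : ℕ) + 1) - ((r : ℕ) + 1)|)
    (fun _ _ => abs_nonneg _) (mem_univ r)

/-- Finiteness matters because `symLength` is an `ncard`, which vanishes on infinite sets. -/
theorem inversions_finite {w : Equiv.Perm ℤ} (hw : ∀ m, w (m + k) = w m + k) :
    (inversions k w).Finite := by
  obtain ⟨B, hB⟩ := exists_displacement_bound hw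
  refine ((Set.finite_Icc (1 : ℤ) k).prod (Set.finite_Icc (1 : ℤ) (k + 2 * B))).subset ?_
  rintro ⟨p, q⟩ ⟨h1, h2, h3, h4⟩
  have h5 := abs_le.1 (hB p)
  have h6 := abs_le.1 (hB q)
  simp only at h1 h2 h3 h4
  refine ⟨⟨h1, h2⟩, ⟨by simp only; omega, by simp only; omega⟩⟩

/-- The simple transposition exchanging the residue classes of `i` and `i + 1`, `1 ≤ i < k`. -/
theorem exists_simpleTransposition {i : ℤ} (h1 : 1 ≤ i) (h2 : i < k) :
    ∃ s ∈ finSym k, s i = i + 1 ∧ s (i + 1) = i ∧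
      ∀ a, s a = a ∨ (∃ q, a = i + q * k ∧ s a = a + 1) ∨
        (∃ q, a = i + 1 + q * k ∧ s a = a - 1) := by
  let u : Fin k := ⟨(i - 1).toNat, by omega⟩
  let v : Fin k := ⟨i.toNat, by omega⟩
  have hu : ((u : ℕ) : ℤ) = i - 1 := by simp only [u]; omega
  have hv : ((v : ℕ) : ℤ) = i := by simp only [v]; omega
  refine ⟨affPerm (Equiv.swap u v) 0, affPerm_mem_finSym.2 rfl, ?_, ?_, ?_⟩
  · have := affPerm_apply_fin (Equiv.swap u v) 0 u
    rw [Equiv.swap_apply_left, hu, hv] at this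
    simpa using this
  · have := affPerm_apply_fin (Equiv.swap u v) 0 v
    rw [Equiv.swap_apply_right, hu, hv] at this
    simpa using this
  · intro a
    obtain ⟨q, r, rfl⟩ := exists_eq_mul_add_fin k a
    rw [affPerm_apply]
    by_cases hru : r = u
    · right; left
      subst hru
      rw [Equiv.swap_apply_left, hv, hu]
      exact ⟨q, by ring, by simp only [Pi.zero_apply, add_zero]; ring⟩
    · by_cases hrv : r = v
      · right; right
        subst hrv
        rw [Equiv.swap_apply_right, hv, hu]
        exact ⟨q, by ring, by simp only [Pi.zero_apply, add_zero]; ring⟩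
      · left
        rw [Equiv.swap_apply_of_ne_of_ne hru hrv]; simp

/-- Left multiplication by `s` only swaps neighbouring values `i + q k`, `i + 1 + q k`. By `hlt`
such values occur in inverted order, so inversions are lost and none is created. -/
theorem symLength_simpleTransposition_mul_lt {w s : Equiv.Perm ℤ}
    (hw : ∀ m, w (m + k) = w m + k) {i : ℤ} (hs : s ∈ finSym k) (hs1 : s i = i + 1)
    (hs2 : s (i + 1) = i)
    (hs3 : ∀ a, s a = a ∨ (∃ q, a = i + q * k ∧ s a = a + 1) ∨
        (∃ q, a = i + 1 + q * k ∧ s a = a - 1)) (hlt : w⁻¹ (i + 1) < w⁻¹ i) :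
    symLength k (s * w) < symLength k w := by
  have hinv : ∀ b q : ℤ, w⁻¹ (b + q * k) = w⁻¹ b + q * k := by
    intro b q
    rw [Equiv.Perm.inv_eq_iff_eq, perm_add_mul hw, perm_apply_inv]
  refine Set.ncard_lt_ncard (t := inversions k w) ?_ (inversions_finite hw)
  refine (Set.ssubset_iff_of_subset ?_).2 ?_
  · rintro ⟨p, q⟩ ⟨h1, h2, h3, h4⟩
    simp only [Equiv.Perm.mul_apply] at h1 h2 h3 h4
    refine ⟨h1, h2, h3, ?_⟩
    simp only
    by_contra h5
    have h6 : w p < w q := lt_of_le_of_ne (not_lt.1 h5) fun h => h3.ne (w.injective h)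
    rcases hs3 (w p) with h7 | ⟨a, ha, h7⟩ | ⟨a, ha, h7⟩ <;>
      rcases hs3 (w q) with h8 | ⟨b, hb, h8⟩ | ⟨b, hb, h8⟩ <;> try omega
    -- The surviving cases have values `i + a k` and `i + 1 + a k` occurring in increasing order,
    -- contrary to `hlt`.
    all_goals
      have h9 : w q = i + 1 + a * k := by
        by_cases h : w q = w p + 1
        · rw [h, ha]; ring
        · omega
      have hp : p = w⁻¹ i + a * k := by rw [← hinv, ← ha, perm_inv_apply]
      have hq : q = w⁻¹ (i + 1) + a * k := by rw [← hinv, ← h9, perm_inv_apply]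
      omega
  -- The lost inversion, translated by a period so that its first entry lies in `{1, …, k}`.
  · obtain ⟨q, r, hqr⟩ := exists_eq_mul_add_fin k (w⁻¹ (i + 1))
    refine ⟨(w⁻¹ (i + 1) + (-q) * k, w⁻¹ i + (-q) * k), ⟨?_, ?_, ?_, ?_⟩, ?_⟩
    · simp only [hqr]; ring_nf; omega
    · have := r.2
      simp only [hqr]; ring_nf; omega
    · simp only; omega
    · simp only [perm_add_mul hw, perm_apply_inv]; omega
    · rintro ⟨-, -, -, h⟩
      simp only [Equiv.Perm.mul_apply, perm_add_mul hw, perm_apply_inv,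
        perm_add_mul hs.1, hs1, hs2] at h
      omega

/-- Sets of periodic permutations of `ℤ` which are stable under `S_k` from the left. -/
structure IsLeftStable (k : ℕ) (G : Set (Equiv.Perm ℤ)) : Prop where
  periodic : ∀ w ∈ G, ∀ m, w (m + k) = w m + k
  mul_mem : ∀ u ∈ finSym k, ∀ w ∈ G, u * w ∈ G

theorem isLeftStable_finSym : IsLeftStable k (finSym k) :=
  ⟨fun _ h => h.1, fun _ hu _ hw => mul_mem_finSym hu hw⟩

theorem isLeftStable_affSym : IsLeftStable k (affSym k) :=
  ⟨fun _ h => h.1, fun _ hu _ hw => mul_mem_affSym (finSym_subset_affSym hu) hw⟩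

theorem mul_mem_weightStab {mu : ℤ → ℤ} {u v : Equiv.Perm ℤ} (hu : u ∈ weightStab k mu)
    (hv : v ∈ weightStab k mu) : u * v ∈ weightStab k mu := by
  refine ⟨mul_mem_finSym hu.1 hv.1, ?_⟩
  rw [Equiv.Perm.coe_mul, ← Function.comp_assoc, hu.2, hv.2]

omit [NeZero k] in
theorem simpleTransposition_mem_weightStab {mu : ℤ → ℤ} (hmu : mu ∈ cylWeight k n)
    {s : Equiv.Perm ℤ} (hs : s ∈ finSym k) {i : ℤ}
    (hs3 : ∀ a, s a = a ∨ (∃ q, a = i + q * k ∧ s a = a + 1) ∨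
        (∃ q, a = i + 1 + q * k ∧ s a = a - 1)) (h : mu (i + 1) = mu i) :
    s ∈ weightStab k mu := by
  refine ⟨hs, funext fun a => ?_⟩
  rw [Function.comp_apply]
  rcases hs3 a with h1 | ⟨q, rfl, h1⟩ | ⟨q, rfl, h1⟩
  · rw [h1]
  · rw [h1, add_right_comm, cylWeight_add_mul hmu, cylWeight_add_mul hmu, h]
  · rw [h1, show i + 1 + q * k - 1 = i + q * k by ring, cylWeight_add_mul hmu,
      cylWeight_add_mul hmu, h]

/-- For adjacent positions of equal weight, the wrong order would let a simple transposition in the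
stabiliser shorten `w`. As `mu` is sorted, equal values are contiguous and the adjacent comparisons
chain. -/
theorem minReps_inv_lt {mu : ℤ → ℤ} (hmu : mu ∈ cylWeight k n) (hsort : IsSortedWeight k mu)
    {G : Set (Equiv.Perm ℤ)} (hG : IsLeftStable k G) {w : Equiv.Perm ℤ}
    (hw : w ∈ minReps k G mu) {i j : ℤ} (hi : 1 ≤ i) (hij : i < j) (hj : j ≤ k)
    (h : mu i = mu j) : w⁻¹ i < w⁻¹ j := by
  have adj : ∀ i : ℤ, 1 ≤ i → i < k → mu (i + 1) = mu i → w⁻¹ i < w⁻¹ (i + 1) := by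
    intro i h1 h2 h3
    obtain ⟨s, hs, hs1, hs2, hs3⟩ := exists_simpleTransposition (k := k) h1 h2
    by_contra h4
    have h5 : w⁻¹ (i + 1) < w⁻¹ i := lt_of_le_of_ne (not_lt.1 h4) fun h => by
      have := (w⁻¹).injective h
      omega
    have h6 := symLength_simpleTransposition_mul_lt (hG.periodic w hw.1) hs hs1 hs2 hs3 h5
    exact absurd (hw.2 s (simpleTransposition_mem_weightStab hmu hs hs3 h3)) (not_le.2 h6)
  have key : ∀ j, i + 1 ≤ j → j ≤ k → mu i = mu j → w⁻¹ i < w⁻¹ j := by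
    intro j hij
    induction j, hij using Int.leInduction with
    | base => exact fun h1 h2 => adj i hi (by omega) h2.symm
    | succ j hj ih =>
      intro h1 h2
      have h3 := hsort.le hi (show i ≤ j by omega) (by omega)
      have h4 := hsort j (by omega) (by omega)
      exact (ih (by omega) (by omega)).trans (adj j (by omega) (by omega) (by omega))
  exact key j hij hj h

/-- The quotient `v = w w'⁻¹` stabilises `mu` and, by `minReps_inv_lt`, is increasing on each block
of equal values, hence trivial. The hypothesis `hstab` keeps `v` inside the finite group. -/
theorem minReps_injOn {mu : ℤ → ℤ} (hmu : mu ∈ cylWeight k n) (hsort : IsSortedWeight k mu)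
    {G : Set (Equiv.Perm ℤ)} (hG : IsLeftStable k G)
    (hstab : ∀ w ∈ G, ∀ w' ∈ G, mu ∘ w = mu ∘ w' → w * w'⁻¹ ∈ finSym k) :
    Set.InjOn (fun w : Equiv.Perm ℤ => mu ∘ w) (minReps k G mu) := by
  intro w hw w' hw' heq
  simp only at heq
  have hv := hstab w hw.1 w' hw'.1 heq
  set v : Equiv.Perm ℤ := w * w'⁻¹ with hvdef
  have hmuv : ∀ i, mu (v i) = mu i := by
    intro i
    have := congrFun heq (w'⁻¹ i)
    simpa [hvdef] using this
  have hinv : ∀ i, w⁻¹ (v i) = w'⁻¹ i := by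
    intro i
    simp [hvdef]
  have hIcc : ∀ i : ℤ, 1 ≤ i → i ≤ k → 1 ≤ v i ∧ v i ≤ k := fun i h1 h2 =>
    mem_Icc.1 (hv.2 i (mem_Icc.2 ⟨h1, h2⟩))
  have hmono : ∀ i j : ℤ, 1 ≤ i → i < j → j ≤ k → mu i = mu j → v i < v j := by
    intro i j h1 h2 h3 h4
    have h5 := minReps_inv_lt hmu hsort hG hw' h1 h2 h3 h4
    rw [← hinv i, ← hinv j] at h5
    rcases lt_trichotomy (v i) (v j) with h6 | h6 | h6
    · exact h6
    · rw [h6] at h5; exact absurd h5 (lt_irrefl _)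
    · have := minReps_inv_lt hmu hsort hG hw (hIcc j (by omega) h3).1 h6
        (hIcc i h1 (by omega)).2 (by rw [hmuv, hmuv, h4])
      omega
  have hvi := inv_mem_finSym hv
  -- At the smallest moved point `i` both `v i` and `v⁻¹ i` exceed `i`. But `v⁻¹ i` lies in the
  -- block of `i`, so monotonicity would give `v i < i`.
  have hfix : ∀ N : ℕ, ∀ i : ℤ, 1 ≤ i → i ≤ k → i ≤ N → v i = i := by
    intro N
    induction N with
    | zero => intro i h1 _ h2; simp only [Nat.cast_zero] at h2; omega
    | succ N ih =>
      intro i h1 h2 h3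
      by_cases h4 : i ≤ N
      · exact ih i h1 h2 h4
      have h5 : i ≤ v i := by
        by_contra h
        have := ih (v i) (hIcc i h1 h2).1 (hIcc i h1 h2).2 (by push_cast at h3; omega)
        have := v.injective this
        omega
      have h6 := mem_Icc.1 (hvi.2 i (mem_Icc.2 ⟨h1, h2⟩))
      have h7 : v (v⁻¹ i) = i := perm_apply_inv _ _
      have h8 : i ≤ v⁻¹ i := by
        by_contra h
        have := ih (v⁻¹ i) h6.1 h6.2 (by push_cast at h3; omega)
        omega
      rcases h8.eq_or_lt with h9 | h9
      · rw [← h9] at h7; exact h7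
      · have := hmono i (v⁻¹ i) h1 h9 h6.2 (by rw [← hmuv (v⁻¹ i), h7])
        omega
  have hv1 : v = 1 := periodicPerm_ext (k := k) hv.1 (by simp) fun r =>
    hfix k _ (by omega) (by have := r.2; omega) (by have := r.2; omega)
  exact mul_inv_eq_one.1 hv1

theorem minReps_exists {mu : ℤ → ℤ} {G : Set (Equiv.Perm ℤ)} (hG : IsLeftStable k G)
    {w : Equiv.Perm ℤ} (hw : w ∈ G) : ∃ w' ∈ minReps k G mu, mu ∘ w' = mu ∘ w := by
  let S : Set (Equiv.Perm ℤ) := {v | ∃ u ∈ weightStab k mu, v = u * w}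
  have hS : S.Nonempty := ⟨w, 1, ⟨one_mem_finSym, rfl⟩, by simp⟩
  obtain ⟨v, ⟨u, hu, rfl⟩, hmin⟩ :=
    (InvImage.wf (symLength k) Nat.lt_wfRel.wf).has_min S hS
  refine ⟨u * w, ⟨hG.mul_mem u hu.1 w hw, fun u' hu' => ?_⟩, ?_⟩
  · exact not_lt.1 (hmin _ ⟨u' * u, mul_mem_weightStab hu' hu, (mul_assoc _ _ _).symm⟩)
  · rw [Equiv.Perm.coe_mul, ← Function.comp_assoc, hu.2]

theorem minReps_bijOn {mu : ℤ → ℤ} (hmu : mu ∈ cylWeight k n) (hsort : IsSortedWeight k mu)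
    {G : Set (Equiv.Perm ℤ)} (hG : IsLeftStable k G)
    (hstab : ∀ w ∈ G, ∀ w' ∈ G, mu ∘ w = mu ∘ w' → w * w'⁻¹ ∈ finSym k) :
    Set.BijOn (fun w : Equiv.Perm ℤ => mu ∘ w) (minReps k G mu) {φ | ∃ w ∈ G, mu ∘ w = φ} := by
  refine ⟨fun w hw => ⟨w, hw.1, rfl⟩, minReps_injOn hmu hsort hG hstab, ?_⟩
  rintro φ ⟨w, hw, rfl⟩
  exact minReps_exists hG hw

theorem minReps_finSym_bijOn {mu : ℤ → ℤ} (hmu : mu ∈ cylWeight k n)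
    (hsort : IsSortedWeight k mu) :
    Set.BijOn (fun w : Equiv.Perm ℤ => mu ∘ w) (minReps k (finSym k) mu)
      {φ | ∃ w ∈ finSym k, mu ∘ w = φ} :=
  minReps_bijOn hmu hsort isLeftStable_finSym fun _ hw _ hw' _ =>
    mul_mem_finSym hw (inv_mem_finSym hw')

/-- Values of an alcove weight on the window lie in `{1, …, n}` and differ by less than `n`, so an
affine permutation fixing the weight cannot move a position to another period. -/
theorem minReps_affSym_bijOn {mu : ℤ → ℤ} (hmu : mu ∈ alcove k n) :
    Set.BijOn (fun w : Equiv.Perm ℤ => mu ∘ w) (minReps k (affSym k) mu)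
      {φ | ∃ w ∈ affSym k, mu ∘ w = φ} := by
  refine minReps_bijOn hmu.1 hmu.2.2.1 isLeftStable_affSym fun w hw w' hw' h => ?_
  have h1 : ∀ i, mu ((w * w'⁻¹) i) = mu i := by
    intro i
    have := congrFun h (w'⁻¹ i)
    simpa using this
  obtain ⟨σ, a, hσ⟩ := exists_eq_affPerm (mul_mem_affSym hw (inv_mem_affSym hw')).1
  rw [hσ] at h1 ⊢
  rw [affPerm_mem_finSym]
  funext r
  have h2 := h1 ((r : ℕ) + 1)
  rw [affPerm_apply_fin, cylWeight_pos hmu.1] at h2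
  have h3 := alcove_pos hmu r
  have h4 := alcove_le hmu r
  have h5 := alcove_pos hmu (σ r)
  have h6 := alcove_le hmu (σ r)
  rw [Pi.zero_apply]
  have hn : (0 : ℤ) < n := h3.trans_le h4
  have h7 : (n : ℤ) * a r < n * 1 := by linarith
  have h8 : (n : ℤ) * (-1) < n * a r := by linarith
  have h9 := lt_of_mul_lt_mul_left h7 hn.le
  have h10 := lt_of_mul_lt_mul_left h8 hn.le
  omega

end MinimalRepresentatives

/-! ### Structure constants as counts of exponent vectors modulo n. -/

section Counting

variable {k n : ℕ} [NeZero k]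

omit [NeZero k] in
/-- The exponent vector `(l 1, …, l k)`. -/
noncomputable def expVec (k : ℕ) (l : ℤ → ℤ) : Fin k →₀ ℕ :=
  Finsupp.equivFunOnFinite.symm fun r => (l ((r : ℕ) + 1)).toNat

omit [NeZero k] in
theorem expVec_apply (l : ℤ → ℤ) (r : Fin k) : expVec k l r = (l ((r : ℕ) + 1)).toNat := rfl

omit [NeZero k] in
theorem expVec_apply_cast {l : ℤ → ℤ} (hl : l ∈ dominantWeight k n) (r : Fin k) :
    (expVec k l r : ℤ) = l ((r : ℕ) + 1) :=
  Int.toNat_of_nonneg (dominant_nonneg hl r)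

open Classical in
omit [NeZero k] in
/-- The set of rearrangements of the exponent vector `(l 1, …, l k)`. -/
noncomputable def rearr (k : ℕ) (l : ℤ → ℤ) : Finset (Fin k →₀ ℕ) :=
  univ.image fun σ : Equiv.Perm (Fin k) => Finsupp.equivFunOnFinite.symm fun r => expVec k l (σ r)

omit [NeZero k] in
theorem mem_rearr {l : ℤ → ℤ} {f : Fin k →₀ ℕ} :
    f ∈ rearr k l ↔ ∃ σ : Equiv.Perm (Fin k), ∀ r, f r = expVec k l (σ r) := by
  classical
  simp only [rearr, mem_image, mem_univ, true_and]
  refine exists_congr fun σ => ?_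
  rw [eq_comm, DFunLike.ext_iff]
  rfl

omit [NeZero k] in
theorem mem_rearr_cast {l : ℤ → ℤ} (hl : l ∈ dominantWeight k n) {f : Fin k →₀ ℕ} :
    f ∈ rearr k l ↔ ∃ σ : Equiv.Perm (Fin k), ∀ r, (f r : ℤ) = l ((σ r : ℕ) + 1) := by
  rw [mem_rearr]
  refine exists_congr fun σ => forall_congr' fun r => ?_
  rw [← expVec_apply_cast hl]
  exact Nat.cast_inj.symm

omit [NeZero k] in
theorem expVec_mem_rearr (l : ℤ → ℤ) : expVec k l ∈ rearr k l := mem_rearr.2 ⟨1, fun _ => rfl⟩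

omit [NeZero k] in
theorem sum_of_mem_rearr {l : ℤ → ℤ} (hl : l ∈ dominantWeight k n) {f : Fin k →₀ ℕ}
    (hf : f ∈ rearr k l) : ∑ r, (f r : ℤ) = wsize k l := by
  obtain ⟨σ, hσ⟩ := (mem_rearr_cast hl).1 hf
  rw [wsize_eq]
  simp only [hσ]
  exact Equiv.sum_comp σ fun r => l ((r : ℕ) + 1)

omit [NeZero k] in
theorem expVec_injOn [NeZero k] : Set.InjOn (expVec k)
    {l | l ∈ cylWeight k n ∧ ∀ r : Fin k, 0 ≤ l ((r : ℕ) + 1)} := by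
  intro l hl m hm h
  refine cylWeight_ext hl.1 hm.1 fun r => ?_
  have h1 := DFunLike.congr_fun h r
  rw [expVec_apply, expVec_apply] at h1
  have h2 := hl.2 r
  have h3 := hm.2 r
  omega

theorem wsize_comp_affSym {l : ℤ → ℤ} (hl : l ∈ cylWeight k n) {w : Equiv.Perm ℤ}
    (hw : w ∈ affSym k) : wsize k (l ∘ w) = wsize k l := by
  obtain ⟨-, σ, a, ha, h⟩ := (mem_orbit_affSym hl).1 ⟨w, hw, rfl⟩
  rw [wsize_eq, wsize_eq]
  simp only [h]
  rw [sum_sub_distrib, ← mul_sum, ha, mul_zero, sub_zero]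
  exact Equiv.sum_comp σ fun r => l ((r : ℕ) + 1)

/-- A minimal representative is determined by the rearrangement it produces, and the existence of
`α` is a congruence modulo `n`. The condition on `|α|` then follows by summation. -/
theorem cylN_eq_card {mu nu lam : ℤ → ℤ} (hmu : mu ∈ dominantWeight k n)
    (hnu : nu ∈ dominantWeight k n) (hlam : lam ∈ cylWeight k n) :
    cylN k n mu nu lam = #{p ∈ rearr k mu ×ˢ rearr k nu |
      ∀ r : Fin k, (n : ℤ) ∣ p.1 r + p.2 r - lam ((r : ℕ) + 1)} := by
  have hcomp : ∀ l ∈ dominantWeight k n, ∀ w ∈ minReps k (finSym k) l,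
      l ∘ w ∈ cylWeight k n ∧ ∀ r : Fin k, 0 ≤ (l ∘ w) ((r : ℕ) + 1) := by
    intro l hl w hw
    obtain ⟨h1, σ, h2⟩ := (mem_orbit_finSym hl.1).1 ⟨w, hw.1, rfl⟩
    exact ⟨h1, fun r => by rw [h2]; exact dominant_nonneg hl _⟩
  have hcast : ∀ l ∈ dominantWeight k n, ∀ w ∈ minReps k (finSym k) l, ∀ r : Fin k,
      (expVec k (l ∘ w) r : ℤ) = l (w ((r : ℕ) + 1)) := by
    intro l hl w hw r
    rw [expVec_apply, Int.toNat_of_nonneg ((hcomp l hl w hw).2 r)]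
    rfl
  have hmem : ∀ l ∈ dominantWeight k n, ∀ w ∈ minReps k (finSym k) l,
      expVec k (l ∘ w) ∈ rearr k l := by
    intro l hl w hw
    obtain ⟨h1, σ, h2⟩ := (mem_orbit_finSym hl.1).1 ⟨w, hw.1, rfl⟩
    exact (mem_rearr_cast hl).2 ⟨σ, fun r => by rw [hcast l hl w hw, ← h2]; rfl⟩
  have hsurj : ∀ l ∈ dominantWeight k n, ∀ f ∈ rearr k l, ∃ w ∈ minReps k (finSym k) l,
      expVec k (l ∘ w) = f := by
    intro l hl f hf
    obtain ⟨σ, hσ⟩ := (mem_rearr_cast hl).1 hf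
    obtain ⟨w, hw, h⟩ := minReps_exists (mu := l) isLeftStable_finSym
      (affPerm_mem_finSym (σ := σ).2 rfl)
    refine ⟨w, hw, Finsupp.ext fun r => ?_⟩
    have h1 := hcast l hl w hw r
    have h2 := congrFun h ((r : ℕ) + 1)
    simp only [Function.comp_apply, affPerm_apply_fin, Pi.zero_apply, zero_mul, zero_add] at h2
    rw [h2, ← hσ] at h1
    exact_mod_cast h1
  rw [cylN, ← Set.ncard_coe_finset]
  refine Set.ncard_congr (fun p _ => (expVec k (mu ∘ p.1), expVec k (nu ∘ p.2))) ?_ ?_ ?_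
  · rintro ⟨w, w'⟩ ⟨hw, hw', a, ha, -, h⟩
    simp only at hw hw' h
    simp only [coe_filter, mem_product, Set.mem_ofPred_eq, hmem mu hmu w hw, hmem nu hnu w' hw',
      hcast mu hmu w hw, hcast nu hnu w' hw', true_and]
    intro r
    have h1 := h _ (fin_add_one_mem_Icc r)
    have h2 := cylWeight_add_mul hlam ((r : ℕ) + 1) (- a ((r : ℕ) + 1))
    rw [show ((r : ℕ) : ℤ) + 1 + - a ((r : ℕ) + 1) * k = yTrans k a ((r : ℕ) + 1) by
      rw [yTrans]; ring] at h2
    exact ⟨a ((r : ℕ) + 1), by linarith⟩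
  · rintro ⟨w, w'⟩ ⟨v, v'⟩ ⟨hw, hw', -⟩ ⟨hv, hv', -⟩ h
    simp only [Prod.mk.injEq] at h hw hw' hv hv'
    have h1 := expVec_injOn (hcomp mu hmu w hw) (hcomp mu hmu v hv) h.1
    have h2 := expVec_injOn (hcomp nu hnu w' hw') (hcomp nu hnu v' hv') h.2
    rw [(minReps_finSym_bijOn hmu.1 hmu.2.1).injOn hw hv h1,
      (minReps_finSym_bijOn hnu.1 hnu.2.1).injOn hw' hv' h2]
  · rintro ⟨f, g⟩ h
    simp only [coe_filter, mem_product, Set.mem_ofPred_eq] at h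
    obtain ⟨⟨hf, hg⟩, hdvd⟩ := h
    obtain ⟨w, hw, rfl⟩ := hsurj mu hmu f hf
    obtain ⟨w', hw', rfl⟩ := hsurj nu hnu g hg
    choose a ha using hdvd
    -- With `n = 0`, `weightOf` extends the vector of quotients `k`-periodically.
    refine ⟨(w, w'), ⟨hw, hw', weightOf k 0 a, fun i => by simpa using weightOf_mem (n := 0) a i,
      ?_, ?_⟩, rfl⟩
    · rw [wsize_eq (weightOf k 0 a)]
      simp only [weightOf_apply]
      rw [← sum_of_mem_rearr hmu hf, ← sum_of_mem_rearr hnu hg, mul_sum, wsize_eq lam]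
      simp only [← ha, sum_add_distrib, sum_sub_distrib]
      ring
    · intro i hi
      obtain ⟨r, rfl⟩ := exists_fin_of_mem_Icc hi
      have h2 := cylWeight_add_mul hlam ((r : ℕ) + 1) (- a r)
      have h3 := ha r
      rw [hcast mu hmu w hw, hcast nu hnu w' hw'] at h3
      rw [yTrans, weightOf_apply, show ((r : ℕ) : ℤ) + 1 - k * a r = (r : ℕ) + 1 + -a r * k by ring,
        h2]
      linarith

omit [NeZero k] in
-- The function `-w` is a weight with `n = k`, so `wsize_cylLoop` applies.
theorem sum_shift {w : ℤ → ℤ} (hw : ∀ m, w (m + k) = w m + k) (d : ℤ) :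
    ∑ m ∈ Icc (1 : ℤ) k, w (m - d) = ∑ m ∈ Icc (1 : ℤ) k, w m - k * d := by
  have h := wsize_cylLoop (k := k) (n := k) (l := fun m => - w m)
    (fun m => by simp only [hw]; ring) d
  simp only [wsize, cylLoop_apply, sum_neg_distrib] at h
  linarith

omit [NeZero k] in
-- Conjugation by shifts moves an arbitrary position to the end of the window.
theorem conj_tau_mem_affSym {w : Equiv.Perm ℤ} (hw : w ∈ affSym k) (c : ℤ) :
    tau ^ c * w * tau ^ (-c) ∈ affSym k := by
  have happ : ∀ m, (tau ^ c * w * tau ^ (-c)) m = w (m - -c) - c := by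
    intro m
    rw [Equiv.Perm.mul_apply, Equiv.Perm.mul_apply, tau_zpow_apply, tau_zpow_apply]
  refine ⟨fun m => ?_, ?_⟩
  · rw [happ, happ, show m + k - -c = m - -c + k by ring, hw.1]; ring
  · simp only [happ, sum_sub_distrib, sum_shift hw.1, hw.2]
    simp

/-- If `nu j < mu j`, monotonicity forces `w⁻¹` to send every position up to `j` strictly below `j`.
After moving `j` to `k`, the period shifts of this permutation are all nonpositive and one is
negative, while in the affine symmetric group they sum to zero. -/
theorem le_of_comp_le {mu nu : ℤ → ℤ} (hmu : Antitone mu) (hnu : Antitone nu) {w : Equiv.Perm ℤ}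
    (hw : w ∈ affSym k) (h : ∀ i, mu (w i) ≤ nu i) (j : ℤ) : mu j ≤ nu j := by
  by_contra hj
  have h1 : ∀ i ≤ j, w⁻¹ i < j := by
    intro i hi
    by_contra h2
    have h3 := h (w⁻¹ i)
    rw [perm_apply_inv] at h3
    have h4 := hmu hi
    have h5 := hnu (not_lt.1 h2)
    omega
  obtain ⟨σ, a, hσ⟩ := exists_eq_affPerm
    (conj_tau_mem_affSym (inv_mem_affSym hw) (j - k)).1
  have hmem := conj_tau_mem_affSym (inv_mem_affSym hw) (j - k)
  rw [hσ, affPerm_mem_affSym] at hmem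
  have h2 : ∀ i ≤ (k : ℤ), affPerm σ a i < k := by
    intro i hi
    rw [← hσ, Equiv.Perm.mul_apply, Equiv.Perm.mul_apply, tau_zpow_apply, tau_zpow_apply]
    have := h1 (i - -(j - k)) (by omega)
    omega
  have hk := Nat.pos_of_ne_zero (NeZero.ne k)
  have h3 : ∀ r, a r * k < (0 + 1) * k - (σ r : ℕ) - 1 := by
    intro r
    have := h2 ((r : ℕ) + 1) (by have := r.2; omega)
    rw [affPerm_apply_fin] at this
    omega
  have hle : ∀ r, a r ≤ 0 := by
    intro r
    have h4 : a r * (k : ℤ) < 1 * k := by have := h3 r; omega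
    have := lt_of_mul_lt_mul_right h4 (by omega)
    omega
  have hlt : a (σ.symm ⟨k - 1, by omega⟩) < 0 := by
    have h4 := h3 (σ.symm ⟨k - 1, by omega⟩)
    rw [Equiv.apply_symm_apply] at h4
    simp only [Nat.cast_sub hk, Nat.cast_one] at h4
    by_contra h5
    have : 0 ≤ a (σ.symm ⟨k - 1, by omega⟩) * (k : ℤ) := mul_nonneg (not_lt.1 h5) (by omega)
    omega
  have := Finset.sum_lt_sum (s := univ) (f := a) (g := fun _ => 0) (fun r _ => hle r)
    ⟨_, mem_univ _, hlt⟩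
  rw [hmem] at this
  simp at this

theorem nonneg_of_le_cylLoop {mu nu : ℤ → ℤ} (hmu : mu ∈ alcove k n) (hnu : nu ∈ alcove k n)
    {d : ℤ} (h : ∀ i, mu i ≤ cylLoop nu d i) : 0 ≤ d := by
  have h1 := h k
  rw [cylLoop_apply] at h1
  have h2 := (alcove_apply_pos_iff hnu (k - d)).1 (hmu.2.2.2.trans_le h1)
  omega

theorem cylChiFactor_eq_ncard {mu : ℤ → ℤ} (hmu : mu ∈ alcove k n) (nu : ℤ → ℤ) (d : ℤ) :
    cylChiFactor k nu d mu =
      Set.ncard {φ | (∃ w ∈ affSym k, mu ∘ w = φ) ∧ ∀ i, φ i ≤ cylLoop nu d i} := by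
  have hb := minReps_affSym_bijOn hmu
  rw [cylChiFactor]
  refine Set.ncard_congr (fun w _ => mu ∘ w) ?_ ?_ ?_
  · exact fun w hw => ⟨⟨w, hw.1.1, rfl⟩, hw.2⟩
  · exact fun w w' hw hw' h => hb.injOn hw.1 hw'.1 h
  · rintro φ ⟨h1, h2⟩
    obtain ⟨w, hw, rfl⟩ := hb.surjOn h1
    exact ⟨w, ⟨hw, h2⟩, rfl⟩

theorem le_cylLoop_of_cylChiFactor_ne_zero {mu nu : ℤ → ℤ} (hmu : mu ∈ alcove k n)
    (hnu : nu ∈ alcove k n) {d : ℤ} (h : cylChiFactor k nu d mu ≠ 0) (i : ℤ) :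
    mu i ≤ cylLoop nu d i := by
  obtain ⟨w, hw, hle⟩ := Set.nonempty_of_ncard_ne_zero h
  refine le_of_comp_le (alcove_antitone hmu) ?_ hw.1 hle i
  intro i j hij
  rw [cylLoop_apply, cylLoop_apply]
  exact alcove_antitone hnu (by omega)

/-- Weights in one affine orbit have equal size, so pointwise comparison forces equality. Hence the
constant tail of a plane partition contributes factors 1. -/
theorem cylChiFactor_self {mu : ℤ → ℤ} (hmu : mu ∈ alcove k n) : cylChiFactor k mu 0 mu = 1 := by
  rw [cylChiFactor_eq_ncard hmu, Set.ncard_eq_one]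
  refine ⟨mu, Set.eq_singleton_iff_unique_mem.2 ⟨⟨⟨1, finSym_subset_affSym one_mem_finSym, rfl⟩,
    fun i => by simp [cylLoop]⟩, ?_⟩⟩
  rintro φ ⟨⟨w, hw, rfl⟩, h⟩
  refine cylWeight_ext (cylWeight_comp hmu.1 hw.1) hmu.1 fun r => ?_
  have h1 := wsize_comp_affSym hmu.1 hw
  rw [wsize_eq, wsize_eq] at h1
  refine (Finset.sum_eq_sum_iff_of_le fun r _ => ?_).1 h1 r (mem_univ r)
  simpa [cylLoop] using h ((r : ℕ) + 1)

/-- The pair `(f, g)` corresponds to the loop `nu - f` shifted by `d`. The congruence says that `nu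
- f` arises from `mu` by a periodic permutation, and the shift brings that permutation into the
affine symmetric group. -/
theorem cylChiFactor_eq_card {mu nu : ℤ → ℤ} (hmu : mu ∈ alcove k n) (hnu : nu ∈ cylWeight k n)
    {d : ℤ} {r : ℕ} (hr : (r : ℤ) = n * d + wsize k nu - wsize k mu) :
    cylChiFactor k nu d mu = #{p ∈ finsuppAntidiag (univ : Finset (Fin k)) r ×ˢ rearr k mu |
      ∀ i : Fin k, (n : ℤ) ∣ p.1 i + p.2 i - nu ((i : ℕ) + 1)} := by
  have hk := Nat.pos_of_ne_zero (NeZero.ne k)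
  have hn : (0 : ℤ) < n := (alcove_pos hmu ⟨0, hk⟩).trans_le (alcove_le hmu _)
  have hdom := alcove_subset_dominantWeight hmu
  rw [cylChiFactor_eq_ncard hmu, ← Set.ncard_coe_finset]
  symm
  refine Set.ncard_congr
    (fun p _ => cylLoop (weightOf k n fun i => nu ((i : ℕ) + 1) - p.1 i) d) ?_ ?_ ?_
  · rintro ⟨f, g⟩ h
    simp only [coe_filter, mem_product, Set.mem_ofPred_eq, mem_finsuppAntidiag] at h
    obtain ⟨⟨⟨hf, -⟩, hg⟩, hdvd⟩ := h
    choose a ha using hdvd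
    obtain ⟨σ, hσ⟩ := (mem_rearr_cast hdom).1 hg
    have hsum : ∑ i, a i = d := by
      have h1 := sum_of_mem_rearr hdom hg
      have h2 : ∑ i, (f i : ℤ) = r := by exact_mod_cast hf
      have h3 : n * ∑ i, a i = n * d := by
        rw [mul_sum]
        simp only [← ha, sum_add_distrib, sum_sub_distrib]
        rw [h1, h2, ← wsize_eq, hr]; ring
      exact mul_left_cancel₀ hn.ne' h3
    have hψ : mu ∘ affPerm σ a = weightOf k n fun i => nu ((i : ℕ) + 1) - f i := by
      refine cylWeight_ext (cylWeight_comp hmu.1 (affPerm_add σ a)) (weightOf_mem _) fun i => ?_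
      rw [Function.comp_apply, affPerm_apply_fin, cylWeight_pos hmu.1, weightOf_apply, ← hσ]
      linarith [ha i]
    -- The quotients sum to `d`, so `affPerm σ a` raises the window sum by `k d`; composing with
    -- `tau ^ d` cancels this.
    refine ⟨⟨affPerm σ a * tau ^ d, ⟨?_, ?_⟩, ?_⟩, ?_⟩
    · intro m
      rw [Equiv.Perm.mul_apply, Equiv.Perm.mul_apply, tau_zpow_apply, tau_zpow_apply,
        ← affPerm_add]
      congr 1; ring
    · simp only [Equiv.Perm.mul_apply, tau_zpow_apply]
      rw [sum_shift (affPerm_add σ a), sum_affPerm, hsum]; ring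
    · rw [← hψ]; rfl
    · intro i
      rw [cylLoop_apply, cylLoop_apply]
      obtain ⟨q, s, hs⟩ := exists_eq_mul_add_fin k (i - d)
      rw [hs, cylWeight_pos (weightOf_mem _), cylWeight_pos hnu, weightOf_apply]
      simp
  · rintro ⟨f, g⟩ ⟨f', g'⟩ h h' heq
    simp only [coe_filter, mem_product, Set.mem_ofPred_eq, mem_finsuppAntidiag] at h h'
    have hff : ∀ i, f i = f' i := by
      intro i
      have h1 := congrFun heq ((i : ℕ) + 1 + d)
      simp only [cylLoop_apply, add_sub_cancel_right, weightOf_apply] at h1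
      omega
    obtain ⟨σ, hσ⟩ := (mem_rearr_cast hdom).1 h.1.2
    obtain ⟨σ', hσ'⟩ := (mem_rearr_cast hdom).1 h'.1.2
    refine Prod.ext (Finsupp.ext hff) (Finsupp.ext fun i => ?_)
    -- Once `f = f'`, the entries of `g` and `g'` are congruent modulo `n` and lie in `{1, …, n}`,
    -- hence agree.
    have h1 := dvd_sub (h.2 i) (h'.2 i)
    simp only [hff] at h1 ⊢
    rw [show (f' i : ℤ) + g i - nu ((i : ℕ) + 1) - (f' i + g' i - nu ((i : ℕ) + 1)) =
      g i - g' i by ring] at h1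
    have h2 := alcove_pos hmu (σ i)
    have h3 := alcove_le hmu (σ i)
    have h4 := alcove_pos hmu (σ' i)
    have h5 := alcove_le hmu (σ' i)
    have h6 := Int.eq_zero_of_abs_lt_dvd h1
      (by rw [abs_lt, hσ, hσ']; constructor <;> omega)
    omega
  · rintro φ ⟨⟨w, hw, rfl⟩, hle⟩
    have hper : ∀ m, (w * tau ^ (-d)) (m + k) = (w * tau ^ (-d)) m + k := by
      intro m
      rw [Equiv.Perm.mul_apply, Equiv.Perm.mul_apply, tau_zpow_apply, tau_zpow_apply, ← hw.1]
      congr 1; ring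
    obtain ⟨σ, a, hσ⟩ := exists_eq_affPerm hper
    have hval : ∀ i : Fin k, mu (w ((i : ℕ) + 1 + d)) = mu ((σ i : ℕ) + 1) - n * a i := by
      intro i
      rw [← cylWeight_pos hmu.1, ← affPerm_apply_fin, ← hσ, Equiv.Perm.mul_apply, tau_zpow_apply,
        sub_neg_eq_add]
    have hle' : ∀ i : Fin k, mu (w ((i : ℕ) + 1 + d)) ≤ nu ((i : ℕ) + 1) := by
      intro i
      have := hle ((i : ℕ) + 1 + d)
      rwa [cylLoop_apply, add_sub_cancel_right] at this
    let f : Fin k →₀ ℕ := Finsupp.equivFunOnFinite.symm fun i =>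
      (nu ((i : ℕ) + 1) - mu (w ((i : ℕ) + 1 + d))).toNat
    let g : Fin k →₀ ℕ := Finsupp.equivFunOnFinite.symm fun i => expVec k mu (σ i)
    have hf : ∀ i, (f i : ℤ) = nu ((i : ℕ) + 1) - mu (w ((i : ℕ) + 1 + d)) := fun i =>
      Int.toNat_of_nonneg (by have := hle' i; omega)
    have hg : ∀ i, (g i : ℤ) = mu ((σ i : ℕ) + 1) := fun i => expVec_apply_cast hdom (σ i)
    have hfr : ∑ i, (f i : ℤ) = r := by
      have h1 := wsize_cylLoop (cylWeight_comp hmu.1 hw.1) (-d)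
      rw [wsize_comp_affSym hmu.1 hw, wsize_eq] at h1
      simp only [cylLoop_apply, Function.comp_apply, sub_neg_eq_add] at h1
      simp only [hf, sum_sub_distrib]
      rw [h1, hr, ← wsize_eq]; ring
    refine ⟨(f, g), ?_, ?_⟩
    · simp only [coe_filter, mem_product, Set.mem_ofPred_eq, mem_finsuppAntidiag]
      refine ⟨⟨⟨by exact_mod_cast hfr, subset_univ _⟩, mem_rearr.2 ⟨σ, fun _ => rfl⟩⟩, fun i => ?_⟩
      exact ⟨a i, by rw [hf, hg, hval]; ring⟩
    · refine cylWeight_ext (cylLoop_mem (weightOf_mem _) d) (cylWeight_comp hmu.1 hw.1) fun i => ?_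
      obtain ⟨q, s, hs⟩ := exists_eq_mul_add_fin k ((i : ℕ) + 1 - d)
      rw [cylLoop_apply, hs, cylWeight_pos (weightOf_mem _), weightOf_apply, hf]
      have h1 := cylWeight_add_mul (cylWeight_comp hmu.1 hw.1) ((s : ℕ) + 1 + d) q
      rw [show ((s : ℕ) : ℤ) + 1 + d + q * k = (i : ℕ) + 1 by linarith] at h1
      rw [h1, Function.comp_apply]; ring

end Counting

/-! ### Cylindric reverse plane partitions as weighted paths. -/

section Paths

variable {k n : ℕ} [NeZero k]

/-- The number of pairs `(f, g)` of exponent vectors with `|f| = t`, `g` a rearrangement of `mu` and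
`f + g ≡ nu` modulo `n`. -/
noncomputable def pieriCount (k n t : ℕ) (mu nu : ℤ → ℤ) : ℕ :=
  #{p ∈ finsuppAntidiag (univ : Finset (Fin k)) t ×ˢ rearr k mu |
      ∀ i : Fin k, (n : ℤ) ∣ p.1 i + p.2 i - nu ((i : ℕ) + 1)}

omit [NeZero k] in
theorem dvd_of_pieriCount_ne_zero {t : ℕ} {mu nu : ℤ → ℤ} (hmu : mu ∈ dominantWeight k n)
    (h : pieriCount k n t mu nu ≠ 0) : (n : ℤ) ∣ t + wsize k mu - wsize k nu := by
  obtain ⟨⟨f, g⟩, hp⟩ := Finset.card_ne_zero.1 h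
  simp only [mem_filter, mem_product, mem_finsuppAntidiag] at hp
  obtain ⟨⟨⟨hf, -⟩, hg⟩, hdvd⟩ := hp
  have h1 := Finset.dvd_sum (s := univ) fun i _ => hdvd i
  rw [sum_sub_distrib, sum_add_distrib, sum_of_mem_rearr hmu hg, ← wsize_eq] at h1
  have hf' : ∑ i, (f i : ℤ) = t := by exact_mod_cast hf
  rwa [hf'] at h1

/-- The condition on consecutive loops of a cylindric reverse plane partition. -/
structure CylStep (p q : alcove k n × ℤ) (t : ℕ) : Prop where
  deg_le : p.2 ≤ q.2
  loop_le : ∀ j, p.1.1 j ≤ cylLoop q.1.1 (q.2 - p.2) j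
  weight_eq : (t : ℤ) = wsize k q.1 + n * (q.2 - p.2) - wsize k p.1

/-- The weight factor of a step. -/
noncomputable def stepFactor (p q : alcove k n × ℤ) : ℕ := cylChiFactor k q.1 (q.2 - p.2) p.1

/-- Cylindric reverse plane partitions of weight `θ` which start at `p` and end at `(lam, d)`. -/
def cylPath (e p : alcove k n × ℤ) (θ : ℕ → ℕ) : Set (ℕ → alcove k n × ℤ) :=
  {s | s 0 = p ∧ (∀ i, CylStep (s i) (s (i + 1)) (θ i)) ∧ ∃ N, ∀ i ≥ N, s i = e}

/-- The weighted number of paths. -/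
noncomputable def pathSum (e p : alcove k n × ℤ) (θ : ℕ → ℕ) : ℕ :=
  ∑ᶠ s ∈ cylPath e p θ, ∏ᶠ i, stepFactor (s i) (s (i + 1))

/-- Weight zero means equal sizes, and comparable loops of equal size coincide; positivity then
determines the degree. -/
theorem CylStep.eq_of_weight_zero {p q : alcove k n × ℤ} (h : CylStep p q 0) : p = q := by
  have h1 := h.weight_eq
  have h2 : p.1.1 = cylLoop q.1.1 (q.2 - p.2) := by
    refine cylWeight_ext p.1.2.1 (cylLoop_mem q.1.2.1 _) fun r => ?_
    have h3 := wsize_cylLoop q.1.2.1 (q.2 - p.2)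
    have h4 : wsize k p.1.1 = wsize k (cylLoop q.1.1 (q.2 - p.2)) := by
      rw [h3]; push_cast at h1; linarith
    rw [wsize_eq, wsize_eq] at h4
    exact (Finset.sum_eq_sum_iff_of_le fun r _ => h.loop_le _).1 h4 r (mem_univ r)
  have h3 : q.2 = p.2 := by
    -- Position `k + 1` is the first where an alcove weight fails to be positive, so a positive
    -- shift would be visible there.
    have h4 := congrFun h2 (k + 1)
    rw [cylLoop_apply] at h4
    have h5 := alcove_apply_pos_iff p.1.2 (k + 1)
    have h6 := alcove_apply_pos_iff q.1.2 (k + 1 - (q.2 - p.2))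
    rw [h4] at h5
    have := h.deg_le
    have h7 := h5.symm.trans h6
    omega
  refine Prod.ext (Subtype.ext ?_) h3.symm
  rw [h2, h3, sub_self]
  simp [cylLoop]

theorem cylPath_zero (e p : alcove k n × ℤ) [Decidable (p = e)] :
    cylPath e p (fun _ => 0) = if p = e then {fun _ => e} else ∅ := by
  have key : ∀ s ∈ cylPath e p (fun _ => 0), p = e ∧ s = fun _ => e := by
    rintro s ⟨h0, h1, N, h2⟩
    have h3 : ∀ i, s i = p := by
      intro i
      induction i with
      | zero => exact h0
      | succ i ih => rw [← (h1 i).eq_of_weight_zero, ih]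
    have h4 : p = e := by rw [← h3 N, h2 N le_rfl]
    exact ⟨h4, funext fun i => by rw [h3, h4]⟩
  split_ifs with h
  · refine Set.eq_singleton_iff_unique_mem.2 ⟨⟨h.symm, fun i => ⟨le_rfl, fun j => ?_, ?_⟩, 0,
      fun _ _ => rfl⟩, fun s hs => (key s hs).2⟩
    · simp [cylLoop]
    · simp
  · exact Set.eq_empty_of_forall_notMem fun s hs => h (key s hs).1

theorem stepFactor_self (p : alcove k n × ℤ) : stepFactor p p = 1 := by
  rw [stepFactor, sub_self]
  exact cylChiFactor_self p.1.2

theorem pathSum_zero (e p : alcove k n × ℤ) [Decidable (p = e)] :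
    pathSum e p (fun _ => 0) = if p = e then 1 else 0 := by
  rw [pathSum, cylPath_zero]
  split_ifs with h
  · rw [finsum_mem_singleton]
    simp [stepFactor_self]
  · simp

theorem finprod_nat_succ {M : Type*} [CommMonoid M] {f : ℕ → M} {N : ℕ}
    (hf : ∀ i ≥ N, f i = 1) : ∏ᶠ i, f i = f 0 * ∏ᶠ i, f (i + 1) := by
  rw [finprod_eq_prod_of_mulSupport_subset (s := range (N + 1)) f,
    finprod_eq_prod_of_mulSupport_subset (s := range N) (fun i => f (i + 1)),
    Finset.prod_range_succ', mul_comm]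
  · intro i hi
    by_contra h
    exact hi (hf _ (by simp only [coe_range, Set.mem_Iio] at h; omega))
  · intro i hi
    by_contra h
    exact hi (hf _ (by simp only [coe_range, Set.mem_Iio] at h; omega))

/-- Prepend a term to a sequence. -/
def seqCons {α : Type*} (a : α) (s : ℕ → α) : ℕ → α := fun i => Nat.casesOn i a s

theorem seqCons_injective {α : Type*} (a : α) : Function.Injective (seqCons a) := by
  intro s s' h
  funext i
  exact congrFun h (i + 1)

omit [NeZero k] in
theorem cylPath_eq_biUnion (e p : alcove k n × ℤ) (θ : ℕ → ℕ) :
    cylPath e p θ = ⋃ q ∈ {q | CylStep p q (θ 0)},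
      seqCons p '' cylPath e q (fun i => θ (i + 1)) := by
  ext s
  simp only [Set.mem_iUnion, Set.mem_image, exists_prop]
  constructor
  · rintro ⟨h0, h1, N, h2⟩
    refine ⟨s 1, by have := h1 0; rwa [h0] at this, fun i => s (i + 1), ⟨rfl, fun i => h1 (i + 1), N,
      fun i hi => h2 _ (by omega)⟩, ?_⟩
    funext i
    cases i with
    | zero => exact h0.symm
    | succ i => rfl
  · rintro ⟨q, hq, s', ⟨h0, h1, N, h2⟩, rfl⟩
    refine ⟨rfl, fun i => ?_, N + 1, fun i hi => ?_⟩
    · cases i with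
      | zero => change CylStep p (s' 0) (θ 0); rw [h0]; exact hq
      | succ i => exact h1 i
    · obtain ⟨j, rfl⟩ : ∃ j, i = j + 1 := ⟨i - 1, by omega⟩
      exact h2 j (by omega)

/-- The end of a step of weight `t` from `p` to the loop `nu`. -/
noncomputable def stepEnd (p : alcove k n × ℤ) (t : ℕ) (nu : alcove k n) : alcove k n × ℤ :=
  (nu, p.2 + (t + wsize k p.1 - wsize k nu) / n)

omit [NeZero k] in
-- The size equation determines the final degree, so steps of fixed weight from `p` are parametrised
-- by a subset of the finite alcove.
theorem CylStep.eq_stepEnd [NeZero n] {p q : alcove k n × ℤ} {t : ℕ} (h : CylStep p q t) :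
    q = stepEnd p t q.1 := by
  have hn : (n : ℤ) ≠ 0 := by exact_mod_cast NeZero.ne n
  refine Prod.ext rfl ?_
  rw [stepEnd, h.weight_eq]
  simp only
  rw [show wsize k q.1 + n * (q.2 - p.2) - wsize k p.1 + wsize k p.1 - wsize k q.1 =
    n * (q.2 - p.2) by ring, Int.mul_ediv_cancel_left _ hn]
  ring

omit [NeZero k] in
theorem setOf_cylStep_eq_image [NeZero n] (p : alcove k n × ℤ) (t : ℕ) :
    {q | CylStep p q t} = stepEnd p t '' {nu | CylStep p (stepEnd p t nu) t} := by
  ext q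
  constructor
  · intro h
    exact ⟨q.1, by rw [Set.mem_ofPred_eq, ← CylStep.eq_stepEnd h]; exact h,
      (CylStep.eq_stepEnd h).symm⟩
  · rintro ⟨nu, h, rfl⟩
    exact h

theorem finite_setOf_cylStep [NeZero n] (p : alcove k n × ℤ) (t : ℕ) :
    {q | CylStep p q t}.Finite := by
  rw [setOf_cylStep_eq_image]
  exact (Set.toFinite _).image _

/-- Finiteness keeps the `finsum` in `pathSum` from taking its default value and allows it to be
split over first steps. -/
theorem cylPath_finite [NeZero n] (e p : alcove k n × ℤ) {θ : ℕ → ℕ} {M : ℕ}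
    (hθ : ∀ i ≥ M, θ i = 0) : (cylPath e p θ).Finite := by
  classical
  induction M generalizing p θ with
  | zero =>
    obtain rfl : θ = fun _ => 0 := funext fun i => hθ i (Nat.zero_le i)
    rw [cylPath_zero]
    split_ifs <;> simp
  | succ M ih =>
    rw [cylPath_eq_biUnion e p θ]
    exact (finite_setOf_cylStep p (θ 0)).biUnion fun q _ =>
      (ih q fun i hi => hθ (i + 1) (by omega)).image _

theorem stepFactor_eq_pieriCount {p q : alcove k n × ℤ} {t : ℕ} (h : CylStep p q t) :
    stepFactor p q = pieriCount k n t p.1 q.1 :=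
  cylChiFactor_eq_card p.1.2 q.1.2.1 (by rw [h.weight_eq]; ring)

/-- A nonzero count provides an affine rearrangement of the loop `p` below the new loop, and
`le_of_comp_le` passes from it to the loop itself. Sums of counts over the whole alcove therefore
add nothing beyond genuine steps. -/
theorem cylStep_of_pieriCount_ne_zero [NeZero n] {p : alcove k n × ℤ} {nu : alcove k n} {t : ℕ}
    (h : pieriCount k n t p.1 nu ≠ 0) : CylStep p (stepEnd p t nu) t := by
  have h1 := Int.mul_ediv_cancel' (dvd_of_pieriCount_ne_zero (alcove_subset_dominantWeight p.1.2) h)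
  set d := ((t : ℤ) + wsize k p.1 - wsize k nu) / n with hd
  have h2 : (t : ℤ) = n * d + wsize k nu - wsize k p.1 := by linarith
  have h3 : cylChiFactor k nu d p.1 ≠ 0 := by
    rw [cylChiFactor_eq_card p.1.2 nu.2.1 h2]; exact h
  have h4 := le_cylLoop_of_cylChiFactor_ne_zero p.1.2 nu.2 h3
  have h5 := nonneg_of_le_cylLoop p.1.2 nu.2 h4
  have h6 : (stepEnd p t nu).2 - p.2 = d := by rw [stepEnd]; simp [hd]
  refine ⟨by omega, ?_, ?_⟩
  · rw [h6]; exact h4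
  · rw [h6, h2]; simp only [stepEnd]; ring

/-- Splitting off the first step mirrors multiplication by one factor h_r. -/
theorem pathSum_succ [NeZero n] (e p : alcove k n × ℤ) {θ : ℕ → ℕ} {M : ℕ}
    (hθ : ∀ i ≥ M, θ i = 0) : pathSum e p θ =
      ∑ nu : alcove k n, pieriCount k n (θ 0) p.1 nu *
        pathSum e (stepEnd p (θ 0) nu) (fun i => θ (i + 1)) := by
  classical
  have hθ' : ∀ i ≥ M, θ (i + 1) = 0 := fun i hi => hθ (i + 1) (by omega)
  rw [pathSum, cylPath_eq_biUnion e p θ, finsum_mem_biUnion]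
  · have h1 : ∀ q ∈ {q | CylStep p q (θ 0)},
        ∑ᶠ s ∈ seqCons p '' cylPath e q (fun i => θ (i + 1)), ∏ᶠ i, stepFactor (s i) (s (i + 1)) =
        pieriCount k n (θ 0) p.1 q.1 * pathSum e q (fun i => θ (i + 1)) := by
      intro q hq
      rw [finsum_mem_image (seqCons_injective p).injOn, pathSum,
        mul_finsum_mem]
      refine finsum_mem_congr rfl fun s hs => ?_
      obtain ⟨h0, h1, N, h2⟩ := hs
      rw [finprod_nat_succ (N := N + 1)]
      · congr 1
        change stepFactor p (s 0) = _
        rw [h0, stepFactor_eq_pieriCount hq]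
      · intro i hi
        obtain ⟨j, rfl⟩ : ∃ j, i = j + 1 := ⟨i - 1, by omega⟩
        change stepFactor (s j) (s (j + 1)) = 1
        rw [h2 j (by omega), h2 (j + 1) (by omega), stepFactor_self]
    rw [finsum_mem_congr rfl h1, setOf_cylStep_eq_image, finsum_mem_image]
    · rw [finsum_mem_eq_sum_of_inter_support_eq _ (t := univ)]
      · rfl
      · ext nu
        simp only [Set.mem_inter_iff, Function.mem_support, coe_univ, Set.mem_univ, true_and,
          and_iff_right_iff_imp]
        intro h
        exact cylStep_of_pieriCount_ne_zero (left_ne_zero_of_mul h)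
    · intro nu _ nu' _ h
      exact congrArg Prod.fst h
  · intro q _ q' _ hqq'
    refine Set.disjoint_left.2 ?_
    rintro _ ⟨s, hs, rfl⟩ ⟨s', hs', h⟩
    apply hqq'
    rw [← hs.1, ← hs'.1, seqCons_injective p h]
  · exact finite_setOf_cylStep p (θ 0)
  · exact fun q _ => (cylPath_finite e q hθ').image _

omit [NeZero k] in
theorem cylDiagram_ncard {lam mu : ℤ → ℤ} {d : ℤ} (h : ∀ j, mu j ≤ cylLoop lam d j) :
    (Set.ncard {p | p ∈ cylDiagram lam d mu ∧ 1 ≤ p.1 ∧ p.1 ≤ k} : ℤ) =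
      wsize k (cylLoop lam d) - wsize k mu := by
  have h1 : {p | p ∈ cylDiagram lam d mu ∧ 1 ≤ p.1 ∧ p.1 ≤ k} =
      ((Icc (1 : ℤ) k).sigma fun a => Ioc (mu a) (cylLoop lam d a)).map
        (Equiv.sigmaEquivProd ℤ ℤ).toEmbedding := by
    ext ⟨a, b⟩
    simp only [cylDiagram, Set.mem_ofPred_eq, coe_map, Set.mem_image, mem_coe, mem_sigma, mem_Icc,
      mem_Ioc, Equiv.coe_toEmbedding]
    constructor
    · rintro ⟨⟨h1, h2⟩, h3, h4⟩
      exact ⟨⟨a, b⟩, ⟨⟨h3, h4⟩, h1, h2⟩, rfl⟩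
    · rintro ⟨⟨a', b'⟩, ⟨⟨h3, h4⟩, h1, h2⟩, h⟩
      simp only [Equiv.sigmaEquivProd_apply, Prod.mk.injEq] at h
      obtain ⟨rfl, rfl⟩ := h
      exact ⟨⟨h1, h2⟩, h3, h4⟩
  rw [h1, Set.ncard_coe_finset, card_map, card_sigma, wsize, wsize, ← sum_sub_distrib]
  push_cast
  refine sum_congr rfl fun a _ => ?_
  rw [Int.card_Ioc, Int.toNat_of_nonneg (by have := h a; omega)]

omit [NeZero k] in
theorem CylRPP.weight_eq {lam mu : alcove k n} {d : ℤ} (π : CylRPP k n lam d mu) (i : ℕ) :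
    (π.weight i : ℤ) = wsize k (π.loop (i + 1)) + n * (π.deg (i + 1) - π.deg i) -
      wsize k (π.loop i) := by
  rw [CylRPP.weight, cylDiagram_ncard (π.loop_le i), wsize_cylLoop (π.loop (i + 1)).2.1]

theorem cylChiWeight_eq_pathSum (lam : alcove k n) (d : ℤ) (mu : alcove k n) (θ : ℕ →₀ ℕ) :
    cylChiWeight lam d mu θ = pathSum (lam, d) (mu, 0) θ := by
  let F : {π : CylRPP k n lam d mu // ∀ i, π.weight i = θ i} → ℕ → alcove k n × ℤ :=
    fun π i => (π.1.loop i, π.1.deg i)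
  have hF : Function.Injective F := by
    rintro ⟨⟨l, e, _, _, _, _, _⟩, _⟩ ⟨⟨l', e', _, _, _, _, _⟩, _⟩ h
    have h1 : l = l' := funext fun i => congrArg Prod.fst (congrFun h i)
    have h2 : e = e' := funext fun i => congrArg Prod.snd (congrFun h i)
    subst h1 h2
    rfl
  have hrange : cylPath (lam, d) (mu, 0) θ = Set.range F := by
    ext s
    constructor
    · rintro ⟨h0, h1, N, h2⟩
      let π : CylRPP k n lam d mu := ⟨fun i => (s i).1, fun i => (s i).2, by rw [h0], by rw [h0],
        fun i => (h1 i).deg_le, fun i => (h1 i).loop_le, N, fun i hi => by rw [h2 i hi]; simp⟩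
      refine ⟨⟨π, fun i => ?_⟩, rfl⟩
      have h3 := π.weight_eq i
      change (π.weight i : ℤ) = wsize k (s (i + 1)).1 + n * ((s (i + 1)).2 - (s i).2) -
        wsize k (s i).1 at h3
      rw [← (h1 i).weight_eq] at h3
      exact_mod_cast h3
    · rintro ⟨⟨π, hπ⟩, rfl⟩
      refine ⟨Prod.ext π.loop_zero π.deg_zero, fun i => ⟨π.deg_le i, π.loop_le i, ?_⟩, ?_⟩
      · rw [← hπ i, π.weight_eq]
      · obtain ⟨N, hN⟩ := π.eventually_eq
        exact ⟨N, fun i hi => Prod.ext (hN i hi).1 (hN i hi).2⟩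
  rw [pathSum, hrange, finsum_mem_range hF]
  rfl

omit [NeZero k] in
theorem sum_eq_of_cylPath_nonempty {e p : alcove k n × ℤ} {θ : ℕ → ℕ} {M : ℕ}
    (hθ : ∀ i ≥ M, θ i = 0) (h : (cylPath e p θ).Nonempty) :
    ((∑ i ∈ range M, θ i : ℕ) : ℤ) = wsize k e.1 - wsize k p.1 + n * (e.2 - p.2) ∧
      p.2 ≤ e.2 := by
  obtain ⟨s, h0, h1, N, h2⟩ := h
  have h3 : ∀ m, ((∑ i ∈ range m, θ i : ℕ) : ℤ) =
      wsize k (s m).1 - wsize k p.1 + n * ((s m).2 - p.2) ∧ p.2 ≤ (s m).2 := by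
    intro m
    induction m with
    | zero => simp [h0]
    | succ m ih =>
      rw [sum_range_succ, Nat.cast_add, ih.1, (h1 m).weight_eq]
      exact ⟨by ring, ih.2.trans (h1 m).deg_le⟩
  have h4 := h3 (M + N)
  rw [h2 _ (by omega)] at h4
  rw [← h4.1]
  refine ⟨?_, h4.2⟩
  rw [Finset.sum_range_add, Finset.sum_eq_zero (s := range N) fun i _ => hθ _ (by omega), add_zero]

theorem degree_eq_of_cylChiWeight_ne_zero {lam mu : alcove k n} {d : ℤ} {θ : ℕ →₀ ℕ}
    (h : cylChiWeight lam d mu θ ≠ 0) :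
    (θ.degree : ℤ) = n * d + wsize k lam - wsize k mu ∧ 0 ≤ d := by
  rw [cylChiWeight_eq_pathSum, pathSum] at h
  have h1 : (cylPath (lam, d) (mu, 0) θ).Nonempty := by
    by_contra h2
    rw [Set.not_nonempty_iff_eq_empty] at h2
    simp [h2] at h
  have hM : ∀ i ∉ range (θ.support.sup id + 1), θ i = 0 := by
    intro i hi
    by_contra h2
    have := Finset.le_sup (f := id) (Finsupp.mem_support_iff.2 h2)
    simp only [mem_range, id] at hi this
    omega
  have h2 := sum_eq_of_cylPath_nonempty (M := θ.support.sup id + 1)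
    (fun i hi => hM i (by simpa using hi)) h1
  have h3 : θ.degree = ∑ i ∈ range (θ.support.sup id + 1), θ i := by
    rw [Finsupp.degree_apply]
    refine Finset.sum_subset (fun i hi => ?_) fun i _ hi => Finsupp.notMem_support_iff.1 hi
    by_contra h4
    exact Finsupp.mem_support_iff.1 hi (hM i h4)
  rw [h3, h2.1]
  exact ⟨by simp only; ring, h2.2⟩

end Paths

/-! ### Monomial and complete symmetric polynomials as sums over exponent vectors. -/

section MonomialSymmetric

open MvPolynomial

theorem exists_perm_of_map_univ_eq {k : ℕ} {α : Type*} [LinearOrder α] {f g : Fin k → α}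
    (h : univ.val.map f = univ.val.map g) : ∃ σ : Equiv.Perm (Fin k), ∀ r, f r = g (σ r) := by
  have h1 : ∀ (f : Fin k → α), ((List.ofFn f : List α) : Multiset α) = univ.val.map f := by
    intro f
    rw [Fin.univ_val_map]
  have h2 : ∀ (f : Fin k → α) (σ : Equiv.Perm (Fin k)),
      univ.val.map (f ∘ σ) = univ.val.map f := by
    intro f σ
    rw [← Multiset.map_map, Multiset.map_univ_val_equiv]
  have h3 : f ∘ Tuple.sort f = g ∘ Tuple.sort g := by
    apply List.ofFn_injective
    refine List.Perm.eq_of_pairwise' (r := (· ≤ ·)) (Tuple.monotone_sort f).sortedLE_ofFn.pairwise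
      (Tuple.monotone_sort g).sortedLE_ofFn.pairwise ?_
    rw [← Multiset.coe_eq_coe, h1, h1, h2, h2, h]
  refine ⟨(Tuple.sort f).symm.trans (Tuple.sort g), fun r => ?_⟩
  have := congrFun h3 ((Tuple.sort f).symm r)
  simpa using this

/-- Partitions drop zeros while exponent vectors keep them; the multiplicity of zero is recovered
from the number of variables. -/
theorem map_univ_eq_iff_filter {ι : Type*} [Fintype ι] {f g : ι → ℕ} :
    univ.val.map f = univ.val.map g ↔
      (univ.val.map f).filter (· ≠ 0) = (univ.val.map g).filter (· ≠ 0) := by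
  constructor
  · intro h; rw [h]
  · intro h
    ext a
    by_cases ha : a = 0
    · subst ha
      have key : ∀ f : ι → ℕ, (univ.val.map f).count 0 +
          Multiset.card ((univ.val.map f).filter (· ≠ 0)) = Fintype.card ι := by
        intro f
        rw [Multiset.count, Multiset.countP_eq_card_filter, add_comm, ← Multiset.card_add]
        have := Multiset.filter_add_not (· ≠ 0) (univ.val.map f)
        simp only [not_not] at this
        have h2 : ∀ s : Multiset ℕ, s.filter (fun a => 0 = a) = s.filter (fun a => a = 0) :=
          fun s => Multiset.filter_congr fun a _ => eq_comm
        rw [h2, this, Multiset.card_map]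
        rfl
      have h1 := key f
      have h2 := key g
      rw [h] at h1
      omega
    · have h1 := congrArg (Multiset.count a) h
      rwa [Multiset.count_filter_of_pos (p := fun a => a ≠ 0) ha,
        Multiset.count_filter_of_pos (p := fun a => a ≠ 0) ha] at h1

theorem sum_multiset_singleton_map {ι α : Type*} (f : ι → α) (s : Finset ι) :
    ∑ i ∈ s, ({f i} : Multiset α) = s.val.map f := by
  rw [Finset.sum_eq_multiset_sum, ← Multiset.sum_map_singleton (s.val.map f), Multiset.map_map]
  rfl

theorem filter_map_univ_eq {ι : Type*} [Fintype ι] (f : ι →₀ ℕ) :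
    (univ.val.map f).filter (· ≠ 0) = f.support.val.map f := by
  classical
  have : f.support = univ.filter fun i => f i ≠ 0 := by ext; simp
  rw [this, Finset.filter_val, Multiset.filter_map]
  rfl

variable {k : ℕ}

theorem mem_rearr_iff_parts {l : ℤ → ℤ} {f : Fin k →₀ ℕ} :
    f ∈ rearr k l ↔ f.support.val.map f = (weightPartition k l).parts := by
  have h1 : (Icc (1 : ℤ) k).val.map (fun i => (l i).toNat) = univ.val.map (expVec k l) := by
    have h2 := sum_Icc_eq_sum_fin k (fun i => ({(l i).toNat} : Multiset ℕ))
    rwa [← sum_multiset_singleton_map (fun i => (l i).toNat),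
      ← sum_multiset_singleton_map (expVec k l)]
  have h2 : (weightPartition k l).parts = (univ.val.map (expVec k l)).filter (· ≠ 0) := by
    rw [← h1]; rfl
  rw [h2, ← filter_map_univ_eq, ← map_univ_eq_iff_filter, mem_rearr]
  constructor
  · rintro ⟨σ, h⟩
    rw [show (f : Fin k → ℕ) = expVec k l ∘ σ from funext h, ← Multiset.map_map,
      Multiset.map_univ_val_equiv]
  · exact exists_perm_of_map_univ_eq

theorem prod_map_X_eq_monomial {σ R : Type*} [CommSemiring R] [DecidableEq σ] (s : Multiset σ) :
    (s.map (X : σ → MvPolynomial σ R)).prod = monomial (Multiset.toFinsupp s) 1 := by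
  induction s using Multiset.induction with
  | empty => simp
  | cons a s ih =>
    rw [Multiset.map_cons, Multiset.prod_cons, ih, ← Multiset.singleton_add, map_add,
      Multiset.toFinsupp_singleton, X, monomial_mul, one_mul]

theorem card_multiset_eq_degree {σ : Type*} [DecidableEq σ] (s : Multiset σ) :
    Multiset.card s = (Multiset.toFinsupp s).degree := by
  rw [Finsupp.degree_apply, Multiset.toFinsupp_support]
  exact (Multiset.toFinset_sum_count_eq s).symm

theorem symM_eq_sum (l : ℤ → ℤ) :
    (symM k l : MvPolynomial (Fin k) LaurentC) = ∑ f ∈ rearr k l, monomial f 1 := by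
  change msymm (Fin k) LaurentC (weightPartition k l) = _
  rw [msymm]
  refine Finset.sum_bij (fun s _ => Multiset.toFinsupp s.1.1) ?_ ?_ ?_ ?_
  · rintro ⟨s, hs⟩ -
    rw [mem_rearr_iff_parts]
    exact congrArg Nat.Partition.parts hs
  · rintro ⟨s, _⟩ - ⟨t, _⟩ - h
    exact Subtype.ext (Subtype.ext (Multiset.toFinsupp.injective h))
  · intro f hf
    rw [mem_rearr_iff_parts] at hf
    obtain ⟨s, rfl⟩ := Multiset.toFinsupp.surjective f
    have hcard : Multiset.card s =
        ((Icc (1 : ℤ) k).val.map (fun i => (l i).toNat)).sum := by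
      rw [← (weightPartition k l).parts_sum, ← hf, card_multiset_eq_degree]
      rfl
    exact ⟨⟨⟨s, hcard⟩, Nat.Partition.ext hf⟩, mem_univ _, rfl⟩
  · rintro ⟨s, _⟩ -
    exact prod_map_X_eq_monomial _

theorem hsymm_eq_sum (R : Type*) [CommRing R] (r : ℕ) :
    hsymm (Fin k) R r = ∑ f ∈ finsuppAntidiag (univ : Finset (Fin k)) r, monomial f 1 := by
  rw [hsymm]
  refine Finset.sum_bij (fun s _ => Multiset.toFinsupp s.1) ?_ ?_ ?_ ?_
  · intro s _
    rw [mem_finsuppAntidiag]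
    refine ⟨?_, subset_univ _⟩
    rw [← Finsupp.degree_eq_sum, ← card_multiset_eq_degree]
    exact s.2
  · intro s _ t _ h
    exact Subtype.ext (Multiset.toFinsupp.injective h)
  · intro f hf
    rw [mem_finsuppAntidiag] at hf
    obtain ⟨s, rfl⟩ := Multiset.toFinsupp.surjective f
    refine ⟨⟨s, ?_⟩, mem_univ _, rfl⟩
    rw [card_multiset_eq_degree, Finsupp.degree_eq_sum]
    exact hf.1
  · intro s _
    exact prod_map_X_eq_monomial _

end MonomialSymmetric

/-! ### Symmetrization and membership in the ideal. -/

section Symmetrization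

open MvPolynomial

variable {k n : ℕ}

theorem isUnit_natCast_laurent {m : ℕ} (hm : m ≠ 0) : IsUnit (m : LaurentC) := by
  have h : IsUnit ((m : ℂ)) := isUnit_iff_ne_zero.2 (Nat.cast_ne_zero.2 hm)
  have := h.map (LaurentPolynomial.C : ℂ →+* LaurentC)
  rwa [map_natCast] at this

/-- Symmetrization produces integer factors, which have to be cancelled. -/
theorem eq_zero_of_nsmul_eq_zero {M : Type*} [AddCommGroup M] [Module LaurentC M] {m : ℕ}
    (hm : m ≠ 0) {x : M} (h : m • x = 0) : x = 0 := by
  rw [← Nat.cast_smul_eq_nsmul LaurentC] at h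
  exact ((isUnit_natCast_laurent hm).smul_eq_zero).1 h

/-- The symmetrization `p ↦ ∑ σ, σ p`. -/
noncomputable def symmetrize (k : ℕ) : MvPolynomial (Fin k) LaurentC →ₗ[LaurentC] SymRing k :=
  LinearMap.codRestrict (Subalgebra.toSubmodule (symmetricSubalgebra (Fin k) LaurentC))
    (∑ σ : Equiv.Perm (Fin k), (rename σ).toLinearMap) (by
      intro p e
      simp only [LinearMap.coe_sum, Finset.sum_apply, AlgHom.toLinearMap_apply, map_sum,
        rename_rename]
      exact Equiv.sum_comp (Equiv.mulLeft e) fun σ : Equiv.Perm (Fin k) => rename σ p)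

theorem coe_symmetrize (p : MvPolynomial (Fin k) LaurentC) :
    (symmetrize k p : MvPolynomial (Fin k) LaurentC) =
      ∑ σ : Equiv.Perm (Fin k), rename σ p := by
  change (∑ σ : Equiv.Perm (Fin k), (rename σ).toLinearMap) p = _
  simp

theorem symmetrize_rename (τ : Equiv.Perm (Fin k)) (p : MvPolynomial (Fin k) LaurentC) :
    symmetrize k (rename τ p) = symmetrize k p := by
  apply Subtype.ext
  rw [coe_symmetrize, coe_symmetrize]
  simp only [rename_rename]
  exact Equiv.sum_comp (Equiv.mulRight τ) fun σ : Equiv.Perm (Fin k) => rename σ p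

theorem symmetrize_mul (s : SymRing k) (p : MvPolynomial (Fin k) LaurentC) :
    symmetrize k (s * p) = s * symmetrize k p := by
  apply Subtype.ext
  rw [coe_symmetrize, MulMemClass.coe_mul, coe_symmetrize, mul_sum]
  exact sum_congr rfl fun σ _ => by rw [map_mul, s.2 σ]

theorem symmetrize_coe (s : SymRing k) :
    symmetrize k s = Fintype.card (Equiv.Perm (Fin k)) • s := by
  apply Subtype.ext
  rw [coe_symmetrize]
  simp only [s.2 _]
  simp

theorem symmetrize_monomial_of_mem_rearr {l : ℤ → ℤ} {f : Fin k →₀ ℕ} (hf : f ∈ rearr k l) :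
    symmetrize k (monomial f 1) = symmetrize k (monomial (expVec k l) 1) := by
  obtain ⟨σ, hσ⟩ := mem_rearr.1 hf
  have h : f.mapDomain σ = expVec k l := by
    refine Finsupp.ext fun r => ?_
    obtain ⟨s, rfl⟩ := σ.surjective r
    rw [Finsupp.mapDomain_apply σ.injective, hσ]
  rw [← symmetrize_rename σ (monomial f 1), rename_monomial, h]

/-- The polynomial `x_i ^ n - z`. -/
noncomputable def powSub (k n : ℕ) (i : Fin k) : MvPolynomial (Fin k) LaurentC :=
  X i ^ n - C (LaurentPolynomial.T 1)

theorem rename_powSub (σ : Equiv.Perm (Fin k)) (i : Fin k) :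
    rename σ (powSub k n i) = powSub k n (σ i) := by
  simp [powSub]

/-- The element `p_{n+a} - z p_a`. -/
noncomputable def verlindeRel (k n a : ℕ) : SymRing k :=
  symP k (n + a) - (LaurentPolynomial.T 1 : LaurentC) • symP k a

theorem coe_verlindeRel (a : ℕ) : (verlindeRel k n a : MvPolynomial (Fin k) LaurentC) =
    ∑ i, X i ^ a * powSub k n i := by
  have h1 : ∀ r, (symP k r : MvPolynomial (Fin k) LaurentC) = ∑ i, X i ^ r := fun r => rfl
  rw [verlindeRel, AddSubgroupClass.coe_sub, SetLike.val_smul, h1, h1, smul_sum, ← sum_sub_distrib]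
  refine sum_congr rfl fun i _ => ?_
  rw [powSub, pow_add, smul_eq_C_mul]; ring

theorem symP_zero_sub : symP k n - algebraMap LaurentC (SymRing k)
    (LaurentPolynomial.T 1 * (k : LaurentC)) = verlindeRel k n 0 := by
  rw [verlindeRel, add_zero, sub_right_inj]
  have h : symP k 0 = (k : SymRing k) := by
    apply Subtype.ext
    change ∑ i : Fin k, X i ^ 0 = _
    simp
  rw [h, map_mul, map_natCast, ← Algebra.smul_def]

/-- Vieta's formula for the product of the factors `t + X j`, evaluated at its root `t = -X i`. -/
theorem sum_esymm_mul_X_pow (i : Fin k) : ∑ j ∈ range (k + 1),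
    (-1) ^ (k - j) * (esymm (Fin k) LaurentC j * X i ^ (k - j)) = 0 := by
  have h := congrArg (Polynomial.eval (-X i)) (prod_C_add_X_eq_sum_esymm LaurentC (Fin k))
  rw [Polynomial.eval_prod, Finset.prod_eq_zero (mem_univ i) (by simp), Polynomial.eval_finsetSum,
    Fintype.card_fin] at h
  rw [h]
  refine sum_congr rfl fun j _ => ?_
  rw [Polynomial.eval_mul, Polynomial.eval_C, Polynomial.eval_pow, Polynomial.eval_X, neg_pow (X i : MvPolynomial (Fin k) LaurentC)]
  ring

theorem neg_one_pow_mul_self {R : Type*} [CommRing R] (k : ℕ) :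
    ((-1) ^ k * (-1) ^ k : R) = 1 := by
  rw [← mul_pow]; simp

/-- Multiplying `sum_esymm_mul_X_pow` by `X i ^ c * (X i ^ n - z)` and summing over `i` gives a
linear recursion of order `k` with leading coefficient ±1, so the generators with `a < k` produce
all the others. -/
theorem verlindeRel_mem (a : ℕ) [NeZero k] : verlindeRel k n a ∈ verlindeIdeal k n := by
  induction a using Nat.strong_induction_on with
  | _ a ih =>
    by_cases hak : a < k
    · apply Ideal.subset_span
      rcases Nat.eq_zero_or_pos a with rfl | ha
      · left
        rw [Set.mem_singleton_iff, symP_zero_sub]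
      · right
        exact ⟨a, ha, hak, rfl⟩
    · obtain ⟨c, rfl⟩ := Nat.exists_eq_add_of_le (not_lt.1 hak)
      let e : ℕ → SymRing k := fun j =>
        ⟨esymm (Fin k) LaurentC j, esymm_isSymmetric (Fin k) LaurentC j⟩
      have h : ∑ j ∈ range (k + 1), (-1) ^ (k - j) * (e j * verlindeRel k n (k - j + c)) = 0 := by
        apply Subtype.ext
        rw [AddSubmonoidClass.coe_finsetSum, ZeroMemClass.coe_zero]
        have h1 : ∀ j, (((-1) ^ (k - j) * (e j * verlindeRel k n (k - j + c)) : SymRing k) :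
            MvPolynomial (Fin k) LaurentC) = ∑ i, ((-1) ^ (k - j) *
              (esymm (Fin k) LaurentC j * X i ^ (k - j))) * (X i ^ c * powSub k n i) := by
          intro j
          rw [MulMemClass.coe_mul, MulMemClass.coe_mul, coe_verlindeRel, mul_sum, mul_sum]
          refine sum_congr rfl fun i _ => ?_
          simp only [e, SubmonoidClass.coe_pow, NegMemClass.coe_neg, OneMemClass.coe_one]
          ring
        simp only [h1]
        rw [sum_comm]
        refine sum_eq_zero fun i _ => ?_
        rw [← sum_mul, sum_esymm_mul_X_pow, zero_mul]
      have he : e 0 = 1 := Subtype.ext (esymm_zero (Fin k) LaurentC)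
      rw [sum_range_succ', he, one_mul, Nat.sub_zero] at h
      have hmem : (-1) ^ k * verlindeRel k n (k + c) ∈ verlindeIdeal k n := by
        rw [← neg_eq_of_add_eq_zero_right h]
        refine neg_mem (sum_mem fun j hj => ?_)
        refine Ideal.mul_mem_left _ _ (Ideal.mul_mem_left _ _ (ih _ ?_))
        rw [mem_range] at hj
        omega
      have := Ideal.mul_mem_left _ ((-1) ^ k) hmem
      have hs : ((-1) ^ k * (-1) ^ k : SymRing k) = 1 := neg_one_pow_mul_self _
      rwa [← mul_assoc, hs, one_mul] at this

theorem X_pow_mul_monomial (i : Fin k) (a : ℕ) (g : Fin k →₀ ℕ) :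
    (X i ^ a * monomial g 1 : MvPolynomial (Fin k) LaurentC) =
      monomial (g + Finsupp.single i a) 1 := by
  rw [X_pow_eq_monomial, monomial_mul, one_mul, add_comm]

/-- Induction on the number of variables other than `x_i` in `x^f`. Write `x^f = x^g x_i^a` with
`x_i` absent from `x^g`. The product of `p_{n+a} - z p_a` with the symmetrized `x^g` is a sum over
`j`: some terms have fewer other variables, the rest are copies of the wanted element. -/
theorem symmetrize_monomial_mul_powSub_mem [NeZero k] (f : Fin k →₀ ℕ) (i : Fin k) :
    symmetrize k (monomial f 1 * powSub k n i) ∈ verlindeIdeal k n := by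
  obtain ⟨N, hN⟩ : ∃ N, N = #(f.support.erase i) := ⟨_, rfl⟩
  induction N using Nat.strong_induction_on generalizing f i with
  | _ N ih =>
    set g := f.erase i with hg
    set a := f i with ha
    have hf : f = g + Finsupp.single i a := by
      rw [hg, ha, Finsupp.erase_add_single]
    have hgsupp : g.support = f.support.erase i := Finsupp.support_erase
    have hig : i ∉ g.support := by rw [hgsupp]; simp
    have hsum : verlindeRel k n a * symmetrize k (monomial g 1) =
        ∑ j, symmetrize k (monomial (g + Finsupp.single j a) 1 * powSub k n j) := by
      rw [← symmetrize_mul, coe_verlindeRel, sum_mul, map_sum]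
      refine sum_congr rfl fun j _ => ?_
      rw [← X_pow_mul_monomial, mul_right_comm]
    have hmem := Ideal.mul_mem_right (symmetrize k (monomial g 1)) _ (verlindeRel_mem (n := n) a)
    rw [hsum, ← sum_add_sum_compl g.support] at hmem
    -- Here `x_j` already occurs in `x^g`, so one variable fewer differs from `x_j`.
    have h1 : ∑ j ∈ g.support,
        symmetrize k (monomial (g + Finsupp.single j a) 1 * powSub k n j) ∈ verlindeIdeal k n := by
      refine sum_mem fun j hj => ih _ ?_ _ _ rfl
      rw [hN, ← hgsupp]
      refine (card_le_card ?_).trans_lt (card_erase_lt_of_mem hj)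
      intro r hr
      rw [mem_erase, Finsupp.mem_support_iff, Finsupp.add_apply,
        Finsupp.single_apply] at hr
      rw [if_neg (Ne.symm hr.1), add_zero] at hr
      exact mem_erase.2 ⟨hr.1, Finsupp.mem_support_iff.2 hr.2⟩
    -- The transposition of `i` and `j` fixes `g`, as both exponents vanish, so each summand has the
    -- same symmetrization.
    have h2 : ∑ j ∈ g.supportᶜ,
        symmetrize k (monomial (g + Finsupp.single j a) 1 * powSub k n j) =
        #g.supportᶜ • symmetrize k (monomial f 1 * powSub k n i) := by
      refine sum_eq_card_nsmul fun j hj => ?_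
      have hj0 : g j = 0 := Finsupp.notMem_support_iff.1 (mem_compl.1 hj)
      have hi0 : g i = 0 := Finsupp.notMem_support_iff.1 hig
      have hswap : g.mapDomain (Equiv.swap i j) = g := by
        refine Finsupp.ext fun r => ?_
        obtain ⟨s, rfl⟩ := (Equiv.swap i j).surjective r
        rw [Finsupp.mapDomain_apply (Equiv.swap i j).injective]
        by_cases hsi : s = i
        · subst hsi; rw [Equiv.swap_apply_left, hi0, hj0]
        · by_cases hsj : s = j
          · subst hsj; rw [Equiv.swap_apply_right, hi0, hj0]
          · rw [Equiv.swap_apply_of_ne_of_ne hsi hsj]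
      rw [← symmetrize_rename (Equiv.swap i j), map_mul, rename_powSub, Equiv.swap_apply_right,
        rename_monomial, Finsupp.mapDomain_add, Finsupp.mapDomain_single,
        Equiv.swap_apply_right, hswap, ← hf]
    rw [h2, Ideal.add_mem_iff_right _ h1] at hmem
    have hcard : #g.supportᶜ ≠ 0 := Finset.card_ne_zero.2 ⟨i, mem_compl.2 hig⟩
    rw [← Ideal.Quotient.eq_zero_iff_mem] at hmem ⊢
    rw [map_nsmul] at hmem
    exact eq_zero_of_nsmul_eq_zero hcard hmem

end Symmetrization

/-! ### Coordinate functionals and reduction of exponents modulo n. -/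

section Coordinates

open MvPolynomial

variable {k n : ℕ}

open Classical in
/-- The linear functional sending a monomial `x^f` with `f ≡ nu` modulo `n` to
`z ^ ((|f| - |nu|) / n)`, and all other monomials to zero. -/
noncomputable def coord (k n : ℕ) (nu : ℤ → ℤ) : MvPolynomial (Fin k) LaurentC →ₗ[LaurentC] LaurentC :=
  (basisMonomials (Fin k) LaurentC).constr LaurentC fun f =>
    if ∀ i : Fin k, (n : ℤ) ∣ f i - nu ((i : ℕ) + 1) then
      LaurentPolynomial.T ((∑ i, (f i : ℤ) - wsize k nu) / n) else 0

open Classical in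
theorem coord_monomial (nu : ℤ → ℤ) (f : Fin k →₀ ℕ) :
    coord k n nu (monomial f 1) = if ∀ i : Fin k, (n : ℤ) ∣ f i - nu ((i : ℕ) + 1) then
      LaurentPolynomial.T ((∑ i, (f i : ℤ) - wsize k nu) / n) else 0 := by
  have h := (basisMonomials (Fin k) LaurentC).constr_basis LaurentC (fun f =>
    if ∀ i : Fin k, (n : ℤ) ∣ f i - nu ((i : ℕ) + 1) then
      (LaurentPolynomial.T ((∑ i, (f i : ℤ) - wsize k nu) / n) : LaurentC) else 0) f
  rw [coe_basisMonomials] at h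
  exact h

theorem monomial_mul_powSub (f : Fin k →₀ ℕ) (i : Fin k) :
    monomial f 1 * powSub k n i = monomial (f + Finsupp.single i n) 1 -
      (LaurentPolynomial.T 1 : LaurentC) • monomial f 1 := by
  rw [powSub, mul_sub, mul_comm _ (X i ^ n), X_pow_mul_monomial, smul_eq_C_mul, mul_comm (C _)]

theorem coord_monomial_mul_powSub [NeZero n] (nu : ℤ → ℤ) (f : Fin k →₀ ℕ) (i : Fin k) :
    coord k n nu (monomial f 1 * powSub k n i) = 0 := by
  classical
  have hn : (n : ℤ) ≠ 0 := by exact_mod_cast NeZero.ne n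
  rw [monomial_mul_powSub, map_sub, map_smul, coord_monomial, coord_monomial]
  have h1 : (∀ j : Fin k, (n : ℤ) ∣ ((f + Finsupp.single i n) j : ℕ) - nu ((j : ℕ) + 1)) ↔
      ∀ j : Fin k, (n : ℤ) ∣ f j - nu ((j : ℕ) + 1) := by
    refine forall_congr' fun j => ?_
    rw [Finsupp.add_apply, Nat.cast_add, add_sub_right_comm]
    refine dvd_add_left ?_
    rw [Finsupp.single_apply]
    split_ifs <;> simp
  have h2 : (∑ j, ((f + Finsupp.single i n) j : ℤ) - wsize k nu) / n =
      1 + (∑ j, (f j : ℤ) - wsize k nu) / n := by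
    have h3 : ∑ j, ((Finsupp.single i n) j : ℤ) = n := by
      have : ∑ j, (Finsupp.single i n) j = n := by
        rw [← Finsupp.degree_eq_sum, Finsupp.degree_single]
      exact_mod_cast this
    simp only [Finsupp.add_apply, Nat.cast_add, sum_add_distrib]
    rw [h3, add_sub_right_comm, Int.add_ediv_of_dvd_right (dvd_refl _), Int.ediv_self hn, add_comm]
  simp only [h1, h2]
  split_ifs
  · rw [LaurentPolynomial.T_add, smul_eq_mul, sub_self]
  · simp

theorem coord_mul_powSub [NeZero n] (nu : ℤ → ℤ) (p : MvPolynomial (Fin k) LaurentC) (i : Fin k) :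
    coord k n nu (p * powSub k n i) = 0 := by
  have h : (coord k n nu) ∘ₗ LinearMap.mulRight LaurentC (powSub k n i) = 0 := by
    refine (basisMonomials (Fin k) LaurentC).ext fun f => ?_
    rw [coe_basisMonomials, LinearMap.comp_apply, LinearMap.mulRight_apply,
      coord_monomial_mul_powSub, LinearMap.zero_apply]
  exact LinearMap.congr_fun h p

theorem coord_eq_zero_of_mem [NeZero n] (nu : ℤ → ℤ) {p : SymRing k}
    (hp : p ∈ verlindeIdeal k n) : coord k n nu p = 0 := by
  have hrel : ∀ (a : ℕ) (q : SymRing k), coord k n nu (q * verlindeRel k n a : SymRing k) = 0 := by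
    intro a q
    rw [MulMemClass.coe_mul, coe_verlindeRel, mul_sum, map_sum]
    refine sum_eq_zero fun i _ => ?_
    rw [← mul_assoc, coord_mul_powSub]
  -- `coord` is linear but not multiplicative, so the induction over the ideal has to carry all
  -- multiples of `p`.
  have key : ∀ q : SymRing k, coord k n nu (q * p : SymRing k) = 0 := by
    refine Submodule.span_induction (p := fun p _ => ∀ q : SymRing k,
      coord k n nu (q * p : SymRing k) = 0) ?_ ?_ ?_ ?_ hp
    · rintro x (hx | ⟨r, -, -, rfl⟩) q
      · rw [Set.mem_singleton_iff] at hx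
        rw [hx, symP_zero_sub]
        exact hrel 0 q
      · exact hrel r q
    · intro q; simp
    · intro x y _ _ hx hy q
      rw [mul_add, AddMemClass.coe_add, map_add, hx, hy, add_zero]
    · intro a x _ hx q
      rw [smul_eq_mul, ← mul_assoc]
      exact hx _
  have := key 1
  rwa [one_mul] at this

/-- Under `hL`, raising one exponent by `n` multiplies the value by z. The target is an arbitrary
module because the result is applied to maps into the quotient algebra. -/
theorem map_monomial_add_nsmul {W : Type*} [AddCommGroup W] [Module LaurentC W]
    {L : MvPolynomial (Fin k) LaurentC →ₗ[LaurentC] W}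
    (hL : ∀ f i, L (monomial f 1 * powSub k n i) = 0) (α f : Fin k →₀ ℕ) :
    L (monomial (f + n • α) 1) =
      (LaurentPolynomial.T (α.degree : ℤ) : LaurentC) • L (monomial f 1) := by
  induction α using Finsupp.induction_linear generalizing f with
  | zero => simp
  | add α β hα hβ =>
    rw [smul_add, ← add_assoc, hβ, hα, smul_smul, ← LaurentPolynomial.T_add, map_add, Nat.cast_add,
      add_comm]
  | single i m =>
    rw [Finsupp.degree_single]
    induction m with
    | zero => simp
    | succ m ih =>
      have h := hL (f + n • Finsupp.single i m) i
      rw [monomial_mul_powSub, map_sub, sub_eq_zero, map_smul, ih, smul_smul,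
        ← LaurentPolynomial.T_add] at h
      rw [Finsupp.single_add, smul_add, ← add_assoc, Finsupp.smul_single n i 1, smul_eq_mul,
        mul_one, h, Nat.cast_add, Nat.cast_one, add_comm]

/-- Both exponent vectors reduce to the same remainders. The exponent of z may be negative, so
invertibility of z is used. -/
theorem map_monomial_eq_of_congr [NeZero n] {W : Type*} [AddCommGroup W] [Module LaurentC W]
    {L : MvPolynomial (Fin k) LaurentC →ₗ[LaurentC] W}
    (hL : ∀ f i, L (monomial f 1 * powSub k n i) = 0) {f g : Fin k →₀ ℕ}
    (hfg : ∀ i, f i % n = g i % n) :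
    ∃ e : ℤ, L (monomial f 1) = (LaurentPolynomial.T e : LaurentC) • L (monomial g 1) := by
  let quo : (Fin k →₀ ℕ) → (Fin k →₀ ℕ) := fun f => f.mapRange (· / n) (Nat.zero_div n)
  let res : (Fin k →₀ ℕ) → (Fin k →₀ ℕ) := fun f => f.mapRange (· % n) (Nat.zero_mod n)
  have hdecomp : ∀ f, f = res f + n • quo f := fun f => Finsupp.ext fun i =>
    (Nat.mod_add_div (f i) n).symm
  have hres : res f = res g := Finsupp.ext hfg
  have h1 := map_monomial_add_nsmul hL (quo f) (res f)
  have h2 := map_monomial_add_nsmul hL (quo g) (res g)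
  rw [← hdecomp] at h1 h2
  refine ⟨((quo f).degree : ℤ) - (quo g).degree, ?_⟩
  rw [h1, h2, hres, smul_smul, ← LaurentPolynomial.T_add, sub_add_cancel]

end Coordinates

/-! ### Sorting vectors into dominant and alcove weights. -/

section Sorting

variable {k n : ℕ} [NeZero k]

theorem exists_sorted (v : Fin k → ℤ) :
    ∃ l ∈ cylWeight k n, IsSortedWeight k l ∧ ∃ σ : Equiv.Perm (Fin k),
      ∀ r, v r = l ((σ r : ℕ) + 1) := by
  -- The sign is needed because `Tuple.sort` sorts increasingly.
  let σ := Tuple.sort fun r => - v r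
  refine ⟨weightOf k n (v ∘ σ), weightOf_mem _, isSortedWeight_of_antitone ?_, σ.symm, fun r => ?_⟩
  · intro r s hrs
    have := Tuple.monotone_sort (fun r => - v r) hrs
    simp only [weightOf_apply, Function.comp_apply] at this ⊢
    exact neg_le_neg_iff.1 this
  · rw [weightOf_apply]; simp

theorem exists_dominantWeight (f : Fin k →₀ ℕ) : ∃ l ∈ dominantWeight k n, f ∈ rearr k l := by
  obtain ⟨l, hl, hs, σ, hσ⟩ := exists_sorted (n := n) fun r => (f r : ℤ)
  have hd : l ∈ dominantWeight k n := mem_dominantWeight_iff.2 ⟨hl, hs, fun r => by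
    have := hσ (σ.symm r)
    rw [Equiv.apply_symm_apply] at this
    omega⟩
  exact ⟨l, hd, (mem_rearr_cast hd).2 ⟨σ, hσ⟩⟩

theorem exists_alcove [NeZero n] (f : Fin k →₀ ℕ) :
    ∃ l ∈ alcove k n, ∃ g ∈ rearr k l, ∀ i, f i % n = g i % n := by
  have hn : (0 : ℤ) < n := by exact_mod_cast Nat.pos_of_ne_zero (NeZero.ne n)
  -- Residues are chosen in `{1, …, n}` instead of `{0, …, n - 1}`, hence the shift by one.
  obtain ⟨l, hl, hs, σ, hσ⟩ := exists_sorted (n := n) fun r => ((f r : ℤ) - 1) % n + 1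
  have ha : l ∈ alcove k n := mem_alcove_iff.2 ⟨hl, hs, fun r => by
    have := hσ (σ.symm r)
    rw [Equiv.apply_symm_apply] at this
    have h1 := Int.emod_nonneg ((f (σ.symm r) : ℤ) - 1) hn.ne'
    have h2 := Int.emod_lt_of_pos ((f (σ.symm r) : ℤ) - 1) hn
    omega⟩
  refine ⟨l, ha, Finsupp.equivFunOnFinite.symm fun r => expVec k l (σ r),
    mem_rearr.2 ⟨σ, fun _ => rfl⟩, fun i => ?_⟩
  have h1 : (expVec k l (σ i) : ℤ) = ((f i : ℤ) - 1) % n + 1 := by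
    rw [expVec_apply_cast (alcove_subset_dominantWeight ha), ← hσ]
  change f i % n = expVec k l (σ i) % n
  zify
  rw [h1, Int.emod_add_emod, sub_add_cancel]

omit [NeZero k] in
theorem sorted_eq_of_perm {l m : ℤ → ℤ} (hl : IsSortedWeight k l) (hm : IsSortedWeight k m)
    {σ : Equiv.Perm (Fin k)} (h : ∀ r : Fin k, m ((r : ℕ) + 1) = l ((σ r : ℕ) + 1)) (r : Fin k) :
    m ((r : ℕ) + 1) = l ((r : ℕ) + 1) := by
  have h1 := Tuple.unique_monotone (f := fun r : Fin k => - l ((r : ℕ) + 1)) (σ := σ) (τ := 1)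
    (fun a b hab => by
      have := hm.antitone hab
      simp only [h] at this
      exact neg_le_neg this)
    (fun a b hab => neg_le_neg (hl.antitone hab))
  have := congrFun h1 r
  simp only [Function.comp_apply, Equiv.Perm.one_apply, neg_inj] at this
  rw [h, this]

theorem eq_of_expVec_mem_rearr {l m : ℤ → ℤ} (hl : l ∈ dominantWeight k n)
    (hm : m ∈ dominantWeight k n) (h : expVec k m ∈ rearr k l) : m = l := by
  obtain ⟨σ, hσ⟩ := (mem_rearr_cast hl).1 h
  refine cylWeight_ext hm.1 hl.1 (sorted_eq_of_perm hl.2.1 hm.2.1 (σ := σ) fun r => ?_)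
  rw [← hσ, expVec_apply_cast hm]

omit [NeZero k] in
theorem eq_expVec_of_dvd {l m : ℤ → ℤ} (hl : l ∈ alcove k n) (hm : m ∈ alcove k n)
    {f : Fin k →₀ ℕ} (hf : f ∈ rearr k l) :
    (∀ i : Fin k, (n : ℤ) ∣ f i - m ((i : ℕ) + 1)) ↔ f = expVec k m := by
  constructor
  · intro h
    obtain ⟨σ, hσ⟩ := (mem_rearr_cast (alcove_subset_dominantWeight hl)).1 hf
    refine Finsupp.ext fun i => ?_
    have h1 := expVec_apply_cast (alcove_subset_dominantWeight hm) i
    have h2 := alcove_pos hl (σ i)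
    have h3 := alcove_le hl (σ i)
    have h4 := alcove_pos hm i
    have h5 := alcove_le hm i
    have h6 := Int.eq_zero_of_abs_lt_dvd (h i)
      (by rw [abs_lt, hσ]; constructor <;> omega)
    omega
  · rintro rfl i
    rw [expVec_apply_cast (alcove_subset_dominantWeight hm), sub_self]
    exact dvd_zero _

end Sorting

/-! ### The basis of monomial symmetric functions. -/

section Basis

open MvPolynomial

variable {k n : ℕ} [NeZero k] [NeZero n]

omit [NeZero n] in
-- Vectors with entries in `{1, …, n}` are determined by their residues, so only the exponent vector
-- of `m` itself contributes. This duality gives linear independence.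
theorem coord_symM (l m : alcove k n) [Decidable (l = m)] :
    coord k n m (symM k l) = if l = m then 1 else 0 := by
  classical
  have hl := alcove_subset_dominantWeight l.2
  have hm := alcove_subset_dominantWeight m.2
  rw [symM_eq_sum, map_sum]
  have h1 : ∀ f ∈ rearr k l.1, coord k n m (monomial f 1) = if f = expVec k m.1 then 1 else 0 := by
    intro f hf
    rw [coord_monomial]
    simp only [eq_expVec_of_dvd l.2 m.2 hf]
    split_ifs with h
    · have h2 : (f : Fin k →₀ ℕ) ∈ rearr k m.1 := by rw [h]; exact expVec_mem_rearr _
      rw [sum_of_mem_rearr hm h2, sub_self, Int.zero_ediv, LaurentPolynomial.T_zero]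
    · rfl
  rw [sum_congr rfl h1, sum_ite_eq']
  refine if_congr ?_ rfl rfl
  constructor
  · intro h
    exact (Subtype.ext (eq_of_expVec_mem_rearr hl hm h)).symm
  · rintro rfl
    exact expVec_mem_rearr _

/-- The error term `D` vanishes on every m_l with `l` in the alcove. Composed with symmetrization it
kills the multiples of `x_i^n - z`, so it suffices to treat monomials with exponents rearranged from
an alcove weight. -/
theorem mk_eq_sum_coord (p : SymRing k) : Ideal.Quotient.mk (verlindeIdeal k n) p =
    ∑ nu : alcove k n, coord k n nu p • verM k n nu := by
  classical
  let mkL : SymRing k →ₗ[LaurentC] GenVerlinde k n :=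
    (Ideal.Quotient.mkₐ LaurentC (verlindeIdeal k n)).toLinearMap
  let D : SymRing k →ₗ[LaurentC] GenVerlinde k n := mkL - ∑ nu : alcove k n,
    LinearMap.smulRight ((coord k n nu) ∘ₗ
      (symmetricSubalgebra (Fin k) LaurentC).val.toLinearMap) (verM k n nu)
  have hD : ∀ s, D s = Ideal.Quotient.mk (verlindeIdeal k n) s -
      ∑ nu : alcove k n, coord k n nu s • verM k n nu := by
    intro s
    simp only [D, LinearMap.sub_apply, LinearMap.coe_sum, Finset.sum_apply]
    rfl
  have hDsymM : ∀ l : alcove k n, D (symM k l) = 0 := by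
    intro l
    rw [hD]
    simp only [coord_symM]
    simp [verM]
  let L := D ∘ₗ symmetrize k
  have hL : ∀ f i, L (monomial f 1 * powSub k n i) = 0 := by
    intro f i
    have hmem := symmetrize_monomial_mul_powSub_mem (n := n) f i
    rw [LinearMap.comp_apply, hD, Ideal.Quotient.eq_zero_iff_mem.2 hmem]
    simp [coord_eq_zero_of_mem _ hmem]
  have hLmono : ∀ f, L (monomial f 1) = 0 := by
    intro f
    obtain ⟨l, hl, g, hg, hfg⟩ := exists_alcove (n := n) f
    obtain ⟨e, he⟩ := map_monomial_eq_of_congr hL hfg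
    rw [he]
    have h1 : ∀ g ∈ rearr k l, L (monomial g 1) = L (monomial (expVec k l) 1) := fun g hg =>
      congrArg D (symmetrize_monomial_of_mem_rearr hg)
    -- All rearrangements have the same symmetrization, and their sum is m_l, on which `L` is `k!`
    -- times `D`.
    have h2 : #(rearr k l) • L (monomial (expVec k l) 1) = 0 := by
      have h3 : L (symM k l) = 0 := by
        rw [LinearMap.comp_apply, symmetrize_coe, map_nsmul, hDsymM ⟨l, hl⟩, smul_zero]
      rw [symM_eq_sum, map_sum, sum_congr rfl h1, sum_const] at h3
      exact h3
    rw [h1 g hg, eq_zero_of_nsmul_eq_zero (Finset.card_ne_zero.2 ⟨_, expVec_mem_rearr l⟩) h2, smul_zero]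
  have hL0 : L = 0 := by
    refine (basisMonomials (Fin k) LaurentC).ext fun f => ?_
    rw [coe_basisMonomials]
    exact hLmono f
  have h := LinearMap.congr_fun hL0 (p : MvPolynomial (Fin k) LaurentC)
  rw [LinearMap.comp_apply, symmetrize_coe, map_nsmul, LinearMap.zero_apply] at h
  have h' := eq_zero_of_nsmul_eq_zero Fintype.card_ne_zero h
  rw [hD, sub_eq_zero] at h'
  exact h'

omit [NeZero k] in
/-- The coordinate functional on the generalised Verlinde algebra. -/
noncomputable def verCoord (nu : alcove k n) : GenVerlinde k n →ₗ[LaurentC] LaurentC :=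
  Submodule.liftQ ((verlindeIdeal k n).restrictScalars LaurentC)
    ((coord k n nu) ∘ₗ (symmetricSubalgebra (Fin k) LaurentC).val.toLinearMap)
    fun _ hp => coord_eq_zero_of_mem _ hp

theorem verCoord_verM (l m : alcove k n) [Decidable (l = m)] :
    verCoord m (verM k n l) = if l = m then 1 else 0 :=
  coord_symM l m

theorem eq_sum_verCoord (x : GenVerlinde k n) :
    x = ∑ nu : alcove k n, verCoord nu x • verM k n nu := by
  obtain ⟨p, rfl⟩ := Ideal.Quotient.mk_surjective x
  exact mk_eq_sum_coord p

/-- The basis of monomial symmetric functions. -/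
noncomputable def verBasis (k n : ℕ) [NeZero k] [NeZero n] :
    Module.Basis (alcove k n) LaurentC (GenVerlinde k n) :=
  Module.Basis.ofEquivFun
    { toFun := fun x nu => verCoord nu x
      map_add' := fun x y => funext fun nu => map_add _ x y
      map_smul' := fun a x => funext fun nu => map_smul _ a x
      invFun := fun c => ∑ nu : alcove k n, c nu • verM k n nu
      left_inv := fun x => (eq_sum_verCoord x).symm
      right_inv := fun c => by
        classical
        funext nu
        simp [verCoord_verM] }

theorem verBasis_apply (l : alcove k n) : verBasis k n l = verM k n l := by
  classical
  rw [verBasis, Module.Basis.coe_ofEquivFun]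
  change ∑ nu : alcove k n, (Pi.single l 1 : alcove k n → LaurentC) nu • verM k n nu = _
  simp [Pi.single_apply]

end Basis

/-! ### Frobenius extensions from a Gram matrix supported on an involution. -/

section Frobenius

theorem isFrobeniusExtension_of_gram {A B ι : Type*} [CommRing A] [CommRing B] [Algebra A B]
    [Nontrivial A] [Fintype ι] [DecidableEq ι] [Nonempty ι] (b : Module.Basis ι A B)
    (ε : B →ₗ[A] A) {s : ι → ι} (hs : Function.Involutive s)
    (hunit : ∀ i, IsUnit (ε (b i * b (s i)))) (hzero : ∀ i j, j ≠ s i → ε (b i * b j) = 0) :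
    IsFrobeniusExtension ε := by
  -- Pairing with `b j` reads off the coordinate at `s j` up to a unit, which makes the form
  -- nondegenerate.
  have hsum : ∀ (x : B) (j : ι), ε (x * b j) = b.repr x (s j) * ε (b (s j) * b j) := by
    intro x j
    conv_lhs => rw [← b.sum_repr x, sum_mul, map_sum]
    rw [Finset.sum_eq_single (s j)]
    · rw [smul_mul_assoc, map_smul, smul_eq_mul]
    · intro i _ hi
      rw [smul_mul_assoc, map_smul, hzero i j, smul_zero]
      rintro rfl
      exact hi (hs i).symm
    · simp
  have hunit' : ∀ j, IsUnit (ε (b (s j) * b j)) := by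
    intro j
    have := hunit (s j)
    rwa [hs j] at this
  refine ⟨?_, Module.Finite.of_basis b, Module.Projective.of_basis b, ?_, ?_⟩
  · obtain ⟨i⟩ := ‹Nonempty ι›
    intro r t hrt
    have h1 : r • b i = t • b i := by rw [Algebra.smul_def, Algebra.smul_def, hrt]
    have h2 := congrArg (fun x => b.repr x i) h1
    simpa using h2
  · intro x y hxy
    refine b.repr.injective (Finsupp.ext fun i => ?_)
    have h1 : ε (x * b (s i)) = ε (y * b (s i)) := LinearMap.congr_fun hxy (b (s i))
    rw [hsum x, hsum y, hs i] at h1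
    have h2 := hunit' (s i)
    rw [hs i] at h2
    exact h2.mul_right_cancel h1
  · intro φ
    choose u hu using hunit'
    -- The coefficient at `i` is the value of `φ` on the partner `b (s i)` divided by the Gram entry
    -- of the pair.
    refine ⟨∑ i, (φ (b (s i)) * ((u (s i))⁻¹ : Aˣ)) • b i, b.ext fun j => ?_⟩
    change ε (_ * b j) = _
    rw [hsum, ← hu j, map_sum, Finsupp.finsetSum_apply, Finset.sum_eq_single (s j)]
    · rw [map_smul, Finsupp.smul_apply, b.repr_self, Finsupp.single_eq_same, smul_eq_mul, mul_one,
        hs j, mul_assoc, Units.inv_mul, mul_one]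
    · intro i _ hi
      rw [map_smul, Finsupp.smul_apply, b.repr_self, Finsupp.single_apply, if_neg hi, smul_zero]
    · simp

end Frobenius

/-! ### Multiplication rules and the iterated Pieri rule. -/

section Products

open MvPolynomial

variable {k n : ℕ}

/-- Since both factors are homogeneous, all contributing monomials carry the same power of z and
only their number remains. -/
theorem coord_sum_mul_sum [NeZero n] (nu : ℤ → ℤ) (A B : Finset (Fin k →₀ ℕ)) {a b : ℤ}
    (hA : ∀ f ∈ A, ∑ i, (f i : ℤ) = a) (hB : ∀ f ∈ B, ∑ i, (f i : ℤ) = b) :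
    coord k n nu ((∑ f ∈ A, monomial f 1) * ∑ g ∈ B, monomial g 1) =
      LaurentPolynomial.T ((a + b - wsize k nu) / n) *
        (#{p ∈ A ×ˢ B | ∀ i : Fin k, (n : ℤ) ∣ p.1 i + p.2 i - nu ((i : ℕ) + 1)} : LaurentC) := by
  classical
  rw [sum_mul_sum, ← sum_product', map_sum]
  have h : ∀ p ∈ A ×ˢ B, coord k n nu (monomial p.1 1 * monomial p.2 1) =
      if ∀ i : Fin k, (n : ℤ) ∣ p.1 i + p.2 i - nu ((i : ℕ) + 1) then
        LaurentPolynomial.T ((a + b - wsize k nu) / n) else 0 := by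
    intro p hp
    rw [mem_product] at hp
    rw [monomial_mul, one_mul, coord_monomial]
    simp only [Finsupp.add_apply, Nat.cast_add, sum_add_distrib, hA _ hp.1, hB _ hp.2]
  rw [sum_congr rfl h, ← sum_filter, sum_const, nsmul_eq_mul, mul_comm]

variable [NeZero k] [NeZero n]

theorem verM_mul_verM {l m : ℤ → ℤ} (hl : l ∈ dominantWeight k n) (hm : m ∈ dominantWeight k n) :
    verM k n l * verM k n m = ∑ nu : alcove k n,
      (LaurentPolynomial.T ((wsize k l + wsize k m - wsize k nu) / n) *
        (cylN k n l m nu : LaurentC)) • verM k n nu := by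
  rw [verM, verM, ← map_mul, mk_eq_sum_coord]
  refine sum_congr rfl fun nu _ => ?_
  rw [MulMemClass.coe_mul, symM_eq_sum, symM_eq_sum, coord_sum_mul_sum _ _ _
    (fun f hf => sum_of_mem_rearr hl hf) (fun f hf => sum_of_mem_rearr hm hf),
    cylN_eq_card hl hm nu.2.1]

/-- The complete symmetric polynomial as an element of the ring of symmetric polynomials. -/
noncomputable def symHsymm (k r : ℕ) : SymRing k :=
  ⟨hsymm (Fin k) LaurentC r, hsymm_isSymmetric (Fin k) LaurentC r⟩

omit [NeZero k] in
theorem coe_symHsymm (r : ℕ) : (symHsymm k r : MvPolynomial (Fin k) LaurentC) =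
    ∑ f ∈ finsuppAntidiag (univ : Finset (Fin k)) r, monomial f 1 :=
  hsymm_eq_sum LaurentC r

theorem hsymm_mul_verM (r : ℕ) (m : alcove k n) :
    Ideal.Quotient.mk (verlindeIdeal k n) (symHsymm k r) * verM k n m = ∑ nu : alcove k n,
      (LaurentPolynomial.T ((r + wsize k m - wsize k nu) / n) *
        (pieriCount k n r m nu : LaurentC)) • verM k n nu := by
  rw [verM, ← map_mul, mk_eq_sum_coord]
  refine sum_congr rfl fun nu _ => ?_
  rw [MulMemClass.coe_mul, symM_eq_sum, coe_symHsymm, coord_sum_mul_sum _ _ _ (a := r)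
    (fun f hf => by exact_mod_cast (mem_finsuppAntidiag.1 hf).1)
    (fun f hf => sum_of_mem_rearr (alcove_subset_dominantWeight m.2) hf)]
  rfl

/-- The prefactor z^{`p.2`} stores the degree reached so far, so that the remaining path starts at
an arbitrary pair and the induction closes. -/
theorem prod_hsymm_mul_verM (M : ℕ) (θ : ℕ → ℕ) (hθ : ∀ i ≥ M, θ i = 0) (p : alcove k n × ℤ) :
    Ideal.Quotient.mk (verlindeIdeal k n) (∏ i ∈ range M, symHsymm k (θ i)) *
        ((LaurentPolynomial.T p.2 : LaurentC) • verM k n p.1) = ∑ lam : alcove k n,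
      (LaurentPolynomial.T
          (p.2 + ((∑ i ∈ range M, θ i : ℕ) + wsize k p.1 - wsize k lam) / n) *
        (pathSum (lam, p.2 + ((∑ i ∈ range M, θ i : ℕ) + wsize k p.1 - wsize k lam) / n) p θ :
          LaurentC)) • verM k n lam := by
  classical
  induction M generalizing θ p with
  | zero =>
    obtain rfl : θ = fun _ => 0 := funext fun i => hθ i (Nat.zero_le i)
    simp only [range_zero, prod_empty, map_one, one_mul, sum_empty, Nat.cast_zero, zero_add,
      pathSum_zero]
    rw [Finset.sum_eq_single p.1]
    · simp
    · intro lam _ hlam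
      rw [if_neg fun h => hlam (congrArg Prod.fst h).symm, Nat.cast_zero, mul_zero, zero_smul]
    · exact fun h => absurd (mem_univ _) h
  | succ M ih =>
    have hn : (n : ℤ) ≠ 0 := by exact_mod_cast NeZero.ne n
    have hθ' : ∀ i ≥ M, θ (i + 1) = 0 := fun i hi => hθ (i + 1) (by omega)
    rw [prod_range_succ', map_mul, mul_assoc, mul_smul_comm, hsymm_mul_verM, smul_sum, mul_sum]
    have h1 : ∀ nu : alcove k n,
        Ideal.Quotient.mk (verlindeIdeal k n) (∏ i ∈ range M, symHsymm k (θ (i + 1))) *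
          ((LaurentPolynomial.T p.2 : LaurentC) •
            ((LaurentPolynomial.T ((θ 0 + wsize k p.1 - wsize k nu) / n) *
              (pieriCount k n (θ 0) p.1 nu : LaurentC)) • verM k n nu)) =
        ∑ lam : alcove k n, (LaurentPolynomial.T
          (p.2 + ((∑ i ∈ range (M + 1), θ i : ℕ) + wsize k p.1 - wsize k lam) / n) *
            ((pieriCount k n (θ 0) p.1 nu * pathSum (lam, p.2 + ((∑ i ∈ range (M + 1), θ i : ℕ) +
              wsize k p.1 - wsize k lam) / n) (stepEnd p (θ 0) nu) fun i => θ (i + 1) : ℕ) :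
              LaurentC)) • verM k n lam := by
      intro nu
      -- For a nonzero count `n` divides the size difference of the first step, so the integer
      -- divisions of the two stages add up exactly.
      by_cases hc : pieriCount k n (θ 0) p.1 nu = 0
      · simp only [hc, Nat.cast_zero, mul_zero, zero_smul, smul_zero, zero_mul, sum_const_zero]
      · have h2 := ih (fun i => θ (i + 1)) hθ' (stepEnd p (θ 0) nu)
        rw [smul_smul, ← mul_assoc, ← LaurentPolynomial.T_add, mul_comm _ (Nat.cast _), mul_smul,
          mul_smul_comm]
        have h3 : (stepEnd p (θ 0) nu) =
          (nu, p.2 + ((θ 0 : ℤ) + wsize k p.1 - wsize k nu) / n) := rfl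
        rw [h3] at h2
        simp only at h2
        rw [h2, smul_sum]
        refine sum_congr rfl fun lam _ => ?_
        obtain ⟨e, he⟩ := dvd_of_pieriCount_ne_zero (alcove_subset_dominantWeight p.1.2) hc
        have h4 : p.2 + ((θ 0 : ℤ) + wsize k p.1 - wsize k nu) / n +
            ((∑ i ∈ range M, θ (i + 1) : ℕ) + wsize k nu - wsize k lam) / n =
            p.2 + ((∑ i ∈ range (M + 1), θ i : ℕ) + wsize k p.1 - wsize k lam) / n := by
          rw [he, Int.mul_ediv_cancel_left _ hn, add_assoc, add_right_inj, sum_range_succ',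
            Nat.cast_add, show ((∑ i ∈ range M, θ (i + 1) : ℕ) : ℤ) + (θ 0 : ℕ) + wsize k p.1 -
              wsize k lam = e * n + ((∑ i ∈ range M, θ (i + 1) : ℕ) + wsize k nu - wsize k lam) by
              linarith, Int.add_ediv_of_dvd_left (dvd_mul_left _ _), Int.mul_ediv_cancel _ hn]
        rw [h4, smul_smul, h3]
        congr 1
        push_cast
        ring
    rw [sum_congr rfl fun nu _ => h1 nu, sum_comm]
    refine sum_congr rfl fun lam _ => ?_
    rw [← sum_smul, ← mul_sum, ← Nat.cast_sum, pathSum_succ _ p hθ]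

/-- The product of the complete symmetric polynomials with indices in a multiset. -/
noncomputable def symHMultiset (k : ℕ) (s : Multiset ℕ) : SymRing k := (s.map (symHsymm k)).prod

omit [NeZero k] in
theorem symHsymm_zero : symHsymm k 0 = 1 := Subtype.ext (hsymm_zero (Fin k) LaurentC)

omit [NeZero k] [NeZero n] in
theorem exists_support_bound (θ : ℕ →₀ ℕ) : ∃ M, ∀ i ≥ M, θ i = 0 := by
  refine ⟨θ.support.sup id + 1, fun i hi => ?_⟩
  by_contra h
  have := Finset.le_sup (f := id) (Finsupp.mem_support_iff.2 h)
  simp only [id] at this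
  omega

omit [NeZero k] in
theorem prod_range_eq_prod_support {M : ℕ} (θ : ℕ →₀ ℕ) (hθ : ∀ i ≥ M, θ i = 0) :
    ∏ i ∈ range M, symHsymm k (θ i) = symHMultiset k (θ.support.val.map θ) := by
  rw [symHMultiset, Multiset.map_map]
  refine (Finset.prod_subset (fun i hi => ?_) fun i _ hi => ?_).symm
  · by_contra h
    exact Finsupp.mem_support_iff.1 hi (hθ i (by simpa using h))
  · rw [Finsupp.notMem_support_iff.1 hi, symHsymm_zero]

theorem sum_range_eq_degree {M : ℕ} (θ : ℕ →₀ ℕ) (hθ : ∀ i ≥ M, θ i = 0) :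
    ∑ i ∈ range M, θ i = θ.degree := by
  rw [Finsupp.degree_apply]
  refine (Finset.sum_subset (fun i hi => ?_) fun i _ hi => Finsupp.notMem_support_iff.1 hi).symm
  by_contra h
  exact Finsupp.mem_support_iff.1 hi (hθ i (by simpa using h))

theorem symHMultiset_mul_verM (θ : ℕ →₀ ℕ) (m : alcove k n) :
    Ideal.Quotient.mk (verlindeIdeal k n) (symHMultiset k (θ.support.val.map θ)) * verM k n m =
      ∑ nu : alcove k n,
        (LaurentPolynomial.T ((θ.degree + wsize k m - wsize k nu) / n) *
          (cylChiWeight nu ((θ.degree + wsize k m - wsize k nu) / n) m θ : LaurentC)) •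
            verM k n nu := by
  obtain ⟨M, hM⟩ := exists_support_bound θ
  have h := prod_hsymm_mul_verM (n := n) M θ hM (m, 0)
  simp only [LaurentPolynomial.T_zero, one_smul, zero_add, sum_range_eq_degree θ hM,
    prod_range_eq_prod_support θ hM] at h
  rw [h]
  simp only [cylChiWeight_eq_pathSum]

end Products

/-! ### Matrices of nonnegative integers with given row and column sums. -/

section Matrices

/-- Each factor is the sum of all monomials of one degree, so a coefficient counts matrices with row
sums `r` and column sums `d`. -/
theorem coeff_prod_of_degree {σ ι R : Type*} [CommSemiring R] [DecidableEq σ] [DecidableEq ι]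
    {f : ι → MvPowerSeries σ R} {r : ι → ℕ}
    (hf : ∀ i d, MvPowerSeries.coeff d (f i) = if d.degree = r i then 1 else 0)
    (s : Finset ι) (d : σ →₀ ℕ) : MvPowerSeries.coeff d (∏ i ∈ s, f i) =
      (#{l ∈ finsuppAntidiag s d | ∀ i ∈ s, (l i).degree = r i} : R) := by
  rw [MvPowerSeries.coeff_prod, card_filter, Nat.cast_sum]
  refine sum_congr rfl fun l _ => ?_
  simp only [hf]
  rw [Finset.prod_ite_zero, prod_const_one]
  split_ifs <;> simp

/-- The transpose of a finitely supported matrix. -/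
noncomputable def finsuppTranspose {α β : Type*} (A : α →₀ β →₀ ℕ) : β →₀ α →₀ ℕ :=
  (A.uncurry.equivMapDomain (Equiv.prodComm α β)).curry

theorem finsuppTranspose_apply {α β : Type*} (A : α →₀ β →₀ ℕ) (a : α) (b : β) :
    finsuppTranspose A b a = A a b := by
  simp [finsuppTranspose]

theorem finsuppTranspose_transpose {α β : Type*} (A : α →₀ β →₀ ℕ) :
    finsuppTranspose (finsuppTranspose A) = A := by
  ext a b
  rw [finsuppTranspose_apply, finsuppTranspose_apply]

theorem finsuppTranspose_mem {α β : Type*} [DecidableEq α] [DecidableEq β] {s : Finset α}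
    {t : Finset β} {c : α →₀ ℕ} {d : β →₀ ℕ} (hd : d.support ⊆ t) {A : α →₀ β →₀ ℕ}
    (hc : c.support ⊆ s)
    (hA : A ∈ {l ∈ finsuppAntidiag s d | ∀ i ∈ s, (l i).degree = c i}) :
    finsuppTranspose A ∈ {l ∈ finsuppAntidiag t c | ∀ i ∈ t, (l i).degree = d i} := by
  simp only [mem_filter, mem_finsuppAntidiag] at hA ⊢
  obtain ⟨⟨h1, h2⟩, h3⟩ := hA
  have hsum : ∀ b, ∑ a ∈ s, A a b = d b := by
    intro b
    rw [← h1, Finsupp.finsetSum_apply]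
  -- Columns outside `t` have sum zero, and natural numbers with sum zero all vanish.
  have hzero : ∀ a b, b ∉ t → A a b = 0 := by
    intro a b hb
    by_cases ha : a ∈ s
    · have h4 := hsum b
      rw [Finsupp.notMem_support_iff.1 fun h => hb (hd h)] at h4
      exact (Finset.sum_eq_zero_iff.1 h4) a ha
    · rw [Finsupp.notMem_support_iff.1 fun h => ha (h2 h), Finsupp.zero_apply]
  have hzero' : ∀ a b, a ∉ s → A a b = 0 := by
    intro a b ha
    rw [Finsupp.notMem_support_iff.1 fun h => ha (h2 h), Finsupp.zero_apply]
  refine ⟨⟨?_, ?_⟩, ?_⟩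
  · ext a
    rw [Finsupp.finsetSum_apply]
    simp only [finsuppTranspose_apply]
    by_cases ha : a ∈ s
    · rw [← h3 a ha, Finsupp.degree_apply]
      refine (sum_subset (fun b hb => ?_) fun b _ hb => Finsupp.notMem_support_iff.1 hb).symm
      by_contra h
      exact Finsupp.mem_support_iff.1 hb (hzero a b h)
    · rw [Finsupp.notMem_support_iff.1 fun h => ha (hc h)]
      exact sum_eq_zero fun b _ => hzero' a b ha
  · intro b hb
    by_contra h
    refine Finsupp.mem_support_iff.1 hb (Finsupp.ext fun a => ?_)
    rw [finsuppTranspose_apply, hzero a b h, Finsupp.zero_apply]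
  · intro b _
    rw [← hsum b, Finsupp.degree_apply]
    have h5 : ∀ a, A a b = finsuppTranspose A b a := fun a => (finsuppTranspose_apply A a b).symm
    simp only [h5]
    refine sum_subset (fun a ha => ?_) fun a _ ha => Finsupp.notMem_support_iff.1 ha
    by_contra h
    rw [Finsupp.mem_support_iff, ← h5, hzero' a b h] at ha
    exact ha rfl

theorem card_matrices_transpose {α β : Type*} [DecidableEq α] [DecidableEq β] {s : Finset α}
    {t : Finset β} {c : α →₀ ℕ} {d : β →₀ ℕ} (hd : d.support ⊆ t) (hc : c.support ⊆ s) :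
    #{l ∈ finsuppAntidiag s d | ∀ i ∈ s, (l i).degree = c i} =
      #{l ∈ finsuppAntidiag t c | ∀ i ∈ t, (l i).degree = d i} :=
  card_nbij' finsuppTranspose finsuppTranspose (fun _ h => finsuppTranspose_mem hd hc h)
    (fun _ h => finsuppTranspose_mem hc hd h) (fun _ _ => finsuppTranspose_transpose _)
    (fun _ _ => finsuppTranspose_transpose _)

end Matrices

/-! ### Expansion of the cylindric complete symmetric functions. -/

section Expansion

variable {k n : ℕ}

theorem coeff_symHsymm (r : ℕ) (d : Fin k →₀ ℕ) :
    MvPolynomial.coeff d (symHsymm k r : MvPolynomial (Fin k) LaurentC) =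
      if d.degree = r then 1 else 0 := by
  classical
  rw [coe_symHsymm, MvPolynomial.coeff_sum]
  simp only [MvPolynomial.coeff_monomial]
  rw [sum_ite_eq']
  refine if_congr ?_ rfl rfl
  rw [mem_finsuppAntidiag, Finsupp.degree_eq_sum]
  simp

/-- The duality of complete and monomial symmetric functions: both coefficients count the same
matrices, up to transposition. A common natural number is used because the two coefficients lie in
different rings. -/
theorem coeff_seriesHWeight {l : ℤ → ℤ} (θ : ℕ →₀ ℕ) :
    ∃ N : ℕ, MvPowerSeries.coeff θ (seriesHWeight k l) = N ∧
      MvPolynomial.coeff (expVec k l) (symHMultiset k (θ.support.val.map θ) :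
        MvPolynomial (Fin k) LaurentC) = N := by
  classical
  obtain ⟨M, hM⟩ := exists_support_bound θ
  refine ⟨#{A ∈ finsuppAntidiag (range M) (expVec k l) | ∀ i ∈ range M, (A i).degree = θ i},
    ?_, ?_⟩
  rotate_left
  · rw [← prod_range_eq_prod_support θ hM, ← MvPolynomial.coeff_coe,
      ← MvPolynomial.coeToMvPowerSeries.ringHom_apply, SubmonoidClass.coe_finsetProd, map_prod]
    exact coeff_prod_of_degree (r := θ) (fun i d => by
      rw [MvPolynomial.coeToMvPowerSeries.ringHom_apply, MvPolynomial.coeff_coe, coeff_symHsymm])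
      (range M) (expVec k l)
  · rw [seriesHWeight, prod_Icc_eq_prod_fin]
    change MvPowerSeries.coeff θ (∏ i : Fin k, seriesH (expVec k l i)) = _
    rw [coeff_prod_of_degree (f := fun i : Fin k => seriesH (expVec k l i)) (r := expVec k l)
      (fun i d => rfl) univ θ, card_matrices_transpose (t := range M) (fun i hi => ?_)
      (subset_univ _)]
    by_contra h
    exact Finsupp.mem_support_iff.1 hi (hM i (by simpa using h))

theorem coeff_symHMultiset_of_degree_ne {θ : ℕ →₀ ℕ} {f : Fin k →₀ ℕ} (h : f.degree ≠ θ.degree) :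
    MvPolynomial.coeff f (symHMultiset k (θ.support.val.map θ) :
        MvPolynomial (Fin k) LaurentC) = 0 := by
  have h1 : (symHMultiset k (θ.support.val.map θ) : MvPolynomial (Fin k) LaurentC).IsHomogeneous
      θ.degree := by
    obtain ⟨M, hM⟩ := exists_support_bound θ
    rw [← prod_range_eq_prod_support θ hM, SubmonoidClass.coe_finsetProd,
      ← sum_range_eq_degree θ hM]
    refine MvPolynomial.IsHomogeneous.prod _ _ _ fun i _ => ?_
    rw [coe_symHsymm]
    refine MvPolynomial.IsHomogeneous.sum _ _ _ fun g hg => ?_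
    refine MvPolynomial.isHomogeneous_monomial _ ?_
    rw [Finsupp.degree_eq_sum]
    exact (mem_finsuppAntidiag.1 hg).1
  exact h1.coeff_eq_zero h

/-- The partitions of given size with at most `k` parts. -/
def dominantOfSize (k n : ℕ) (N : ℤ) : Set (ℤ → ℤ) :=
  {nu | nu ∈ dominantWeight k n ∧ wsize k nu = N}

theorem degree_eq_wsize {l : ℤ → ℤ} (hl : l ∈ dominantWeight k n) {f : Fin k →₀ ℕ}
    (hf : f ∈ rearr k l) : (f.degree : ℤ) = wsize k l := by
  rw [← sum_of_mem_rearr hl hf, Finsupp.degree_eq_sum]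
  push_cast
  rfl

variable [NeZero k]

theorem dominantOfSize_finite (N : ℤ) : (dominantOfSize k n N).Finite := by
  refine Set.Finite.of_injOn (f := expVec k)
    (t := (finsuppAntidiag (univ : Finset (Fin k)) N.toNat : Set (Fin k →₀ ℕ))) ?_ ?_
    (Finset.finite_toSet _)
  · rintro l ⟨hl, rfl⟩
    rw [mem_coe, mem_finsuppAntidiag]
    refine ⟨?_, subset_univ _⟩
    rw [← degree_eq_wsize hl (expVec_mem_rearr l), Int.toNat_natCast, Finsupp.degree_eq_sum]
  · intro l hl m hm h
    exact expVec_injOn (n := n) ⟨hl.1.1, dominant_nonneg hl.1⟩ ⟨hm.1.1, dominant_nonneg hm.1⟩ h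

theorem eq_of_mem_rearr {l m : ℤ → ℤ} (hl : l ∈ dominantWeight k n) (hm : m ∈ dominantWeight k n)
    {f : Fin k →₀ ℕ} (hfl : f ∈ rearr k l) (hfm : f ∈ rearr k m) : m = l := by
  refine eq_of_expVec_mem_rearr hl hm ?_
  obtain ⟨σ, hσ⟩ := mem_rearr.1 hfl
  obtain ⟨τ, hτ⟩ := mem_rearr.1 hfm
  refine mem_rearr.2 ⟨τ.symm.trans σ, fun r => ?_⟩
  rw [Equiv.trans_apply, ← hσ, hτ, Equiv.apply_symm_apply]

omit [NeZero k] in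
theorem coeff_eq_of_mem_rearr (p : SymRing k) {l : ℤ → ℤ} {f : Fin k →₀ ℕ} (hf : f ∈ rearr k l) :
    MvPolynomial.coeff f (p : MvPolynomial (Fin k) LaurentC) =
      MvPolynomial.coeff (expVec k l) (p : MvPolynomial (Fin k) LaurentC) := by
  obtain ⟨σ, hσ⟩ := mem_rearr.1 hf
  have h : f.mapDomain σ = expVec k l := by
    refine Finsupp.ext fun r => ?_
    obtain ⟨s, rfl⟩ := σ.surjective r
    rw [Finsupp.mapDomain_apply σ.injective, hσ]
  rw [← h, ← MvPolynomial.coeff_rename_mapDomain σ σ.injective, p.2 σ]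

/-- A symmetric polynomial has constant coefficients on rearrangement classes, and each exponent
vector lies in the class of exactly one dominant weight. -/
theorem symHMultiset_eq_sum (n : ℕ) (θ : ℕ →₀ ℕ) : symHMultiset k (θ.support.val.map θ) =
    ∑ nu ∈ (dominantOfSize_finite (k := k) (n := n) θ.degree).toFinset,
      MvPolynomial.coeff (expVec k nu) (symHMultiset k (θ.support.val.map θ) :
        MvPolynomial (Fin k) LaurentC) • symM k nu := by
  classical
  apply Subtype.ext
  ext f
  rw [AddSubmonoidClass.coe_finsetSum, MvPolynomial.coeff_sum]
  have hterm : ∀ nu : ℤ → ℤ, MvPolynomial.coeff f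
      ((MvPolynomial.coeff (expVec k nu) (symHMultiset k (θ.support.val.map θ) :
        MvPolynomial (Fin k) LaurentC) • symM k nu : SymRing k) :
          MvPolynomial (Fin k) LaurentC) = if f ∈ rearr k nu then
          MvPolynomial.coeff f (symHMultiset k (θ.support.val.map θ) :
            MvPolynomial (Fin k) LaurentC) else 0 := by
    intro nu
    rw [SetLike.val_smul, MvPolynomial.coeff_smul, symM_eq_sum, MvPolynomial.coeff_sum]
    simp only [MvPolynomial.coeff_monomial]
    rw [sum_ite_eq']
    split_ifs with h
    · rw [smul_eq_mul, mul_one, coeff_eq_of_mem_rearr _ h]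
    · rw [smul_zero]
  rw [sum_congr rfl fun nu _ => hterm nu]
  obtain ⟨l, hl, hf⟩ := exists_dominantWeight (n := n) f
  by_cases hdeg : f.degree = θ.degree
  · rw [Finset.sum_eq_single l, if_pos hf]
    · intro m hm hml
      rw [Set.Finite.mem_toFinset] at hm
      exact if_neg fun h => hml (eq_of_mem_rearr hl hm.1 hf h)
    · intro h
      exfalso
      apply h
      rw [Set.Finite.mem_toFinset]
      exact ⟨hl, by rw [← degree_eq_wsize hl hf, hdeg]⟩
  · rw [coeff_symHMultiset_of_degree_ne hdeg]
    simp

variable [NeZero n]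

theorem natCast_laurent_injective {a b : ℕ} (h : (a : LaurentC) = b) : a = b := by
  have h1 := congrArg (fun p : LaurentC => p.coeff 0) h
  have h2 : ∀ a : ℕ, (a : LaurentC).coeff 0 = (a : ℂ) := by
    intro a
    rw [← map_natCast (LaurentPolynomial.C : ℂ →+* LaurentC), LaurentPolynomial.C_apply, if_pos rfl]
  simp only [h2] at h1
  exact_mod_cast h1

theorem verCoord_symHMultiset_mul (θ : ℕ →₀ ℕ) (l m : alcove k n) :
    verCoord l (Ideal.Quotient.mk (verlindeIdeal k n) (symHMultiset k (θ.support.val.map θ)) *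
      verM k n m) = LaurentPolynomial.T ((θ.degree + wsize k m - wsize k l) / n) *
        (cylChiWeight l ((θ.degree + wsize k m - wsize k l) / n) m θ : LaurentC) := by
  classical
  rw [symHMultiset_mul_verM, map_sum, Finset.sum_eq_single l]
  · rw [map_smul, verCoord_verM, if_pos rfl, smul_eq_mul, mul_one]
  · intro nu _ hnu
    rw [map_smul, verCoord_verM, if_neg hnu, smul_zero]
  · exact fun h => absurd (mem_univ _) h

omit [NeZero k] in
theorem ediv_eq_of_degree {l m : ℤ → ℤ} {d : ℤ} {N : ℕ}
    (h : (N : ℤ) = n * d + wsize k l - wsize k m) : ((N : ℤ) + wsize k m - wsize k l) / n = d := by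
  have hn : (n : ℤ) ≠ 0 := by exact_mod_cast NeZero.ne n
  rw [h, show n * d + wsize k l - wsize k m + wsize k m - wsize k l = n * d by ring,
    Int.mul_ediv_cancel_left _ hn]

/-- Symmetry of h_{λ/d/μ} in its variables: the path sums are coefficients of a product of h_r,
which depends on neither the order of the factors nor factors h_0 = 1. -/
theorem cylChiWeight_congr (l m : alcove k n) (d : ℤ) {θ θ' : ℕ →₀ ℕ}
    (h : θ.support.val.map θ = θ'.support.val.map θ') :
    cylChiWeight l d m θ = cylChiWeight l d m θ' := by
  have hdeg : θ.degree = θ'.degree := by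
    have := congrArg Multiset.sum h
    exact this
  by_cases hd : (θ.degree : ℤ) = n * d + wsize k l - wsize k m
  · have h1 := verCoord_symHMultiset_mul θ l m
    have h2 := verCoord_symHMultiset_mul θ' l m
    rw [← hdeg, ← h, h1, ediv_eq_of_degree hd] at h2
    exact natCast_laurent_injective ((LaurentPolynomial.isUnit_T d).mul_left_cancel h2)
  · have h0 : ∀ θ : ℕ →₀ ℕ, ¬ (θ.degree : ℤ) = n * d + wsize k l - wsize k m →
        cylChiWeight l d m θ = 0 := fun θ hθ => by
      by_contra h
      exact hθ (degree_eq_of_cylChiWeight_ne_zero h).1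
    rw [h0 θ hd, h0 θ' (by rwa [← hdeg])]

/-- Two evaluations of the coefficient of m_l in h_θ m_m are compared: the path sum, and the product
rule after expanding h_θ in the m_ν. -/
theorem cylChiWeight_eq_sum (l m : alcove k n) (d : ℤ) (θ : ℕ →₀ ℕ) :
    (cylChiWeight l d m θ : ℤ) =
      ∑ nu ∈ (dominantOfSize_finite (k := k) (n := n)
        (n * d + wsize k l - wsize k m)).toFinset,
        (cylN k n m nu l : ℤ) * MvPowerSeries.coeff θ (seriesHWeight k nu) := by
  choose N hN hN' using fun nu : ℤ → ℤ => coeff_seriesHWeight (k := k) (l := nu) θ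
  by_cases hd : (θ.degree : ℤ) = n * d + wsize k l - wsize k m
  · simp only [hN]
    have h1 := verCoord_symHMultiset_mul θ l m
    rw [symHMultiset_eq_sum n θ, map_sum, sum_mul, map_sum, ediv_eq_of_degree hd] at h1
    have hterm : ∀ nu ∈ (dominantOfSize_finite (k := k) (n := n) θ.degree).toFinset,
        verCoord l (Ideal.Quotient.mk (verlindeIdeal k n)
          (MvPolynomial.coeff (expVec k nu) (symHMultiset k (θ.support.val.map θ) :
          MvPolynomial (Fin k) LaurentC) • symM k nu) * verM k n m) =
        LaurentPolynomial.T d * ((cylN k n m nu l * N nu : ℕ) : LaurentC) := by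
      intro nu hnu
      classical
      rw [Set.Finite.mem_toFinset] at hnu
      have h2 : Ideal.Quotient.mk (verlindeIdeal k n)
          (MvPolynomial.coeff (expVec k nu) (symHMultiset k (θ.support.val.map θ) :
          MvPolynomial (Fin k) LaurentC) • symM k nu) = (N nu : LaurentC) • verM k n nu := by
        rw [hN']; rfl
      rw [h2, smul_mul_assoc, mul_comm (verM k n nu),
        verM_mul_verM (alcove_subset_dominantWeight m.2) hnu.1, map_smul, map_sum,
        Finset.sum_eq_single l]
      · rw [map_smul, verCoord_verM, if_pos rfl, hnu.2, add_comm (wsize k m.1),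
          ediv_eq_of_degree hd]
        simp only [smul_eq_mul, mul_one]
        push_cast
        ring
      · intro nu' _ hnu'
        rw [map_smul, verCoord_verM, if_neg hnu', smul_zero]
      · exact fun h => absurd (mem_univ _) h
    rw [sum_congr rfl hterm, ← mul_sum, ← Nat.cast_sum] at h1
    have h3 := natCast_laurent_injective ((LaurentPolynomial.isUnit_T d).mul_left_cancel h1)
    simp only [hd] at h3
    rw [← h3]
    push_cast
    rfl
  · have h0 : cylChiWeight l d m θ = 0 := by
      by_contra h
      exact hd (degree_eq_of_cylChiWeight_ne_zero h).1
    rw [h0, Nat.cast_zero]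
    refine (sum_eq_zero fun nu hnu => ?_).symm
    rw [Set.Finite.mem_toFinset] at hnu
    have h1 : N nu = 0 := by
      apply natCast_laurent_injective
      rw [← hN', coeff_symHMultiset_of_degree_ne, Nat.cast_zero]
      intro h
      apply hd
      rw [← h, degree_eq_wsize hnu.1 (expVec_mem_rearr nu), hnu.2]
    rw [hN, h1, Nat.cast_zero, mul_zero]

end Expansion

/-! ### The dual weight and the trace form. -/

section Trace

variable {k n : ℕ} [NeZero k] [NeZero n]

/-- The weight `n^k = (n, …, n)`. -/
noncomputable def topWeight (k n : ℕ) [NeZero k] [NeZero n] : alcove k n :=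
  ⟨weightOf k n fun _ => n, mem_alcove_iff.2 ⟨weightOf_mem _,
    isSortedWeight_of_antitone fun r s _ => by simp only [weightOf_apply, le_refl],
    fun r => by
      have := Nat.pos_of_ne_zero (NeZero.ne n)
      rw [weightOf_apply]
      omega⟩⟩

theorem topWeight_apply (r : Fin k) : (topWeight k n).1 ((r : ℕ) + 1) = n :=
  weightOf_apply (n := n) (fun _ : Fin k => (n : ℤ)) r

omit [NeZero n] in
/-- The residue of `-x` in `{1, …, n}`, for `x` in `{1, …, n}`. -/
def negResidue (n : ℕ) (x : ℤ) : ℤ := if x = n then n else n - x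

omit [NeZero n] in
theorem exists_dual (l : alcove k n) : ∃ m : alcove k n, ∃ σ : Equiv.Perm (Fin k),
    ∀ r : Fin k, negResidue n (l.1 ((r : ℕ) + 1)) = m.1 ((σ r : ℕ) + 1) := by
  obtain ⟨m, hm, hs, σ, hσ⟩ := exists_sorted (n := n) fun r : Fin k =>
    negResidue n (l.1 ((r : ℕ) + 1))
  refine ⟨⟨m, mem_alcove_iff.2 ⟨hm, hs, fun r => ?_⟩⟩, σ, hσ⟩
  have h1 := hσ (σ.symm r)
  rw [Equiv.apply_symm_apply] at h1
  have h2 := alcove_pos l.2 (σ.symm r)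
  have h3 := alcove_le l.2 (σ.symm r)
  rw [← h1, negResidue]
  split_ifs <;> omega

/-- The weight whose parts are the residues of the negatives of the parts of `l`. -/
noncomputable def dualWeight (l : alcove k n) : alcove k n := (exists_dual l).choose

/-- The congruence `f + g ≡ 0` modulo `n` determines `g` entrywise from `f`, since all entries lie
in `{1, …, n}`. -/
theorem cylN_topWeight_ne_zero_iff (l m : alcove k n) :
    cylN k n l m (topWeight k n) ≠ 0 ↔ m = dualWeight l := by
  have hl := alcove_subset_dominantWeight l.2
  have hm := alcove_subset_dominantWeight m.2
  obtain ⟨σ, hσ⟩ := (exists_dual l).choose_spec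
  change ∀ r : Fin k, negResidue n (l.1 ((r : ℕ) + 1)) = (dualWeight l).1 ((σ r : ℕ) + 1) at hσ
  rw [cylN_eq_card hl hm (topWeight k n).2.1, Finset.card_ne_zero]
  constructor
  · rintro ⟨⟨f, g⟩, h⟩
    simp only [mem_filter, mem_product, topWeight_apply] at h
    obtain ⟨⟨hf, hg⟩, hdvd⟩ := h
    obtain ⟨τ, hτ⟩ := (mem_rearr_cast hl).1 hf
    obtain ⟨ρ, hρ⟩ := (mem_rearr_cast hm).1 hg
    have hg' : g ∈ rearr k (dualWeight l).1 := by
      refine (mem_rearr_cast (alcove_subset_dominantWeight (dualWeight l).2)).2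
        ⟨τ.trans σ, fun r => ?_⟩
      rw [Equiv.trans_apply, ← hσ, ← hτ]
      have h1 := alcove_pos l.2 (τ r)
      have h2 := alcove_le l.2 (τ r)
      have h3 := alcove_pos m.2 (ρ r)
      have h4 := alcove_le m.2 (ρ r)
      have h5 := hdvd r
      rw [← hτ] at h1 h2
      rw [← hρ] at h3 h4
      obtain ⟨c, hc⟩ := h5
      rw [negResidue]
      -- As `0 < f r + g r ≤ 2 n`, the sum is `n` or `2 n`, the latter only if both entries equal
      -- `n`; these are the two branches of `negResidue`.
      have h6 : -1 < c := by
        by_contra h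
        have : (n : ℤ) * c ≤ n * (-1) := mul_le_mul_of_nonneg_left (by omega) (by omega)
        omega
      have h7 : c < 2 := by
        by_contra h
        have : (n : ℤ) * 2 ≤ n * c := mul_le_mul_of_nonneg_left (by omega) (by omega)
        omega
      obtain rfl | rfl : c = 0 ∨ c = 1 := by omega
      · rw [mul_zero] at hc
        split_ifs <;> omega
      · rw [mul_one] at hc
        split_ifs <;> omega
    exact Subtype.ext (eq_of_mem_rearr (alcove_subset_dominantWeight (dualWeight l).2) hm hg' hg)
  · rintro rfl
    refine ⟨(expVec k l.1, Finsupp.equivFunOnFinite.symm fun r =>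
      expVec k (dualWeight l).1 (σ r)), ?_⟩
    simp only [mem_filter, mem_product, topWeight_apply]
    refine ⟨⟨expVec_mem_rearr _, mem_rearr.2 ⟨σ, fun _ => rfl⟩⟩, fun r => ?_⟩
    change (n : ℤ) ∣ (expVec k l.1 r : ℤ) + (expVec k (dualWeight l).1 (σ r) : ℤ) - n
    rw [expVec_apply_cast hl, expVec_apply_cast hm, ← hσ, negResidue]
    split_ifs with h
    · rw [h, add_sub_cancel_right]
    · rw [add_sub_cancel, sub_self]
      exact dvd_zero _

omit [NeZero n] in
theorem cylN_comm {l m nu : ℤ → ℤ} (hl : l ∈ dominantWeight k n) (hm : m ∈ dominantWeight k n)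
    (hnu : nu ∈ cylWeight k n) : cylN k n l m nu = cylN k n m l nu := by
  rw [cylN_eq_card hl hm hnu, cylN_eq_card hm hl hnu]
  refine card_nbij' Prod.swap Prod.swap ?_ ?_ (fun _ _ => Prod.swap_swap _)
    (fun _ _ => Prod.swap_swap _)
  all_goals
    intro p hp
    simp only [coe_filter, mem_product, Set.mem_ofPred_eq, Prod.fst_swap, Prod.snd_swap] at hp ⊢
    exact ⟨hp.1.symm, fun r => by rw [add_comm]; exact hp.2 r⟩

/-- Being partners is a symmetric relation by `cylN_comm`, and each weight has a unique partner. -/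
theorem dualWeight_involutive : Function.Involutive (dualWeight (k := k) (n := n)) := by
  intro l
  refine ((cylN_topWeight_ne_zero_iff (dualWeight l) l).1 ?_).symm
  rw [cylN_comm (alcove_subset_dominantWeight (dualWeight l).2) (alcove_subset_dominantWeight l.2)
    (topWeight k n).2.1]
  exact (cylN_topWeight_ne_zero_iff l (dualWeight l)).2 rfl

theorem traceValue_of_ne {nu : alcove k n} (h : nu ≠ topWeight k n) : traceValue k n nu = 0 := by
  refine if_neg fun h1 => h (Subtype.ext (cylWeight_ext nu.2.1 (topWeight k n).2.1 fun r => ?_))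
  rw [topWeight_apply, h1 _ (fin_add_one_mem_Icc r)]

theorem traceValue_topWeight : traceValue k n (topWeight k n) =
    LaurentPolynomial.C ((n : ℂ) ^ k)⁻¹ * LaurentPolynomial.T (k : ℤ) := by
  refine if_pos fun i hi => ?_
  obtain ⟨r, rfl⟩ := exists_fin_of_mem_Icc hi
  exact topWeight_apply r

theorem isUnit_traceValue_topWeight : IsUnit (traceValue k n (topWeight k n)) := by
  rw [traceValue_topWeight]
  refine IsUnit.mul ?_ (LaurentPolynomial.isUnit_T _)
  refine IsUnit.map LaurentPolynomial.C (isUnit_iff_ne_zero.2 (inv_ne_zero (pow_ne_zero _ ?_)))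
  exact Nat.cast_ne_zero.2 (NeZero.ne n)

theorem trace_mul (l m : alcove k n) :
    (verBasis k n).constr LaurentC (fun l : alcove k n => traceValue k n l)
      (verBasis k n l * verBasis k n m) =
    LaurentPolynomial.T ((wsize k l + wsize k m - wsize k (topWeight k n)) / n) *
      (cylN k n l m (topWeight k n) : LaurentC) * traceValue k n (topWeight k n) := by
  rw [verBasis_apply, verBasis_apply, verM_mul_verM (alcove_subset_dominantWeight l.2)
    (alcove_subset_dominantWeight m.2), map_sum]
  have h : ∀ nu : alcove k n, (verBasis k n).constr LaurentC
      (fun l : alcove k n => traceValue k n l) (verM k n nu) = traceValue k n nu := by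
    intro nu
    rw [← verBasis_apply, Module.Basis.constr_basis]
  rw [Finset.sum_eq_single (topWeight k n)]
  · rw [map_smul, h, smul_eq_mul]
  · intro nu _ hnu
    rw [map_smul, h, traceValue_of_ne hnu, smul_zero]
  · exact fun h => absurd (mem_univ _) h

theorem verlinde_isFrobeniusExtension :
    IsFrobeniusExtension (A := LaurentC) (B := GenVerlinde k n)
      ((verBasis k n).constr LaurentC (fun l : alcove k n => traceValue k n l)) := by
  classical
  have : Nonempty (alcove k n) := ⟨topWeight k n⟩
  refine isFrobeniusExtension_of_gram (verBasis k n) _ dualWeight_involutive (fun l => ?_)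
    fun l m hm => ?_
  · rw [trace_mul]
    exact ((LaurentPolynomial.isUnit_T _).mul (isUnit_natCast_laurent
      ((cylN_topWeight_ne_zero_iff l _).2 rfl))).mul isUnit_traceValue_topWeight
  · rw [trace_mul, not_not.1 fun h => hm ((cylN_topWeight_ne_zero_iff l m).1 h), Nat.cast_zero,
      mul_zero, zero_mul]

end Trace

/-! ### Partitions as finitely supported sequences. -/

section Partitions

theorem toFinsupp_support_map {L : List ℕ} [DecidablePred fun i => L.getD i 0 ≠ 0]
    (hL : ∀ a ∈ L, a ≠ 0) : L.toFinsupp.support.val.map L.toFinsupp = (L : Multiset ℕ) := by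
  have h1 : L.toFinsupp.support = range L.length := by
    ext i
    rw [Finsupp.mem_support_iff, List.toFinsupp_apply, mem_range]
    constructor
    · intro h
      by_contra h2
      exact h (List.getD_eq_default _ _ (by omega))
    · intro h
      rw [List.getD_eq_getElem _ _ h]
      exact hL _ (List.getElem_mem h)
  rw [h1, Finset.range_val, Multiset.range, Multiset.map_coe]
  congr 1
  refine List.ext_getElem (by simp) fun i h2 h3 => ?_
  rw [List.getElem_map, List.getElem_range, List.toFinsupp_apply, List.getD_eq_getElem _ _ h3]

theorem sort_parts_toFinsupp_support_map {N : ℕ} (p : N.Partition) :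
    (p.parts.sort (· ≥ ·)).toFinsupp.support.val.map (p.parts.sort (· ≥ ·)).toFinsupp =
      p.parts := by
  rw [toFinsupp_support_map fun a ha => (p.parts_pos ((Multiset.mem_sort _).1 ha)).ne',
    Multiset.sort_eq]

theorem degree_sort_parts {N : ℕ} (p : N.Partition) :
    (p.parts.sort (· ≥ ·)).toFinsupp.degree = N := by
  have h := congrArg Multiset.sum (sort_parts_toFinsupp_support_map p)
  rw [p.parts_sum] at h
  exact h

end Partitions

/-! ### Assembly of the theorem. -/

theorem mainTheorem2 (k n : ℕ) [NeZero k] [NeZero n] :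
    (∃ b : Module.Basis (alcove k n) LaurentC (GenVerlinde k n),
      (∀ l : alcove k n, b l = verM k n l) ∧
      IsFrobeniusExtension (A := LaurentC) (B := GenVerlinde k n)
        (b.constr LaurentC (fun l : alcove k n => traceValue k n l))) ∧
    (∀ l m : alcove k n,
      verM k n l * verM k n m = ∑ nu : alcove k n,
        (LaurentPolynomial.T ((wsize k l + wsize k m - wsize k nu) / n) *
          (cylN k n l m nu : LaurentC)) • verM k n nu) ∧
    (∀ (N : ℕ) (p : N.Partition) (m : alcove k n),
      verH k n p * verM k n m = ∑ nu : alcove k n,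
        (LaurentPolynomial.T ((N + wsize k m - wsize k nu) / n) *
          (cylChi nu ((N + wsize k m - wsize k nu) / n) m p : LaurentC)) • verM k n nu) ∧
    (∀ (l m : alcove k n) (d : ℕ),
      cylH l d m = ∑ᶠ nu ∈ {nu | nu ∈ dominantWeight k n ∧
        wsize k nu = n * d + wsize k l - wsize k m}, (cylN k n m nu l : ℤ) • seriesHWeight k nu) ∧
    (∀ (l m : alcove k n) (d : ℕ),
      cylH l d m = ∑ p : Nat.Partition (n * d + wsize k l - wsize k m).toNat,
        (cylChi l d m p : ℤ) • seriesM p) := by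
  classical
  refine ⟨⟨verBasis k n, verBasis_apply, verlinde_isFrobeniusExtension⟩, fun l m =>
    verM_mul_verM (alcove_subset_dominantWeight l.2) (alcove_subset_dominantWeight m.2), ?_, ?_, ?_⟩
  · intro N p m
    have h := symHMultiset_mul_verM (p.parts.sort (· ≥ ·)).toFinsupp m
    rw [sort_parts_toFinsupp_support_map, degree_sort_parts] at h
    exact h
  · intro l m d
    have hfin := dominantOfSize_finite (k := k) (n := n) (n * d + wsize k l - wsize k m)
    rw [dominantOfSize] at hfin
    rw [finsum_mem_eq_finite_toFinset_sum _ hfin]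
    ext θ
    rw [map_sum]
    simp only [map_zsmul, smul_eq_mul]
    exact cylChiWeight_eq_sum l m d θ
  · intro l m d
    ext θ
    rw [map_sum]
    have hterm : ∀ p : Nat.Partition (n * d + wsize k l - wsize k m).toNat,
        MvPowerSeries.coeff θ ((cylChi l d m p : ℤ) • seriesM p) =
          if θ.support.val.map θ = p.parts then (cylChiWeight l d m θ : ℤ) else 0 := by
      intro p
      rw [map_zsmul, smul_eq_mul]
      change (cylChi l d m p : ℤ) * (if θ.support.val.map θ = p.parts then 1 else 0) = _
      split_ifs with h
      · rw [mul_one, cylChi, cylChiWeight_congr l m d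
          ((sort_parts_toFinsupp_support_map p).trans h.symm)]
      · rw [mul_zero]
    rw [sum_congr rfl fun p _ => hterm p]
    change (cylChiWeight l d m θ : ℤ) = _
    by_cases hdeg : θ.degree = (n * d + wsize k l - wsize k m).toNat
    -- The nonzero exponents of `θ` form the only partition whose monomial function contains the
    -- monomial with exponents `θ`.
    · let p0 : Nat.Partition (n * d + wsize k l - wsize k m).toNat :=
        ⟨θ.support.val.map θ, fun {i} hi => by
          obtain ⟨j, hj, rfl⟩ := Multiset.mem_map.1 hi
          exact Nat.pos_of_ne_zero (Finsupp.mem_support_iff.1 hj), hdeg⟩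
      rw [Finset.sum_eq_single p0, if_pos rfl]
      · intro p _ hp
        exact if_neg fun h => hp (Nat.Partition.ext h.symm)
      · exact fun h => absurd (mem_univ _) h
    · rw [sum_eq_zero]
      · have h0 : cylChiWeight l d m θ = 0 := by
          by_contra h
          have := (degree_eq_of_cylChiWeight_ne_zero h).1
          omega
        rw [h0, Nat.cast_zero]
      · intro p _
        refine if_neg fun h => hdeg ?_
        rw [← p.parts_sum, ← h]
        rfl
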